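/- Let $p>2$ and let $P\ge 2$ be an integer. For $\ell>0$ let $\mathcal G=\mathcal G_\ell$ be the regular fork graph: the metric graph consisting of one half-line, identified with $[0,\infty)$, and $P$ pendants, each identified with $[0,\ell]$, all glued at the vertex $\mathbf 0$ given by $x=0$ on every edge. Let $H^1(\mathcal G)$ be the space of continuous functions on $\mathcal G$ that are $H^1$ on every edge. A bound-state is a function $u\in H^1(\mathcal G)$, $u\not\equiv 0$, such that $$\int_{\mathcal G} u'\eta'+u\eta-|u|^{p-2}u\,\eta\,dx=0\qquad\text{for all }\eta\in H^1(\mathcal G),$$ and an action ground-state is a bound-state that minimizes $$S(u)=\frac12\int_{\mathcal G}|u'|^2+|u|^2\,dx-\frac1p\int_{\mathcal G}|u|^p\,dx$$ among all bound-states. A function on $\mathcal G$ is positive if it is $>0$ at every point. It is (core-)symmetric if its restrictions to the $P$ pendants coincide as functions of $x\in[0,\ell]$, core-increasing (resp. core-decreasing) if its restriction to each pendant is a strictly increasing (resp. strictly decreasing) function of $x\in[0,\ell]$, and increasing if it is core-increasing and strictly decreasing on the half-line $[0,\infty)$. For every $\ell>0$: 1. there exists a unique increasing symmetric positive bound-state;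 2. if $\ell\le\operatorname{arsinh}\bigl(1/\sqrt{P^2-1}\bigr)$, there are no core-decreasing symmetric positive bound-states; 3. if $\ell>\operatorname{arsinh}\bigl(1/\sqrt{P^2-1}\bigr)$, there exists a unique core-decreasing symmetric positive bound-state. Concerning action ground-states, there are $\ell_0,\ell_1>0$, depending only on $p$ and $P$, such that: (a) if $0<\ell<\ell_0$, the increasing symmetric positive bound-state of item 1 is an action ground-state, and it is the only one up to multiplication by $-1$; (b) if $\ell>\ell_1$, action ground-states exist and none of them is core-symmetric. -/

import Mathlib

open MeasureTheory Set

noncomputable section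

/-- Real functions on the regular fork graph with `P` pendants of length `ℓ`: one half-line,
identified with `[0, ∞)`, and `P` pendants, each identified with `[0, ℓ]`, all glued at `x = 0`,
the vertex `𝟎`. A function is given by its restrictions to the edges; only the values on
`[0, ∞)`, respectively on `[0, ℓ]`, are meaningful, and `SameOn` is equality on the graph.
Agreement of the edge functions at the vertex is part of `MemH1`. -/
structure ForkFun (P : ℕ) where
  halfLine : ℝ → ℝ
  pendant : Fin P → ℝ → ℝ

namespace ForkFun

variable {P : ℕ}

/-- Equality as functions on the graph. -/
def SameOn (ℓ : ℝ) (u v : ForkFun P) : Prop :=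
  EqOn u.halfLine v.halfLine (Ici 0) ∧ ∀ i, EqOn (u.pendant i) (v.pendant i) (Icc 0 ℓ)

instance : Neg (ForkFun P) := ⟨fun u => ⟨fun x => -u.halfLine x, fun i x => -u.pendant i x⟩⟩

/-- `f ∈ H¹(I)` for an interval `I`, `f` being the continuous representative: `f` is absolutely
continuous on the compact subintervals of `I`, and `f` and its derivative (which then exists almost
everywhere on `I` and is the weak derivative) are square integrable on `I`. -/
def MemH1On (I : Set ℝ) (f : ℝ → ℝ) : Prop :=
  (∀ a ∈ I, ∀ b ∈ I, AbsolutelyContinuousOnInterval f a b) ∧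
    MemLp f 2 (volume.restrict I) ∧ MemLp (deriv f) 2 (volume.restrict I)

/-- `u ∈ H¹(𝒢)`: `u` is continuous on the graph and of class `H¹` on every edge. -/
def MemH1 (ℓ : ℝ) (u : ForkFun P) : Prop :=
  MemH1On (Ici 0) u.halfLine ∧
    ∀ i, MemH1On (Icc 0 ℓ) (u.pendant i) ∧ u.pendant i 0 = u.halfLine 0

/-- The action `S(u) = ½ ∫_𝒢 (|u'|² + |u|²) - (1/p) ∫_𝒢 |u|^p`. -/
def action (p ℓ : ℝ) (u : ForkFun P) : ℝ :=
  (1 / 2) * ((∫ x in Ici (0 : ℝ), (deriv u.halfLine x ^ 2 + u.halfLine x ^ 2)) +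
      ∑ i, ∫ x in Icc 0 ℓ, (deriv (u.pendant i) x ^ 2 + u.pendant i x ^ 2)) -
    (1 / p) * ((∫ x in Ici (0 : ℝ), |u.halfLine x| ^ p) +
      ∑ i, ∫ x in Icc 0 ℓ, |u.pendant i x| ^ p)

/-- The integrand `f'g' + fg - |f|^(p-2) f g` of the weak form of `-u'' + u = |u|^(p-2) u`. -/
def weakIntegrand (p : ℝ) (f g : ℝ → ℝ) (x : ℝ) : ℝ :=
  deriv f x * deriv g x + f x * g x - |f x| ^ (p - 2) * f x * g x

/-- Bound-states: nontrivial weak solutions `u ∈ H¹(𝒢)` of `-u'' + u = |u|^(p-2) u` on `𝒢`,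
tested against all of `H¹(𝒢)`. -/
def IsBoundState (p ℓ : ℝ) (u : ForkFun P) : Prop :=
  MemH1 ℓ u ∧
  ((∃ x ∈ Ici (0 : ℝ), u.halfLine x ≠ 0) ∨ ∃ i, ∃ x ∈ Icc 0 ℓ, u.pendant i x ≠ 0) ∧
  ∀ η : ForkFun P, MemH1 ℓ η →
    (∫ x in Ici (0 : ℝ), weakIntegrand p u.halfLine η.halfLine x) +
      ∑ i, ∫ x in Icc 0 ℓ, weakIntegrand p (u.pendant i) (η.pendant i) x = 0

/-- Action ground-states: bound-states of least action among all bound-states. -/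
def IsGroundState (p ℓ : ℝ) (u : ForkFun P) : Prop :=
  IsBoundState p ℓ u ∧ ∀ v : ForkFun P, IsBoundState p ℓ v → action p ℓ u ≤ action p ℓ v

def IsPositive (ℓ : ℝ) (u : ForkFun P) : Prop :=
  (∀ x ∈ Ici (0 : ℝ), 0 < u.halfLine x) ∧ ∀ i, ∀ x ∈ Icc 0 ℓ, 0 < u.pendant i x

def IsCoreSymmetric (ℓ : ℝ) (u : ForkFun P) : Prop :=
  ∀ i j, EqOn (u.pendant i) (u.pendant j) (Icc 0 ℓ)

/-- Symmetric: core-symmetric and equal on all half-lines. A fork graph has a single half-line, so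
the second requirement is void. -/
def IsSymmetric (ℓ : ℝ) (u : ForkFun P) : Prop := IsCoreSymmetric ℓ u

def IsCoreIncreasing (ℓ : ℝ) (u : ForkFun P) : Prop :=
  ∀ i, StrictMonoOn (u.pendant i) (Icc 0 ℓ)

def IsCoreDecreasing (ℓ : ℝ) (u : ForkFun P) : Prop :=
  ∀ i, StrictAntiOn (u.pendant i) (Icc 0 ℓ)

/-- Increasing: core-increasing, and decreasing on the half-line (`𝟎` being at `x = 0`). -/
def IsIncreasing (ℓ : ℝ) (u : ForkFun P) : Prop :=
  IsCoreIncreasing ℓ u ∧ StrictAntiOn u.halfLine (Ici 0)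

/-- Increasing symmetric positive bound-states. -/
def IsIncSymPosBoundState (p ℓ : ℝ) (u : ForkFun P) : Prop :=
  IsBoundState p ℓ u ∧ IsPositive ℓ u ∧ IsSymmetric ℓ u ∧ IsIncreasing ℓ u

/-- Core-decreasing symmetric positive bound-states. -/
def IsCoreDecSymPosBoundState (p ℓ : ℝ) (u : ForkFun P) : Prop :=
  IsBoundState p ℓ u ∧ IsPositive ℓ u ∧ IsSymmetric ℓ u ∧ IsCoreDecreasing ℓ u

end ForkFun

end

open Filter Topology

noncomputable section

namespace Fork

/-! ### The nonlinearity and its potential -/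

/-! On each edge a bound-state solves `u'' = force p u`, with conserved energy `u'^2/2 - pot p u`.
Square integrability makes the energy vanish on the half-line, so the solutions there are the
explicit `hl p b`: for `b > 0` these are soliton translates with peak at `log b`. The natural
condition at a tip is `u' = 0`, so pendant `i` carries `sol p (d i) 0`, run from the tip.
Bound-states thus reduce to finitely many numbers `(b, d)` subject to continuity and Kirchhoff's
condition at the vertex (`Matching`, `IsBoundState.exists_fork`, `isBoundState_fork`).

Symmetric positive states. Let `c` be the value at the vertex and `δ` the value at the tips. The
slope on the half-line is `P` times the slope on a pendant, and comparing energies gives `pot p δ =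
θ * pot p c` with `θ = 1 - 1/P^2` (`Matching.symm_energy`). What remains is that the orbit takes
time `ℓ` between `δ` and `c`, and uniqueness is injectivity of this time in `c`
(`timeIn_Ioi_injective`, `timeIn_Ioo_injective`). If the orbit does not cross the equilibrium `1`,
use the variable `pot u / pot c`: the integrand is monotone in `c` because `√pot / |force|` is
monotone on each side of `1`. If it crosses `1`, subtract the remaining arc from the total time
between the two turning points, which does not increase with the energy level (`timeIn_Ioi_anti`).
For the latter, put `V = pot 1 - pot` and compare `√V / |V'|` on the two branches at equal `V`. The
corrections `+λ√V` and `-λ√V` make each branch monotone and cancel in the sum; the required sign is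
`periodDefect_nonneg`.

Existence is by shooting from the vertex (`exists_shooting`): at the parameter where the slope just
touches zero on `[0, ℓ]`, the contact is at `ℓ`, since a contact inside would be at an equilibrium.
For core-decreasing states, `arsinh (u' / √(2e))`, with `e` the value of `pot` at the tip, is a
clock. It would run at unit speed for `u'' = u`; here its speed is `force / √(2 pot) < 1`, close to
`1` for small solutions. Its reading at the vertex is `arsinh (1 / √(P^2 - 1))`, which is why this
is the exact threshold and does not involve `p`.

Action. On bound-states the action is `1/2 - 1/p` times the integral of `|u|^p`, and it is also the
integral of `u'^2/2 + pot u`. Where `pot u ≥ 0` that integrand dominates `|(calib u)'|`, where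
`calib` is the primitive of `√(2 pot)`. Hence `K = calib p (peak p)` is the action of half a
soliton. For short pendants the increasing state costs at most `K + O(ℓ)`. A bound-state at this
level or below is almost constant on the pendants, so Kirchhoff's condition makes `pot c` small. If
`c` is near `0`, nontriviality puts the peak of the soliton on the half-line, which is too
expensive; if `c` is near the peak, the state is symmetric and increasing, up to sign, and
uniqueness applies (`exists_isIncSymPos_of_action_le`). For long pendants, states concentrated on
one pendant have action close to `K` (`exists_isBoundState_action_lt`), while symmetric ones stay
above some `Λ > K` because at least two pendants share every cost (`exists_lt_action_of_symmetric`).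
A minimizer exists because below `2K` the soliton cannot escape along the half-line, so the
admissible `(b, d)` form a compact set (`exists_isGroundState`). -/

/-- The right-hand side of `u'' = u - |u|^(p-2) u`. -/
def force (p v : ℝ) : ℝ := v - |v| ^ (p - 2) * v

/-- The primitive `v²/2 - |v|^p/p` of `force`. -/
def pot (p v : ℝ) : ℝ := v ^ 2 / 2 - |v| ^ p / p

section basic

variable {p : ℝ}

theorem hasDerivAt_pot (hp : 2 < p) (v : ℝ) : HasDerivAt (pot p) (force p v) v := by
  have h1 := hasDerivAt_abs_rpow v (p := p) (by linarith)
  have h2 := ((hasDerivAt_pow 2 v).div_const 2).sub (h1.div_const p)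
  refine h2.congr_deriv ?_
  unfold force
  have : p ≠ 0 := by linarith
  field_simp
  simp
  ring

theorem continuous_pot (hp : 2 < p) : Continuous (pot p) :=
  continuous_iff_continuousAt.2 fun v => (hasDerivAt_pot hp v).continuousAt

theorem continuous_force (hp : 2 < p) : Continuous (force p) := by
  unfold force
  exact continuous_id.sub ((continuous_abs.rpow_const fun x => Or.inr (by linarith)).mul continuous_id)

theorem force_zero : force p 0 = 0 := by simp [force]

theorem force_one : force p 1 = 0 := by simp [force]

theorem pot_zero (hp : 2 < p) : pot p 0 = 0 := by
  simp [pot, Real.zero_rpow (by linarith : p ≠ 0)]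

theorem pot_one : pot p 1 = 1 / 2 - 1 / p := by simp [pot]

theorem force_neg (v : ℝ) : force p (-v) = -force p v := by simp [force]; ring

theorem pot_abs (v : ℝ) : pot p |v| = pot p v := by simp [pot]

theorem force_of_pos {v : ℝ} (hv : 0 < v) : force p v = v * (1 - v ^ (p - 2)) := by
  simp only [force, abs_of_pos hv]; ring

theorem abs_rpow_eq (hp : 2 < p) (v : ℝ) : |v| ^ p = |v| ^ (p - 2) * v ^ 2 := by
  rcases eq_or_ne v 0 with rfl | hv
  · simp [Real.zero_rpow (by linarith : p ≠ 0)]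
  · have : |v| ^ p = |v| ^ (p - 2) * |v| ^ (2 : ℝ) := by
      rw [← Real.rpow_add (abs_pos.2 hv)]; congr 1; ring
    rw [this, Real.rpow_two, sq_abs]

theorem pot_eq (hp : 2 < p) (v : ℝ) : pot p v = v ^ 2 * (1 / 2 - |v| ^ (p - 2) / p) := by
  rw [pot, abs_rpow_eq hp]; ring

theorem force_pos (hp : 2 < p) {v : ℝ} (hv : 0 < v) (hv1 : v < 1) : 0 < force p v := by
  rw [force_of_pos hv]
  exact mul_pos hv (sub_pos.2 (Real.rpow_lt_one hv.le hv1 (by linarith)))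

theorem force_neg_of_one_lt (hp : 2 < p) {v : ℝ} (hv1 : 1 < v) : force p v < 0 := by
  rw [force_of_pos (by linarith)]
  exact mul_neg_of_pos_of_neg (by linarith)
    (sub_neg.2 (Real.one_lt_rpow hv1 (by linarith)))

theorem force_strictAntiOn (hp : 2 < p) : StrictAntiOn (force p) (Ici 1) := by
  intro a ha b hb hab
  simp only [mem_Ici] at ha hb
  rw [force_of_pos (by linarith), force_of_pos (by linarith)]
  have h1 : a ^ (p - 2) < b ^ (p - 2) :=
    Real.rpow_lt_rpow (by linarith) hab (by linarith)
  have h2 : 1 ≤ a ^ (p - 2) := Real.one_le_rpow ha (by linarith)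
  nlinarith

theorem pot_strictMonoOn (hp : 2 < p) : StrictMonoOn (pot p) (Icc 0 1) := by
  refine strictMonoOn_of_deriv_pos (convex_Icc 0 1) (continuous_pot hp).continuousOn ?_
  intro x hx
  rw [interior_Icc] at hx
  rw [(hasDerivAt_pot hp x).deriv]
  exact force_pos hp hx.1 hx.2

theorem pot_strictAntiOn (hp : 2 < p) : StrictAntiOn (pot p) (Ici 1) := by
  refine strictAntiOn_of_deriv_neg (convex_Ici 1) (continuous_pot hp).continuousOn ?_
  intro x hx
  rw [interior_Ici] at hx
  rw [(hasDerivAt_pot hp x).deriv]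
  exact force_neg_of_one_lt hp hx

theorem pot_le (hp : 2 < p) (v : ℝ) : pot p v ≤ 1 / 2 - 1 / p := by
  rw [← pot_abs, ← pot_one]
  rcases le_total |v| 1 with h | h
  · exact (pot_strictMonoOn hp).monotoneOn ⟨abs_nonneg v, h⟩ ⟨zero_le_one, le_rfl⟩ h
  · exact (pot_strictAntiOn hp).antitoneOn (mem_Ici.2 le_rfl) h h

theorem pot_one_pos (hp : 2 < p) : 0 < 1 / 2 - 1 / p := by
  have : 1 / p < 1 / 2 := one_div_lt_one_div_of_lt (by norm_num) hp
  linarith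

/-- The largest value at which `pot` vanishes: the maximum of the soliton. -/
def peak (p : ℝ) : ℝ := (p / 2) ^ (1 / (p - 2))

theorem one_lt_peak (hp : 2 < p) : 1 < peak p :=
  Real.one_lt_rpow (by linarith) (one_div_pos.2 (by linarith))

theorem peak_rpow (hp : 2 < p) : peak p ^ (p - 2) = p / 2 := by
  rw [peak, ← Real.rpow_mul (by linarith), one_div_mul_cancel (by linarith), Real.rpow_one]

theorem pot_peak (hp : 2 < p) : pot p (peak p) = 0 := by
  have h1 := one_lt_peak hp
  rw [pot_eq hp, abs_of_pos (by linarith), peak_rpow hp]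
  have : p ≠ 0 := by linarith
  field_simp
  simp

theorem pot_pos (hp : 2 < p) {v : ℝ} (hv : 0 < v) (hv1 : v < peak p) : 0 < pot p v := by
  rcases le_total v 1 with h | h
  · have := pot_strictMonoOn hp ⟨le_rfl, zero_le_one⟩ ⟨hv.le, h⟩ hv
    rwa [pot_zero hp] at this
  · have := pot_strictAntiOn hp h (one_lt_peak hp).le hv1
    rwa [pot_peak hp] at this

theorem abs_le_peak (hp : 2 < p) {v : ℝ} (h : 0 ≤ pot p v) : |v| ≤ peak p := by
  by_contra! hv
  have h1 := one_lt_peak hp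
  have := pot_strictAntiOn hp h1.le (h1.trans hv).le hv
  rw [pot_peak hp, pot_abs] at this
  linarith

theorem abs_lt_peak (hp : 2 < p) {v : ℝ} (h : 0 < pot p v) : |v| < peak p := by
  refine lt_of_le_of_ne (abs_le_peak hp h.le) fun h1 => ?_
  rw [← pot_abs, h1, pot_peak hp] at h
  exact lt_irrefl _ h

theorem pot_nonneg (hp : 2 < p) {v : ℝ} (hv : |v| ≤ peak p) : 0 ≤ pot p v := by
  rw [← pot_abs]
  rcases eq_or_lt_of_le (abs_nonneg v) with h | h
  · rw [← h, pot_zero hp]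
  rcases eq_or_lt_of_le hv with h1 | h1
  · rw [h1, pot_peak hp]
  · exact (pot_pos hp h h1).le

theorem pot_le_sq (hp : 2 < p) (v : ℝ) : pot p v ≤ v ^ 2 / 2 := by
  unfold pot
  have : 0 ≤ |v| ^ p / p := by positivity
  linarith

/-- `-pot` is coercive. -/
theorem pot_coercive (hp : 2 < p) (C : ℝ) : ∃ M : ℝ, 0 < M ∧ ∀ v, -C ≤ pot p v → |v| < M := by
  obtain ⟨M, hM⟩ : ∃ M : ℝ, 1 ≤ M ∧ pot p M < -C := by
    have h1 : Tendsto (fun x : ℝ => x ^ (p - 2)) atTop atTop := tendsto_rpow_atTop (by linarith)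
    obtain ⟨M, h2, h3⟩ := ((h1.eventually_ge_atTop (p * (1 / 2 + (|C| + 1)))).and
      (eventually_ge_atTop 1)).exists
    refine ⟨M, h3, ?_⟩
    rw [pot_eq hp, abs_of_pos (by linarith)]
    have h4 : 1 / 2 + (|C| + 1) ≤ M ^ (p - 2) / p := by
      rw [le_div_iff₀ (by linarith)]; linarith
    have h5 := le_abs_self C
    have h6 : 1 ≤ M ^ 2 := one_le_pow₀ h3
    nlinarith [abs_nonneg C, mul_nonneg (sub_nonneg.2 h6) (abs_nonneg C),
      mul_le_mul_of_nonneg_left h4 (sq_nonneg M)]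
  refine ⟨M, by linarith, fun v hv => ?_⟩
  by_contra! h
  have := (pot_strictAntiOn hp).antitoneOn hM.1 (hM.1.trans h) h
  rw [pot_abs] at this
  linarith

theorem hasDerivAt_force (hp : 2 < p) (v : ℝ) :
    HasDerivAt (force p) (1 - (p - 1) * |v| ^ (p - 2)) v := by
  rcases eq_or_ne v 0 with rfl | hv
  · rw [abs_zero, Real.zero_rpow (by linarith)]
    -- At `0` the factor `|v|^(p-2)` need not be differentiable, but the difference quotient is
    -- exactly `1 - |x|^(p-2)`.
    rw [hasDerivAt_iff_tendsto_slope]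
    have h1 : Tendsto (fun x : ℝ => 1 - |x| ^ (p - 2)) (𝓝 0) (𝓝 (1 - (p - 1) * 0)) := by
      have h2 : Continuous fun x : ℝ => 1 - |x| ^ (p - 2) :=
        continuous_const.sub (continuous_abs.rpow_const fun x => Or.inr (by linarith))
      have := h2.tendsto 0
      rw [abs_zero, Real.zero_rpow (by linarith)] at this
      simpa using this
    refine (h1.mono_left nhdsWithin_le_nhds).congr' ?_
    filter_upwards [self_mem_nhdsWithin] with x hx
    have hx : x ≠ 0 := hx
    rw [slope_def_field, force_zero]
    unfold force
    field_simp
    ring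
  · have h1 : HasDerivAt (fun x : ℝ => |x| ^ (p - 2)) ((p - 2) * |v| ^ (p - 2) / v) v := by
      rcases lt_or_gt_of_ne hv with h | h
      · have h2 := (hasDerivAt_neg v).rpow_const (p := p - 2) (Or.inl (by linarith))
        refine (h2.congr_deriv ?_).congr_of_eventuallyEq ?_
        · rw [abs_of_neg h, Real.rpow_sub_one (by linarith)]; field_simp
        · filter_upwards [gt_mem_nhds h] with x hx
          rw [abs_of_neg hx]
      · have h2 := (hasDerivAt_id v).rpow_const (p := p - 2) (Or.inl h.ne')
        refine (h2.congr_deriv ?_).congr_of_eventuallyEq ?_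
        · rw [abs_of_pos h]; simp only [id]; rw [Real.rpow_sub_one h.ne']; field_simp
        · filter_upwards [lt_mem_nhds h] with x hx
          rw [abs_of_pos hx]; rfl
    refine ((hasDerivAt_id v).sub (h1.mul (hasDerivAt_id v))).congr_deriv ?_
    simp only [id]
    field_simp
    ring

/-- The normalization `1 ≤ K` lets the same constant serve for the first component of the planar
field `(v, w) ↦ (w, force v)`. -/
theorem force_lipschitzOn (hp : 2 < p) (M : ℝ) :
    ∃ K : ℝ, 1 ≤ K ∧ ∀ x, |x| ≤ M → ∀ y, |y| ≤ M → |force p x - force p y| ≤ K * |x - y| := by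
  have hc : Continuous fun v : ℝ => 1 - (p - 1) * |v| ^ (p - 2) :=
    continuous_const.sub (continuous_const.mul
      (continuous_abs.rpow_const fun x => Or.inr (by linarith)))
  obtain ⟨K, hK⟩ := (isCompact_Icc (a := -M) (b := M)).exists_bound_of_continuousOn hc.continuousOn
  refine ⟨max K 1, le_max_right _ _, fun x hx y hy => ?_⟩
  have := (convex_Icc (-M) M).norm_image_sub_le_of_norm_hasDerivWithin_le
    (f := force p) (C := max K 1)
    (fun v hv => (hasDerivAt_force hp v).hasDerivWithinAt)
    (fun v hv => (hK v hv).trans (le_max_left _ _)) (abs_le.1 hy) (abs_le.1 hx)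
  simpa [Real.norm_eq_abs] using this

end basic

/-- A continuous function which is positive at `0` and not on all of `[0, T]` has a first zero. -/
theorem exists_first_zero {g : ℝ → ℝ} {T : ℝ} (hg : ContinuousOn g (Icc 0 T)) (h0 : 0 < g 0)
    (h : ∃ t ∈ Icc 0 T, g t ≤ 0) :
    ∃ t ∈ Ioc 0 T, g t = 0 ∧ ∀ s ∈ Ico 0 t, 0 < g s := by
  have hT : 0 ≤ T := by obtain ⟨t, ht, -⟩ := h; exact ht.1.trans ht.2
  have hcl : IsClosed {t ∈ Icc 0 T | g t ≤ 0} :=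
    hg.preimage_isClosed_of_isClosed isClosed_Icc isClosed_Iic
  have hbdd : BddBelow {t ∈ Icc 0 T | g t ≤ 0} := ⟨0, fun t ht => ht.1.1⟩
  obtain ⟨hm1, hm2⟩ := hcl.csInf_mem (by obtain ⟨t, ht, h'⟩ := h; exact ⟨t, ht, h'⟩) hbdd
  set t := sInf {t ∈ Icc 0 T | g t ≤ 0} with htdef
  have hpos : ∀ s ∈ Ico 0 t, 0 < g s := by
    intro s hs
    by_contra! hs'
    exact absurd (csInf_le hbdd ⟨⟨hs.1, hs.2.le.trans hm1.2⟩, hs'⟩) (not_le.2 hs.2)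
  have ht0 : 0 < t := by
    rcases eq_or_lt_of_le hm1.1 with h' | h'
    · rw [← h'] at hm2; linarith
    · exact h'
  refine ⟨t, ⟨ht0, hm1.2⟩, le_antisymm hm2 ?_, hpos⟩
  have hcw : ContinuousWithinAt g (Iio t ∩ Icc 0 T) t := (hg t hm1).mono inter_subset_right
  have : (𝓝[Iio t ∩ Icc 0 T] t).NeBot := by
    refine mem_closure_iff_nhdsWithin_neBot.1 ?_
    have h1 : Ioo 0 t ⊆ Iio t ∩ Icc 0 T := fun s hs => ⟨hs.2, hs.1.le, hs.2.le.trans hm1.2⟩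
    refine closure_mono h1 ?_
    rw [closure_Ioo ht0.ne]
    exact ⟨ht0.le, le_rfl⟩
  refine ge_of_tendsto hcw ?_
  filter_upwards [self_mem_nhdsWithin] with s hs
  exact (hpos s ⟨hs.2.1, hs.1⟩).le

end Fork

namespace Fork

/-! ### Global solutions of `v'' = force v` -/

/-- A bounded Lipschitz vector field is complete. -/
theorem exists_global_solution {E : Type*} [NormedAddCommGroup E] [NormedSpace ℝ E]
    [CompleteSpace E] {Y : E → E} {K : NNReal} (hY : LipschitzWith K Y) {L : NNReal}
    (hL : ∀ x, ‖Y x‖ ≤ L) (z : E) :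
    ∃ γ : ℝ → E, γ 0 = z ∧ ∀ t, HasDerivAt γ (Y (γ t)) t := by
  have key : ∀ n : ℕ, ∃ α : ℝ → E, α 0 = z ∧
      ∀ t ∈ Ioo (-(n + 1 : ℝ)) (n + 1), HasDerivAt α (Y (α t)) t := by
    intro n
    have h0 : (0 : ℝ) ∈ Icc (-(n + 1 : ℝ)) (n + 1) := ⟨by linarith [n.cast_nonneg (α := ℝ)],
      by positivity⟩
    -- The speed is at most `L`, so the ball of radius `L * (n + 1)` cannot be left within time `n +
    -- 1`, and Picard-Lindelöf applies on intervals of any length.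
    have hpl : IsPicardLindelof (fun _ => Y) (⟨0, h0⟩ : Icc (-(n + 1 : ℝ)) (n + 1)) z
        (L * (n + 1)) 0 L K :=
      { lipschitzOnWith := fun t _ => hY.lipschitzOnWith
        continuousOn := fun x _ => continuousOn_const
        norm_le := fun t _ x _ => hL x
        mul_max_le := by simp }
    obtain ⟨α, h1, h2⟩ := hpl.exists_eq_forall_mem_Icc_hasDerivWithinAt₀
    exact ⟨α, h1, fun t ht => (h2 t (Ioo_subset_Icc_self ht)).hasDerivAt (Icc_mem_nhds ht.1 ht.2)⟩
  choose α h0 hα using key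
  have huniq : ∀ m n : ℕ, m ≤ n → EqOn (α m) (α n) (Ioo (-(m + 1 : ℝ)) (m + 1)) := by
    intro m n hmn
    have hmn' : (m : ℝ) ≤ n := by exact_mod_cast hmn
    refine ODE_solution_unique_of_mem_Ioo (v := fun _ => Y) (s := fun _ => univ) (t₀ := 0)
      (fun t _ => hY.lipschitzOnWith) ⟨by linarith [m.cast_nonneg (α := ℝ)], by positivity⟩
      (fun t ht => ⟨hα m t ht, trivial⟩) (fun t ht => ⟨hα n t ⟨?_, ?_⟩, trivial⟩)
      ((h0 m).trans (h0 n).symm)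
    · linarith [ht.1]
    · linarith [ht.2]
  refine ⟨fun t => α ⌈|t|⌉₊ t, by simpa using h0 0, fun t => ?_⟩
  have hmem : ∀ s : ℝ, s ∈ Ioo (-((⌈|s|⌉₊ : ℝ) + 1)) ((⌈|s|⌉₊ : ℝ) + 1) := by
    intro s
    have := Nat.le_ceil |s|
    constructor <;> linarith [neg_abs_le s, le_abs_self s]
  -- One index that serves every `s` within distance `1` of `t`.
  set N := ⌈|t|⌉₊ + 1 with hN
  have hev : (fun s => α ⌈|s|⌉₊ s) =ᶠ[𝓝 t] α N := by
    have h1 : Ioo (t - 1) (t + 1) ∈ 𝓝 t := Ioo_mem_nhds (by linarith) (by linarith)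
    filter_upwards [h1] with s hs
    refine huniq _ _ ?_ (hmem s)
    rw [hN, Nat.ceil_le]
    push_cast
    have h2 := Nat.le_ceil |t|
    have h3 : |s| ≤ |t| + 1 := by
      have : |s - t| ≤ 1 := abs_le.2 ⟨by linarith [hs.1], by linarith [hs.2]⟩
      linarith [abs_sub_abs_le_abs_sub s t]
    linarith
  have h4 : α ⌈|t|⌉₊ t = α N t := hev.eq_of_nhds
  have h5 := hmem t
  have h6 : HasDerivAt (α N) (Y (α N t)) t := by
    refine hα N t ⟨?_, ?_⟩ <;> rw [hN] <;> push_cast <;> linarith [h5.1, h5.2]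
  simp only [h4]
  exact h6.congr_of_eventuallyEq hev

/-- `(v, w)` is a global solution of `v' = w`, `w' = force v`. -/
def IsSol (p : ℝ) (v w : ℝ → ℝ) : Prop :=
  ∀ t, HasDerivAt v (w t) t ∧ HasDerivAt w (force p (v t)) t

variable {p : ℝ} {v w : ℝ → ℝ}

theorem _root_.HasDerivAt.comp_neg_id {f : ℝ → ℝ} {f' t : ℝ} (h : HasDerivAt f f' (-t)) :
    HasDerivAt (fun s => f (-s)) (-f') t :=
  (h.scomp t (hasDerivAt_neg t)).congr_deriv (by simp)

namespace IsSol

theorem continuous (h : IsSol p v w) : Continuous v :=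
  continuous_iff_continuousAt.2 fun t => (h t).1.continuousAt

theorem continuous' (h : IsSol p v w) : Continuous w :=
  continuous_iff_continuousAt.2 fun t => (h t).2.continuousAt

theorem comp_neg (h : IsSol p v w) : IsSol p (fun t => v (-t)) (fun t => -w (-t)) := fun t => by
  exact ⟨(h (-t)).1.comp_neg_id, (h (-t)).2.comp_neg_id.neg.congr_deriv (neg_neg _)⟩

theorem comp_add (h : IsSol p v w) (s : ℝ) : IsSol p (fun t => v (t + s)) (fun t => w (t + s)) :=
  fun t => ⟨(h (t + s)).1.comp_add_const t s, (h (t + s)).2.comp_add_const t s⟩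

theorem neg (h : IsSol p v w) : IsSol p (fun t => -v t) (fun t => -w t) := fun t =>
  ⟨(h t).1.neg, by rw [force_neg]; exact (h t).2.neg⟩

theorem energy (hp : 2 < p) (h : IsSol p v w) (s t : ℝ) :
    w s ^ 2 / 2 - pot p (v s) = w t ^ 2 / 2 - pot p (v t) := by
  have hd : ∀ t, HasDerivAt (fun t => w t ^ 2 / 2 - pot p (v t)) 0 t := fun t => by
    have h1 := (((h t).2.pow 2).div_const 2).sub ((hasDerivAt_pot hp (v t)).comp t (h t).1)
    refine h1.congr_deriv ?_
    simp
    ring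
  exact is_const_of_deriv_eq_zero (fun t => (hd t).differentiableAt) (fun t => (hd t).deriv) s t

end IsSol

theorem force_lipschitzOnWith_box (hp : 2 < p) (M : ℝ) : ∃ K : NNReal,
    LipschitzOnWith K (fun z : ℝ × ℝ => (z.2, force p z.1)) {z | |z.1| ≤ M ∧ |z.2| ≤ M} := by
  obtain ⟨K, hK1, hK⟩ := force_lipschitzOn hp M
  refine ⟨K.toNNReal, LipschitzOnWith.of_dist_le_mul fun x hx y hy => ?_⟩
  rw [Prod.dist_eq, Prod.dist_eq]
  simp only [Real.dist_eq, Real.coe_toNNReal K (by linarith)]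
  refine max_le ?_ ?_
  · have := le_max_right |x.1 - y.1| |x.2 - y.2|
    nlinarith [abs_nonneg (x.2 - y.2)]
  · refine (hK _ hx.1 _ hy.1).trans ?_
    gcongr
    exact le_max_left _ _

/-- Uniform bounds on solutions with a given energy bound. -/
theorem exists_energy_bound (hp : 2 < p) (C : ℝ) : ∃ M : ℝ, 0 < M ∧
    ∀ v w : ℝ, w ^ 2 / 2 - pot p v ≤ C → |v| < M ∧ |w| < M := by
  obtain ⟨M, hM0, hM⟩ := pot_coercive hp C
  refine ⟨max M (|C| + 3), lt_max_of_lt_left hM0, fun v w h => ⟨?_, ?_⟩⟩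
  · exact (hM v (by nlinarith [sq_nonneg w])).trans_le (le_max_left _ _)
  · refine lt_of_lt_of_le ?_ (le_max_right _ _)
    have h1 := pot_le hp v
    have h2 : 0 < 1 / p := by positivity
    have h3 := le_abs_self C
    refine abs_lt_of_sq_lt_sq ?_ (by positivity)
    nlinarith [abs_nonneg C]

theorem exists_initial_energy_bound (hp : 2 < p) (R : ℝ) : ∃ C : ℝ,
    ∀ a b : ℝ, |a| ≤ R → |b| ≤ R → b ^ 2 / 2 - pot p a ≤ C := by
  obtain ⟨C, hC⟩ := (isCompact_Icc (a := -R) (b := R)).exists_bound_of_continuousOn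
    (continuous_pot hp).continuousOn
  refine ⟨R ^ 2 / 2 + C, fun a b ha hb => ?_⟩
  have h1 := hC a (abs_le.1 ha)
  rw [Real.norm_eq_abs] at h1
  have h2 := neg_abs_le (pot p a)
  have h3 : b ^ 2 ≤ R ^ 2 := sq_le_sq' (abs_le.1 hb).1 (abs_le.1 hb).2
  linarith

theorem IsSol.exists_bound (hp : 2 < p) (R : ℝ) : ∃ M : ℝ, 0 < M ∧ ∀ v w : ℝ → ℝ, IsSol p v w →
    |v 0| ≤ R → |w 0| ≤ R → ∀ t, |v t| ≤ M ∧ |w t| ≤ M := by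
  obtain ⟨C, hC⟩ := exists_initial_energy_bound hp R
  obtain ⟨M, hM0, hM⟩ := exists_energy_bound hp C
  refine ⟨M, hM0, fun v w h ha hb t => ?_⟩
  have := hM (v t) (w t) ((h.energy hp t 0).trans_le (hC _ _ ha hb))
  exact ⟨this.1.le, this.2.le⟩

/-- Continuous dependence on the data. -/
theorem IsSol.exists_dist_le (hp : 2 < p) (R T : ℝ) : ∃ L : ℝ, 0 < L ∧ ∀ v w v' w' : ℝ → ℝ,
    IsSol p v w → IsSol p v' w' → |v 0| ≤ R → |w 0| ≤ R → |v' 0| ≤ R → |w' 0| ≤ R →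
    ∀ t ∈ Icc 0 T, |v t - v' t| ≤ L * max |v 0 - v' 0| |w 0 - w' 0| ∧
      |w t - w' t| ≤ L * max |v 0 - v' 0| |w 0 - w' 0| := by
  obtain ⟨M, hM0, hM⟩ := IsSol.exists_bound hp R
  obtain ⟨K, hK⟩ := force_lipschitzOnWith_box hp M
  refine ⟨Real.exp (K * T), Real.exp_pos _, fun v w v' w' h h' h1 h2 h3 h4 t ht => ?_⟩
  have hb := hM v w h h1 h2
  have hb' := hM v' w' h' h3 h4
  have key := dist_le_of_trajectories_ODE_of_mem (v := fun _ (z : ℝ × ℝ) => (z.2, force p z.1))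
    (f := fun t => (v t, w t)) (g := fun t => (v' t, w' t)) (a := 0) (b := T)
    (s := fun _ => {z | |z.1| ≤ M ∧ |z.2| ≤ M}) (fun t _ => hK)
    (h.continuous.prodMk h.continuous').continuousOn
    (fun t _ => ((h t).1.prodMk (h t).2).hasDerivWithinAt) (fun t _ => hb t)
    (h'.continuous.prodMk h'.continuous').continuousOn
    (fun t _ => ((h' t).1.prodMk (h' t).2).hasDerivWithinAt) (fun t _ => hb' t) le_rfl t ht
  simp only [Prod.dist_eq, Real.dist_eq, sub_zero] at key
  have h5 : max |v 0 - v' 0| |w 0 - w' 0| * Real.exp (K * t) ≤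
      Real.exp (K * T) * max |v 0 - v' 0| |w 0 - w' 0| := by
    rw [mul_comm]
    have : Real.exp (K * t) ≤ Real.exp (K * T) :=
      Real.exp_le_exp.2 (mul_le_mul_of_nonneg_left ht.2 K.2)
    gcongr
  exact ⟨(le_max_left _ _).trans (key.trans h5), (le_max_right _ _).trans (key.trans h5)⟩

/-- Solutions on an interval agree with global solutions having the same data. -/
theorem IsSol.eqOn (hp : 2 < p) (h : IsSol p v w) {T : ℝ} {v' w' : ℝ → ℝ}
    (hv : ContinuousOn v' (Icc 0 T)) (hw : ContinuousOn w' (Icc 0 T))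
    (hv' : ∀ t ∈ Ico 0 T, HasDerivWithinAt v' (w' t) (Ici t) t)
    (hw' : ∀ t ∈ Ico 0 T, HasDerivWithinAt w' (force p (v' t)) (Ici t) t)
    (h0 : v' 0 = v 0) (h0' : w' 0 = w 0) :
    EqOn v' v (Icc 0 T) ∧ EqOn w' w (Icc 0 T) := by
  obtain ⟨M1, hM1⟩ := isCompact_Icc.exists_bound_of_continuousOn hv
  obtain ⟨M2, hM2⟩ := isCompact_Icc.exists_bound_of_continuousOn hw
  obtain ⟨M3, hM3⟩ := isCompact_Icc.exists_bound_of_continuousOn (s := Icc 0 T)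
    h.continuous.continuousOn
  obtain ⟨M4, hM4⟩ := isCompact_Icc.exists_bound_of_continuousOn (s := Icc 0 T)
    h.continuous'.continuousOn
  set M := max (max M1 M2) (max M3 M4)
  obtain ⟨K, hK⟩ := force_lipschitzOnWith_box hp M
  have e1 : M1 ≤ M := (le_max_left _ _).trans (le_max_left _ _)
  have e2 : M2 ≤ M := (le_max_right _ _).trans (le_max_left _ _)
  have e3 : M3 ≤ M := (le_max_left _ _).trans (le_max_right _ _)
  have e4 : M4 ≤ M := (le_max_right _ _).trans (le_max_right _ _)
  have key := ODE_solution_unique_of_mem_Icc_right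
    (v := fun _ (z : ℝ × ℝ) => (z.2, force p z.1))
    (f := fun t => (v' t, w' t)) (g := fun t => (v t, w t)) (a := 0) (b := T)
    (s := fun _ => {z | |z.1| ≤ M ∧ |z.2| ≤ M}) (fun t _ => hK)
    (hv.prodMk hw) (fun t ht => (hv' t ht).prodMk (hw' t ht))
    (fun t ht => ⟨(hM1 t (Ico_subset_Icc_self ht)).trans e1,
      (hM2 t (Ico_subset_Icc_self ht)).trans e2⟩)
    (h.continuous.prodMk h.continuous').continuousOn
    (fun t _ => ((h t).1.prodMk (h t).2).hasDerivWithinAt)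
    (fun t ht => ⟨(hM3 t (Ico_subset_Icc_self ht)).trans e3,
      (hM4 t (Ico_subset_Icc_self ht)).trans e4⟩)
    (by simp [h0, h0'])
  exact ⟨fun t ht => congrArg Prod.fst (key ht), fun t ht => congrArg Prod.snd (key ht)⟩

theorem IsSol.unique (hp : 2 < p) {v' w' : ℝ → ℝ} (h : IsSol p v w) (h' : IsSol p v' w')
    (h0 : v 0 = v' 0) (h0' : w 0 = w' 0) : v = v' ∧ w = w' := by
  have pos : ∀ {v w v' w' : ℝ → ℝ}, IsSol p v w → IsSol p v' w' → v 0 = v' 0 → w 0 = w' 0 →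
      ∀ t, 0 ≤ t → v t = v' t ∧ w t = w' t := by
    intro v w v' w' h h' h0 h0' t ht
    have := h'.eqOn hp (T := t) h.continuous.continuousOn h.continuous'.continuousOn
      (fun s _ => (h s).1.hasDerivWithinAt) (fun s _ => (h s).2.hasDerivWithinAt) h0 h0'
    exact ⟨this.1 ⟨ht, le_rfl⟩, this.2 ⟨ht, le_rfl⟩⟩
  have all : ∀ t, v t = v' t ∧ w t = w' t := by
    intro t
    rcases le_total 0 t with ht | ht
    · exact pos h h' h0 h0' t ht
    · have := pos h.comp_neg h'.comp_neg (by simpa using h0) (by simpa using h0') (-t)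
        (by linarith)
      simpa using this
  exact ⟨funext fun t => (all t).1, funext fun t => (all t).2⟩

/-- Truncation of a real number to `[-M, M]`. -/
def clamp (M x : ℝ) : ℝ := max (-M) (min M x)

theorem clamp_of_abs_le {M x : ℝ} (h : |x| ≤ M) : clamp M x = x := by
  rw [clamp, min_eq_right (abs_le.1 h).2, max_eq_right (abs_le.1 h).1]

theorem abs_clamp_le {M : ℝ} (hM : 0 ≤ M) (x : ℝ) : |clamp M x| ≤ M :=
  abs_le.2 ⟨le_max_left _ _, max_le (by linarith) (min_le_left _ _)⟩

theorem clamp_neg {M : ℝ} (hM : 0 ≤ M) (x : ℝ) : clamp M (-x) = -clamp M x := by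
  unfold clamp
  rcases le_total M x with h1 | h1 <;> rcases le_total M (-x) with h2 | h2 <;>
    rcases le_total (-M) x with h3 | h3 <;> rcases le_total (-M) (-x) with h4 | h4 <;>
    simp [h1, h2, h3, h4, hM] <;> linarith

theorem abs_clamp_sub_le (M x y : ℝ) : |clamp M x - clamp M y| ≤ |x - y| := by
  unfold clamp
  rw [max_comm, max_comm (-M), min_comm, min_comm M y]
  exact (abs_max_sub_max_le_abs _ _ _).trans (by simpa using abs_min_sub_min_le_max x M y M)

/-- The field is only locally Lipschitz, so it is truncated to the box given by the energy bound.
Inside the box the energy is conserved, and the energy bound is strict, so the truncated solution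
never touches the boundary of the box and solves the original equation. -/
theorem exists_isSol (hp : 2 < p) (a b : ℝ) : ∃ v w : ℝ → ℝ, IsSol p v w ∧ v 0 = a ∧ w 0 = b := by
  obtain ⟨M, hM0, hM⟩ := exists_energy_bound hp (b ^ 2 / 2 - pot p a)
  obtain ⟨K, hK1, hK⟩ := force_lipschitzOn hp M
  obtain ⟨C, hC⟩ := (isCompact_Icc (a := -M) (b := M)).exists_bound_of_continuousOn
    (continuous_force hp).continuousOn
  set Y : ℝ × ℝ → ℝ × ℝ := fun z => (clamp M z.2, force p (clamp M z.1)) with hYdef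
  have hYlip : LipschitzWith K.toNNReal Y := by
    refine LipschitzWith.of_dist_le_mul fun x y => ?_
    rw [Prod.dist_eq, Prod.dist_eq]
    simp only [Real.dist_eq, Real.coe_toNNReal K (by linarith), hYdef]
    refine max_le ?_ ?_
    · have h1 := le_max_right |x.1 - y.1| |x.2 - y.2|
      have h2 := abs_clamp_sub_le M x.2 y.2
      nlinarith [abs_nonneg (x.2 - y.2)]
    · refine (hK _ (abs_clamp_le hM0.le _) _ (abs_clamp_le hM0.le _)).trans ?_
      gcongr
      exact (abs_clamp_sub_le M x.1 y.1).trans (le_max_left _ _)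
  have hYbdd : ∀ z, ‖Y z‖ ≤ (⟨max M C, le_max_of_le_left hM0.le⟩ : NNReal) := by
    intro z
    rw [Prod.norm_def]
    exact max_le_max (abs_clamp_le hM0.le _) (hC _ (abs_le.1 (abs_clamp_le hM0.le _)))
  obtain ⟨γ, hγ0, hγ⟩ := exists_global_solution hYlip hYbdd (a, b)
  have hv : ∀ t, HasDerivAt (fun t => (γ t).1) (clamp M (γ t).2) t := fun t => (hγ t).fst
  have hw : ∀ t, HasDerivAt (fun t => (γ t).2) (force p (clamp M (γ t).1)) t := fun t => (hγ t).snd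
  have stay : ∀ x y : ℝ → ℝ, (∀ t, HasDerivAt x (clamp M (y t)) t) →
      (∀ t, HasDerivAt y (force p (clamp M (x t))) t) →
      y 0 ^ 2 / 2 - pot p (x 0) = b ^ 2 / 2 - pot p a → ∀ t, 0 ≤ t → |x t| < M ∧ |y t| < M := by
    intro x y hx hy h0 t ht
    have hxc : Continuous x := continuous_iff_continuousAt.2 fun t => (hx t).continuousAt
    have hyc : Continuous y := continuous_iff_continuousAt.2 fun t => (hy t).continuousAt
    -- Distance to the boundary of the box. At its first zero the energy still has its initial
    -- value, which makes the distance positive.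
    set g : ℝ → ℝ := fun t => M - max |x t| |y t|
    have hgc : Continuous g := continuous_const.sub (hxc.abs.max hyc.abs)
    by_contra hcon
    have hg0 : 0 < g 0 := by
      have := hM (x 0) (y 0) h0.le
      exact sub_pos.2 (max_lt this.1 this.2)
    obtain ⟨s, hs, hs0, hs1⟩ := exists_first_zero (T := t) hgc.continuousOn hg0
      ⟨t, ⟨ht, le_rfl⟩, by
        by_contra! h
        have h' := sub_pos.1 h
        exact hcon ⟨(le_max_left _ _).trans_lt h', (le_max_right _ _).trans_lt h'⟩⟩
    have hbd : ∀ r ∈ Icc 0 s, |x r| ≤ M ∧ |y r| ≤ M := by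
      intro r hr
      have : 0 ≤ g r := by
        rcases eq_or_lt_of_le hr.2 with h | h
        · rw [h, hs0]
        · exact (hs1 r ⟨hr.1, h⟩).le
      have h' := sub_nonneg.1 this
      exact ⟨(le_max_left _ _).trans h', (le_max_right _ _).trans h'⟩
    have hconst : ∀ r ∈ Icc 0 s, y r ^ 2 / 2 - pot p (x r) = y 0 ^ 2 / 2 - pot p (x 0) := by
      refine constant_of_has_deriv_right_zero ?_ ?_
      · exact (((hyc.pow 2).div_const 2).sub ((continuous_pot hp).comp hxc)).continuousOn
      · intro r hr
        have hr' := hbd r (Ico_subset_Icc_self hr)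
        have h1 := (((hy r).pow 2).div_const 2).sub ((hasDerivAt_pot hp (x r)).comp r (hx r))
        refine (h1.congr_deriv ?_).hasDerivWithinAt
        rw [clamp_of_abs_le hr'.1, clamp_of_abs_le hr'.2]
        simp
        ring
    have := hM (x s) (y s) ((hconst s ⟨hs.1.le, le_rfl⟩).trans h0).le
    have h' : 0 < g s := sub_pos.2 (max_lt this.1 this.2)
    linarith
  have all : ∀ t, |(γ t).1| < M ∧ |(γ t).2| < M := by
    intro t
    rcases le_total 0 t with ht | ht
    · exact stay _ _ hv hw (by simp [hγ0]) t ht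
    -- Negative times follow by reversing time and the sign of the velocity.
    · have := stay (fun t => (γ (-t)).1) (fun t => -(γ (-t)).2)
        (fun t => by
          rw [clamp_neg hM0.le]
          exact (hv (-t)).comp_neg_id)
        (fun t => (hw (-t)).comp_neg_id.neg.congr_deriv (neg_neg _))
        (by simp [hγ0]) (-t) (by linarith)
      simpa using this
  refine ⟨fun t => (γ t).1, fun t => (γ t).2, fun t => ⟨?_, ?_⟩, by simp [hγ0], by simp [hγ0]⟩
  · have := hv t
    rwa [clamp_of_abs_le (all t).2.le] at this
  · have := hw t
    rwa [clamp_of_abs_le (all t).1.le] at this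

end Fork

/-! ### Solutions as functions of their initial data -/

namespace Fork

/-- The global solution of `v'' = force v` with data `(a, b)`, together with its derivative. -/
def solPair (p a b : ℝ) : (ℝ → ℝ) × (ℝ → ℝ) :=
  Classical.epsilon fun vw => IsSol p vw.1 vw.2 ∧ vw.1 0 = a ∧ vw.2 0 = b

/-- The global solution of `v'' = force v` with `v 0 = a`, `v' 0 = b`. -/
def sol (p a b : ℝ) : ℝ → ℝ := (solPair p a b).1

/-- The derivative of `sol`. -/
def sol' (p a b : ℝ) : ℝ → ℝ := (solPair p a b).2

variable {p : ℝ}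

theorem solPair_spec (hp : 2 < p) (a b : ℝ) :
    IsSol p (sol p a b) (sol' p a b) ∧ sol p a b 0 = a ∧ sol' p a b 0 = b := by
  have h : ∃ vw : (ℝ → ℝ) × (ℝ → ℝ), IsSol p vw.1 vw.2 ∧ vw.1 0 = a ∧ vw.2 0 = b := by
    obtain ⟨v, w, h⟩ := exists_isSol hp a b
    exact ⟨(v, w), h⟩
  exact Classical.epsilon_spec h

theorem isSol_sol (hp : 2 < p) (a b : ℝ) : IsSol p (sol p a b) (sol' p a b) :=
  (solPair_spec hp a b).1

theorem sol_zero (hp : 2 < p) (a b : ℝ) : sol p a b 0 = a := (solPair_spec hp a b).2.1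

theorem sol'_zero (hp : 2 < p) (a b : ℝ) : sol' p a b 0 = b := (solPair_spec hp a b).2.2

theorem IsSol.eq_sol (hp : 2 < p) {v w : ℝ → ℝ} (h : IsSol p v w) {a b : ℝ} (ha : v 0 = a)
    (hb : w 0 = b) : v = sol p a b ∧ w = sol' p a b :=
  h.unique hp (isSol_sol hp a b) (by rw [sol_zero hp, ha]) (by rw [sol'_zero hp, hb])

theorem sol_reflect (hp : 2 < p) (a b t : ℝ) :
    sol p a b (-t) = sol p a (-b) t ∧ -sol' p a b (-t) = sol' p a (-b) t := by
  have := (isSol_sol hp a b).comp_neg.eq_sol hp (a := a) (b := -b)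
    (by simp [sol_zero hp]) (by simp [sol'_zero hp])
  exact ⟨congrFun this.1 t, congrFun this.2 t⟩

theorem sol_neg (hp : 2 < p) (a b t : ℝ) :
    sol p (-a) (-b) t = -sol p a b t ∧ sol' p (-a) (-b) t = -sol' p a b t := by
  have := (isSol_sol hp a b).neg.eq_sol hp (a := -a) (b := -b)
    (by simp [sol_zero hp]) (by simp [sol'_zero hp])
  exact ⟨(congrFun this.1 t).symm, (congrFun this.2 t).symm⟩

theorem sol_equilibrium (hp : 2 < p) {a : ℝ} (ha : force p a = 0) (t : ℝ) :
    sol p a 0 t = a ∧ sol' p a 0 t = 0 := by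
  have h : IsSol p (fun _ => a) (fun _ => 0) := fun t => ⟨hasDerivAt_const t a, by
    rw [ha]; exact hasDerivAt_const t (0 : ℝ)⟩
  have := h.eq_sol hp rfl rfl
  exact ⟨(congrFun this.1 t).symm, (congrFun this.2 t).symm⟩

/-- A solution which starts at rest at an equilibrium at some time is constant. -/
theorem IsSol.eq_const (hp : 2 < p) {v w : ℝ → ℝ} (h : IsSol p v w) {s : ℝ}
    (hs : force p (v s) = 0) (hs' : w s = 0) (t : ℝ) : v t = v s ∧ w t = 0 := by
  have h1 := (h.comp_add s).eq_sol hp (a := v s) (b := 0) (by simp) (by simp [hs'])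
  have h2 := sol_equilibrium hp hs (t - s)
  have h3 := congrFun h1.1 (t - s)
  have h4 := congrFun h1.2 (t - s)
  simp only [sub_add_cancel] at h3 h4
  exact ⟨h3.trans h2.1, h4.trans h2.2⟩

theorem sol_dist_le (hp : 2 < p) (R T : ℝ) : ∃ L : ℝ, 0 < L ∧ ∀ a b a' b' : ℝ,
    |a| ≤ R → |b| ≤ R → |a'| ≤ R → |b'| ≤ R → ∀ t, |t| ≤ T →
    |sol p a b t - sol p a' b' t| ≤ L * max |a - a'| |b - b'| ∧
      |sol' p a b t - sol' p a' b' t| ≤ L * max |a - a'| |b - b'| := by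
  obtain ⟨L, hL0, hL⟩ := IsSol.exists_dist_le hp R T
  have pos : ∀ a b a' b' : ℝ,
      |a| ≤ R → |b| ≤ R → |a'| ≤ R → |b'| ≤ R → ∀ t ∈ Icc 0 T,
      |sol p a b t - sol p a' b' t| ≤ L * max |a - a'| |b - b'| ∧
        |sol' p a b t - sol' p a' b' t| ≤ L * max |a - a'| |b - b'| := by
    intro a b a' b' h1 h2 h3 h4 t ht
    have := hL _ _ _ _ (isSol_sol hp a b) (isSol_sol hp a' b')
    simp only [sol_zero hp, sol'_zero hp] at this
    exact this h1 h2 h3 h4 t ht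
  refine ⟨L, hL0, fun a b a' b' h1 h2 h3 h4 t ht => ?_⟩
  rcases le_total 0 t with h | h
  · exact pos a b a' b' h1 h2 h3 h4 t ⟨h, (le_abs_self t).trans ht⟩
  · have := pos a (-b) a' (-b') h1 (by simpa using h2) h3 (by simpa using h4) (-t)
      ⟨by linarith, (neg_le_abs t).trans ht⟩
    rw [← (sol_reflect hp a b (-t)).1, ← (sol_reflect hp a' b' (-t)).1,
      ← (sol_reflect hp a b (-t)).2, ← (sol_reflect hp a' b' (-t)).2, neg_neg,
      ← neg_sub', abs_neg, ← neg_sub', abs_neg] at this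
    exact this

/-- Joint continuity follows from Lipschitz dependence on the data, uniform on compact time
intervals, together with continuity in time of the one solution at the base point. -/
theorem continuous_sol_and (hp : 2 < p) :
    (Continuous fun z : (ℝ × ℝ) × ℝ => sol p z.1.1 z.1.2 z.2) ∧
      Continuous fun z : (ℝ × ℝ) × ℝ => sol' p z.1.1 z.1.2 z.2 := by
  have main : ∀ g : ℝ → ℝ → ℝ → ℝ, (∀ a b, Continuous (g a b)) →
      (∀ R T : ℝ, ∃ L : ℝ, 0 < L ∧ ∀ a b a' b' : ℝ,
        |a| ≤ R → |b| ≤ R → |a'| ≤ R → |b'| ≤ R → ∀ t, |t| ≤ T →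
        |g a b t - g a' b' t| ≤ L * max |a - a'| |b - b'|) →
      Continuous fun z : (ℝ × ℝ) × ℝ => g z.1.1 z.1.2 z.2 := by
    intro g hg1 hg2
    rw [continuous_iff_continuousAt]
    rintro ⟨⟨a₀, b₀⟩, t₀⟩
    obtain ⟨L, hL0, hL⟩ := hg2 (max |a₀| |b₀| + 1) (|t₀| + 1)
    rw [ContinuousAt, tendsto_iff_dist_tendsto_zero]
    have h1 : Tendsto (fun z : (ℝ × ℝ) × ℝ => L * max |z.1.1 - a₀| |z.1.2 - b₀| +
        |g a₀ b₀ z.2 - g a₀ b₀ t₀|) (𝓝 ((a₀, b₀), t₀)) (𝓝 0) := by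
      have : Continuous fun z : (ℝ × ℝ) × ℝ => L * max |z.1.1 - a₀| |z.1.2 - b₀| +
        |g a₀ b₀ z.2 - g a₀ b₀ t₀| := by
        have := hg1 a₀ b₀
        fun_prop
      have h2 := this.tendsto ((a₀, b₀), t₀)
      simpa using h2
    refine squeeze_zero' (Eventually.of_forall fun z => dist_nonneg) ?_ h1
    have e1 : ∀ᶠ z : (ℝ × ℝ) × ℝ in 𝓝 ((a₀, b₀), t₀), |z.1.1 - a₀| < 1 :=
      ((by fun_prop : Continuous fun z : (ℝ × ℝ) × ℝ => |z.1.1 - a₀|).tendsto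
        ((a₀, b₀), t₀)).eventually_lt_const (by simp)
    have e2 : ∀ᶠ z : (ℝ × ℝ) × ℝ in 𝓝 ((a₀, b₀), t₀), |z.1.2 - b₀| < 1 :=
      ((by fun_prop : Continuous fun z : (ℝ × ℝ) × ℝ => |z.1.2 - b₀|).tendsto
        ((a₀, b₀), t₀)).eventually_lt_const (by simp)
    have e3 : ∀ᶠ z : (ℝ × ℝ) × ℝ in 𝓝 ((a₀, b₀), t₀), |z.2 - t₀| < 1 :=
      ((by fun_prop : Continuous fun z : (ℝ × ℝ) × ℝ => |z.2 - t₀|).tendsto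
        ((a₀, b₀), t₀)).eventually_lt_const (by simp)
    filter_upwards [e1, e2, e3] with z h1 h2 h3
    have k1 := abs_sub_abs_le_abs_sub z.1.1 a₀
    have k2 := abs_sub_abs_le_abs_sub z.1.2 b₀
    have k3 := abs_sub_abs_le_abs_sub z.2 t₀
    have m1 := le_max_left |a₀| |b₀|
    have m2 := le_max_right |a₀| |b₀|
    have := hL z.1.1 z.1.2 a₀ b₀ (by linarith) (by linarith) (by linarith) (by linarith) z.2
      (by linarith)
    rw [Real.dist_eq]
    linarith [abs_sub_le (g z.1.1 z.1.2 z.2) (g a₀ b₀ z.2) (g a₀ b₀ t₀)]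
  constructor
  · refine main _ (fun a b => (isSol_sol hp a b).continuous) fun R T => ?_
    obtain ⟨L, h0, hL⟩ := sol_dist_le hp R T
    exact ⟨L, h0, fun a b a' b' h1 h2 h3 h4 t ht => (hL a b a' b' h1 h2 h3 h4 t ht).1⟩
  · refine main _ (fun a b => (isSol_sol hp a b).continuous') fun R T => ?_
    obtain ⟨L, h0, hL⟩ := sol_dist_le hp R T
    exact ⟨L, h0, fun a b a' b' h1 h2 h3 h4 t ht => (hL a b a' b' h1 h2 h3 h4 t ht).2⟩

theorem _root_.Continuous.sol (hp : 2 < p) {X : Type*} [TopologicalSpace X] {a b t : X → ℝ}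
    (ha : Continuous a) (hb : Continuous b) (ht : Continuous t) :
    Continuous fun x => sol p (a x) (b x) (t x) :=
  (continuous_sol_and hp).1.comp ((ha.prodMk hb).prodMk ht)

theorem _root_.Continuous.sol' (hp : 2 < p) {X : Type*} [TopologicalSpace X] {a b t : X → ℝ}
    (ha : Continuous a) (hb : Continuous b) (ht : Continuous t) :
    Continuous fun x => sol' p (a x) (b x) (t x) :=
  (continuous_sol_and hp).2.comp ((ha.prodMk hb).prodMk ht)

/-! ### The solutions on the half-line -/

/-- The quantity `ρ = |b|^(p-2) e^{-(p-2)x}` in terms of which the decaying solutions are explicit. -/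
def rho (p b x : ℝ) : ℝ := |b| ^ (p - 2) * Real.exp (-(p - 2) * x)

/-- The decaying solutions of `u'' = force u` on the half-line. For `b > 0` these are the
translates of the soliton, with maximum at `log b`. -/
def hl (p b x : ℝ) : ℝ :=
  (2 * p) ^ (1 / (p - 2)) * b * Real.exp (-x) * (1 + rho p b x) ^ (-(2 / (p - 2)))

/-- The derivative of `hl`. -/
def hl' (p b x : ℝ) : ℝ := hl p b x * ((rho p b x - 1) / (rho p b x + 1))

theorem rho_nonneg (b x : ℝ) : 0 ≤ rho p b x := by unfold rho; positivity

theorem hasDerivAt_rho (b x : ℝ) : HasDerivAt (rho p b) (-(p - 2) * rho p b x) x := by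
  have h1 := ((hasDerivAt_id x).const_mul (-(p - 2))).exp.const_mul (|b| ^ (p - 2))
  refine h1.congr_deriv ?_
  simp [rho]
  ring

theorem hasDerivAt_hl (hp : 2 < p) (b x : ℝ) : HasDerivAt (hl p b) (hl' p b x) x := by
  have h0 := rho_nonneg (p := p) b x
  have h1 : HasDerivAt (fun x : ℝ => Real.exp (-x)) (-Real.exp (-x)) x := by
    simpa using (hasDerivAt_neg x).exp
  have h2 := ((hasDerivAt_rho (p := p) b x).const_add 1).rpow_const (p := -(2 / (p - 2)))
    (Or.inl (by positivity))
  have h3 := (h1.const_mul ((2 * p) ^ (1 / (p - 2)) * b)).mul h2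
  refine h3.congr_deriv ?_
  unfold hl' hl
  rw [Real.rpow_sub_one (by positivity)]
  have : p - 2 ≠ 0 := by linarith
  have h4 : rho p b x + 1 ≠ 0 := by positivity
  have h5 : 1 + rho p b x ≠ 0 := by positivity
  field_simp
  ring

/-- In terms of the logarithmic derivative `τ = (ρ - 1)/(ρ + 1)` the right-hand side is `(p/2)(1 -
τ²)`. This is the zero-energy relation, and the differential equation follows from it. -/
theorem abs_hl_rpow (hp : 2 < p) (b x : ℝ) :
    |hl p b x| ^ (p - 2) = 2 * p * rho p b x / (1 + rho p b x) ^ 2 := by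
  have h0 := rho_nonneg (p := p) b x
  have hq : p - 2 ≠ 0 := by linarith
  have hA : (0 : ℝ) < (2 * p) ^ (1 / (p - 2)) := Real.rpow_pos_of_pos (by linarith) _
  have hB : (0 : ℝ) < (1 + rho p b x) ^ (-(2 / (p - 2))) := Real.rpow_pos_of_pos (by positivity) _
  unfold hl
  rw [abs_mul, abs_mul, abs_mul, abs_of_pos hA, abs_of_pos hB, abs_of_pos (Real.exp_pos _),
    Real.mul_rpow (by positivity) hB.le, Real.mul_rpow (by positivity) (Real.exp_pos _).le,
    Real.mul_rpow hA.le (abs_nonneg b), ← Real.rpow_mul (by linarith),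
    ← Real.rpow_mul (by positivity), ← Real.exp_mul, one_div_mul_cancel hq, Real.rpow_one]
  have h1 : -(2 / (p - 2)) * (p - 2) = -2 := by field_simp
  rw [h1, Real.rpow_neg (by positivity)]
  have h2 : |b| ^ (p - 2) * Real.exp (-x * (p - 2)) = rho p b x := by
    unfold rho; congr 2; ring
  rw [Real.rpow_two, ← h2]
  ring

theorem isSol_hl (hp : 2 < p) (b : ℝ) : IsSol p (hl p b) (hl' p b) := fun x => by
  refine ⟨hasDerivAt_hl hp b x, ?_⟩
  have h0 := rho_nonneg (p := p) b x
  have hr := hasDerivAt_rho (p := p) b x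
  have h4 : rho p b x + 1 ≠ 0 := by positivity
  have h5 : 1 + rho p b x ≠ 0 := by positivity
  have h1 := (hasDerivAt_hl hp b x).mul ((hr.sub_const 1).div (hr.add_const 1) h4)
  refine h1.congr_deriv ?_
  rw [force, abs_hl_rpow hp, hl']
  simp only [Pi.div_apply]
  field_simp
  ring

theorem hl'_sq (hp : 2 < p) (b x : ℝ) : hl' p b x ^ 2 = 2 * pot p (hl p b x) := by
  have h0 := rho_nonneg (p := p) b x
  have h4 : rho p b x + 1 ≠ 0 := by positivity
  have h5 : 1 + rho p b x ≠ 0 := by positivity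
  have h6 : p ≠ 0 := by linarith
  rw [pot_eq hp, abs_hl_rpow hp, hl']
  field_simp
  ring

theorem hl_zero_left (x : ℝ) : hl p 0 x = 0 := by simp [hl]

theorem hl'_zero_left (x : ℝ) : hl' p 0 x = 0 := by simp [hl', hl_zero_left]

theorem hl_neg (b x : ℝ) : hl p (-b) x = -hl p b x := by simp [hl, rho]

theorem hl'_neg (b x : ℝ) : hl' p (-b) x = -hl' p b x := by simp [hl', hl_neg, rho]

theorem hl_pos (hp : 2 < p) {b : ℝ} (hb : 0 < b) (x : ℝ) : 0 < hl p b x := by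
  have h0 := rho_nonneg (p := p) b x
  have hA : (0 : ℝ) < (2 * p) ^ (1 / (p - 2)) := Real.rpow_pos_of_pos (by linarith) _
  have hB : (0 : ℝ) < (1 + rho p b x) ^ (-(2 / (p - 2))) := Real.rpow_pos_of_pos (by positivity) _
  unfold hl
  positivity

theorem abs_hl_le (hp : 2 < p) (b x : ℝ) :
    |hl p b x| ≤ (2 * p) ^ (1 / (p - 2)) * |b| * Real.exp (-x) := by
  have h0 := rho_nonneg (p := p) b x
  have hA : (0 : ℝ) < (2 * p) ^ (1 / (p - 2)) := Real.rpow_pos_of_pos (by linarith) _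
  have hB : (0 : ℝ) < (1 + rho p b x) ^ (-(2 / (p - 2))) := Real.rpow_pos_of_pos (by positivity) _
  have hB1 : (1 + rho p b x) ^ (-(2 / (p - 2))) ≤ 1 :=
    Real.rpow_le_one_of_one_le_of_nonpos (by linarith)
      (neg_nonpos.2 (div_nonneg zero_le_two (by linarith)))
  unfold hl
  rw [abs_mul, abs_mul, abs_mul, abs_of_pos hA, abs_of_pos hB, abs_of_pos (Real.exp_pos _)]
  exact mul_le_of_le_one_right (by positivity) hB1

theorem abs_hl'_le (b x : ℝ) : |hl' p b x| ≤ |hl p b x| := by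
  have h0 := rho_nonneg (p := p) b x
  unfold hl'
  rw [abs_mul]
  refine mul_le_of_le_one_right (abs_nonneg _) ?_
  rw [abs_div, abs_of_pos (by positivity : 0 < rho p b x + 1), div_le_one (by positivity)]
  exact abs_le.2 ⟨by linarith, by linarith⟩

theorem pot_hl_nonneg (hp : 2 < p) (b x : ℝ) : 0 ≤ pot p (hl p b x) := by
  have := hl'_sq hp b x
  nlinarith [sq_nonneg (hl' p b x)]

theorem abs_hl_le_peak (hp : 2 < p) (b x : ℝ) : |hl p b x| ≤ peak p :=
  abs_le_peak hp (pot_hl_nonneg hp b x)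

theorem hl_eq_peak (hp : 2 < p) {b x : ℝ} (hb : 0 < b) (h : hl' p b x = 0) :
    hl p b x = peak p := by
  have h1 := hl'_sq hp b x
  rw [h] at h1
  have h2 := abs_hl_le_peak hp b x
  rw [abs_of_pos (hl_pos hp hb x)] at h2
  rcases eq_or_lt_of_le h2 with h3 | h3
  · exact h3
  · have := pot_pos hp (hl_pos hp hb x) h3
    linarith

theorem rho_lt_one (hp : 2 < p) {b x : ℝ} (hb : |b| < 1) (hx : 0 ≤ x) : rho p b x < 1 := by
  have h1 : |b| ^ (p - 2) < 1 := Real.rpow_lt_one (abs_nonneg b) hb (by linarith)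
  have h2 : Real.exp (-(p - 2) * x) ≤ 1 := Real.exp_le_one_iff.2 (by nlinarith)
  have h3 : 0 ≤ |b| ^ (p - 2) := by positivity
  unfold rho
  nlinarith [Real.exp_pos (-(p - 2) * x)]

theorem hl'_neg_iff (hp : 2 < p) {b x : ℝ} (hb : 0 < b) : hl' p b x < 0 ↔ rho p b x < 1 := by
  have h0 := rho_nonneg (p := p) b x
  unfold hl'
  rw [mul_neg_iff]
  have := hl_pos hp hb x
  constructor
  · rintro (h | h)
    · have h2 := (div_neg_iff.1 h.2)
      rcases h2 with h2 | h2 <;> linarith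
    · linarith
  · intro h
    exact Or.inl ⟨this, div_neg_of_neg_of_pos (by linarith) (by linarith)⟩

/-- The data at the vertex of the decaying solutions are the zero-energy data. -/
theorem exists_hl_data (hp : 2 < p) {c w : ℝ} (h : w ^ 2 = 2 * pot p c) :
    ∃ b, hl p b 0 = c ∧ hl' p b 0 = w := by
  rcases eq_or_ne c 0 with rfl | hc
  · rw [pot_zero hp] at h
    refine ⟨0, hl_zero_left 0, ?_⟩
    rw [hl'_zero_left]
    nlinarith
  set τ := w / c with hτ
  have hcr : 0 < |c| ^ (p - 2) := Real.rpow_pos_of_pos (abs_pos.2 hc) _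
  have hτ2 : τ ^ 2 = 1 - 2 * |c| ^ (p - 2) / p := by
    rw [hτ, div_pow, h, pot_eq hp]
    field_simp
  have hτ1 : τ ^ 2 < 1 := by
    rw [hτ2]
    have : 0 < 2 * |c| ^ (p - 2) / p := by positivity
    linarith
  have hτa : |τ| < 1 := by
    exact (sq_lt_one_iff_abs_lt_one τ).1 hτ1
  have h1 := (abs_lt.1 hτa).1
  have h2 := (abs_lt.1 hτa).2
  -- Inverts `τ = (ρ - 1)/(ρ + 1)`, the logarithmic derivative of `hl` at the vertex; then `|b| =
  -- r^(1/(p-2))`, and the sign of `b` is that of `c`.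
  set r := (1 + τ) / (1 - τ) with hr
  have hr0 : 0 < r := div_pos (by linarith) (by linarith)
  have hq : p - 2 ≠ 0 := by linarith
  have key : ∀ b : ℝ, |b| = r ^ (1 / (p - 2)) → rho p b 0 = r := by
    intro b hb
    rw [rho, hb, ← Real.rpow_mul hr0.le, one_div_mul_cancel hq]
    simp
  have habs : ∀ b : ℝ, |b| = r ^ (1 / (p - 2)) → |hl p b 0| = |c| := by
    intro b hb
    have h3 : |hl p b 0| ^ (p - 2) = |c| ^ (p - 2) := by
      rw [abs_hl_rpow hp, key b hb]
      have h4 : |c| ^ (p - 2) = p * (1 - τ ^ 2) / 2 := by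
        rw [hτ2]
        have : p ≠ 0 := by linarith
        field_simp
        ring
      rw [h4, hr]
      have : 1 - τ ≠ 0 := by linarith
      have h5 : 1 + (1 + τ) / (1 - τ) = 2 / (1 - τ) := by field_simp; ring
      rw [h5]
      field_simp
      ring
    exact (Real.rpow_left_inj (abs_nonneg _) (abs_nonneg _) hq).1 h3
  have hb0 : 0 < r ^ (1 / (p - 2)) := Real.rpow_pos_of_pos hr0 _
  have hw : ∀ b : ℝ, |b| = r ^ (1 / (p - 2)) → hl p b 0 = c → hl' p b 0 = w := by
    intro b hb h3
    rw [hl', h3, key b hb, hr]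
    have : 1 - τ ≠ 0 := by linarith
    have h5 : ((1 + τ) / (1 - τ) - 1) / ((1 + τ) / (1 - τ) + 1) = τ := by
      have h6 : (1 + τ) / (1 - τ) + 1 = 2 / (1 - τ) := by field_simp; ring
      rw [h6]
      field_simp
      ring
    rw [h5, hτ]
    field_simp
  rcases lt_or_gt_of_ne hc with hc' | hc'
  · have e : |(-r ^ (1 / (p - 2)))| = r ^ (1 / (p - 2)) := by rw [abs_neg, abs_of_pos hb0]
    have h3 : hl p (-r ^ (1 / (p - 2))) 0 = c := by
      have h4 := habs _ e
      have h5 := hl_pos hp hb0 0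
      rw [hl_neg, abs_neg, abs_of_pos h5, abs_of_neg hc'] at h4
      rw [hl_neg]
      linarith
    exact ⟨_, h3, hw _ e h3⟩
  · have e : |(r ^ (1 / (p - 2)))| = r ^ (1 / (p - 2)) := abs_of_pos hb0
    have h3 : hl p (r ^ (1 / (p - 2))) 0 = c := by
      have h4 := habs _ e
      rwa [abs_of_pos (hl_pos hp hb0 0), abs_of_pos hc'] at h4
    exact ⟨_, h3, hw _ e h3⟩

end Fork

namespace Fork

open ForkFun

/-! ### Sobolev functions on intervals -/

theorem memLp_Icc_of_continuousOn {f : ℝ → ℝ} {L : ℝ} (hf : ContinuousOn f (Icc 0 L)) :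
    MemLp f 2 (volume.restrict (Icc 0 L)) := by
  obtain ⟨C, hC⟩ := isCompact_Icc.exists_bound_of_continuousOn hf
  refine MemLp.of_bound (hf.aestronglyMeasurable measurableSet_Icc) C ?_
  exact (ae_restrict_iff' measurableSet_Icc).2 (Eventually.of_forall hC)

theorem absolutelyContinuous_of_hasDerivAt {f f' : ℝ → ℝ} (hf : ∀ x, HasDerivAt f (f' x) x)
    (hf' : Continuous f') (a b : ℝ) : AbsolutelyContinuousOnInterval f a b := by
  refine ContDiffOn.absolutelyContinuousOnInterval (ContDiff.contDiffOn ?_)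
  refine contDiff_one_iff_deriv.2 ⟨fun x => (hf x).differentiableAt, ?_⟩
  rwa [show deriv f = f' from funext fun x => (hf x).deriv]

theorem intervalIntegrable_of_memLp {g : ℝ → ℝ} {L : ℝ}
    (hg : MemLp g 2 (volume.restrict (Icc 0 L))) : IntegrableOn g (Icc 0 L) :=
  hg.integrable (by norm_num)

/-- The primitive of a function cut off outside `[0, L]`. -/
def cutPrim (g : ℝ → ℝ) (L x : ℝ) : ℝ := ∫ t in (0 : ℝ)..x, (Icc 0 L).indicator g t

section cutPrim

variable {g : ℝ → ℝ} {L : ℝ}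

theorem integrable_indicator_of_memLp (hg : MemLp g 2 (volume.restrict (Icc 0 L))) :
    Integrable ((Icc 0 L).indicator g) :=
  (integrable_indicator_iff measurableSet_Icc).2 (intervalIntegrable_of_memLp hg)

theorem cutPrim_absolutelyContinuous (hg : MemLp g 2 (volume.restrict (Icc 0 L)))
    (a b : ℝ) :
    AbsolutelyContinuousOnInterval (cutPrim g L) a b := by
  have h1 := (integrable_indicator_of_memLp hg).intervalIntegrable (a := min (min a b) 0)
    (b := max (max a b) 0)
  have hle : min (min a b) 0 ≤ max (max a b) 0 := (min_le_right _ _).trans (le_max_right _ _)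
  refine (h1.absolutelyContinuousOnInterval_intervalIntegral (c := 0) ?_).mono ?_
  · rw [uIcc_of_le hle]
    exact ⟨min_le_right _ _, le_max_right _ _⟩
  · rw [uIcc_of_le hle]
    exact Icc_subset_Icc (min_le_left _ _) (le_max_left _ _)

theorem deriv_cutPrim (hg : MemLp g 2 (volume.restrict (Icc 0 L))) :
    ∀ᵐ x, deriv (cutPrim g L) x = (Icc 0 L).indicator g x := by
  filter_upwards [LocallyIntegrable.ae_hasDerivAt_integral
    (integrable_indicator_of_memLp hg).locallyIntegrable] with x hx
  exact (hx 0).deriv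

theorem cutPrim_of_ge {x : ℝ} (hL : 0 ≤ L) (hx : L ≤ x) :
    cutPrim g L x = ∫ t in Icc 0 L, g t := by
  rw [cutPrim, intervalIntegral.integral_of_le (hL.trans hx), ← integral_Icc_eq_integral_Ioc,
    setIntegral_indicator measurableSet_Icc, inter_eq_self_of_subset_right (Icc_subset_Icc_right hx)]

theorem memH1On_Icc_cutPrim (hg : MemLp g 2 (volume.restrict (Icc 0 L))) :
    MemH1On (Icc 0 L) (cutPrim g L) := by
  refine ⟨fun a _ b _ => cutPrim_absolutelyContinuous hg a b, ?_, ?_⟩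
  · refine memLp_Icc_of_continuousOn ?_
    refine (cutPrim_absolutelyContinuous hg 0 L).continuousOn.mono ?_
    exact Icc_subset_uIcc
  · refine hg.ae_eq ?_
    filter_upwards [ae_restrict_of_ae (deriv_cutPrim hg), ae_restrict_mem measurableSet_Icc]
      with x hx hx'
    rw [hx, indicator_of_mem hx']

/-- The zero mean makes the primitive vanish beyond `L`, which yields compactly supported test
functions on the half-line. -/
theorem memH1On_Ici_cutPrim (hg : MemLp g 2 (volume.restrict (Icc 0 L)))
    (hL : 0 ≤ L) (h0 : ∫ t in Icc 0 L, g t = 0) :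
    MemH1On (Ici 0) (cutPrim g L) := by
  refine ⟨fun a _ b _ => cutPrim_absolutelyContinuous hg a b, ?_, ?_⟩
  · have h1 : MemLp ((Icc 0 L).indicator (cutPrim g L)) 2 (volume.restrict (Ici 0)) :=
      ((memLp_indicator_iff_restrict measurableSet_Icc).2 (memH1On_Icc_cutPrim hg).2.1).restrict _
    refine h1.ae_eq ?_
    filter_upwards [ae_restrict_mem measurableSet_Ici] with x hx
    by_cases hxL : x ≤ L
    · rw [indicator_of_mem (show x ∈ Icc 0 L from ⟨hx, hxL⟩)]
    · rw [indicator_of_notMem (fun h => hxL h.2), cutPrim_of_ge hL (not_le.1 hxL).le, h0]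
  · have h1 : MemLp ((Icc 0 L).indicator g) 2 (volume.restrict (Ici 0)) :=
      ((memLp_indicator_iff_restrict measurableSet_Icc).2 hg).restrict _
    refine h1.ae_eq ?_
    filter_upwards [ae_restrict_of_ae (deriv_cutPrim hg)] with x hx
    rw [hx]

end cutPrim

/-! ### Regularity of bound-states from the weak form -/

variable {p : ℝ}

theorem weakIntegrand_eq (f g : ℝ → ℝ) (x : ℝ) :
    weakIntegrand p f g x = deriv f x * deriv g x + force p (f x) * g x := by
  unfold weakIntegrand force; ring

/-- Integration by parts in the weak form. -/
theorem integral_weakIntegrand_Icc {u η : ℝ → ℝ} {L : ℝ} (hL : 0 ≤ L)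
    (hu : MemH1On (Icc 0 L) u) (hη : MemH1On (Icc 0 L) η) {H h : ℝ → ℝ}
    (hH : ∀ x, HasDerivAt H (h x) x) (hh : Continuous h)
    (hhu : ∀ x ∈ Icc 0 L, h x = force p (u x)) :
    ∫ x in Icc 0 L, weakIntegrand p u η x =
      (∫ x in Icc 0 L, (deriv u x - H x) * deriv η x) + (H L * η L - H 0 * η 0) := by
  have hHc : Continuous H := continuous_iff_continuousAt.2 fun x => (hH x).continuousAt
  have hH2 := memLp_Icc_of_continuousOn (L := L) hHc.continuousOn
  have hη1 := hη.1 0 ⟨le_rfl, hL⟩ L ⟨hL, le_rfl⟩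
  have hparts := (absolutelyContinuous_of_hasDerivAt hH hh 0 L).integral_deriv_mul_eq_sub hη1
  rw [intervalIntegral.integral_of_le hL, ← integral_Icc_eq_integral_Ioc] at hparts
  rw [← hparts, ← integral_add]
  · refine setIntegral_congr_fun measurableSet_Icc fun x hx => ?_
    simp only [weakIntegrand_eq]
    rw [(hH x).deriv, hhu x hx]
    ring
  · exact (hu.2.2.sub hH2).integrable_mul hη.2.2
  · have hηc := hη1.continuousOn
    rw [uIcc_of_le hL] at hηc
    refine Integrable.add ?_ (hH2.integrable_mul hη.2.2)
    rw [show deriv H = h from funext fun x => (hH x).deriv]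
    exact (hh.continuousOn.mul hηc).integrableOn_Icc

theorem memH1On_zero (I : Set ℝ) : MemH1On I fun _ => (0 : ℝ) := by
  refine ⟨fun a _ b _ => ?_, by simp, by simp⟩
  exact absolutelyContinuous_of_hasDerivAt (fun x => hasDerivAt_const x (0 : ℝ))
    continuous_const a b

theorem weakIntegrand_zero_right (u : ℝ → ℝ) (x : ℝ) :
    weakIntegrand p u (fun _ => 0) x = 0 := by
  simp [weakIntegrand]

theorem eq_add_integral_of_deriv_ae {u H : ℝ → ℝ} {L x : ℝ}
    (hu : MemH1On (Icc 0 L) u) (hH : ∀ᵐ x ∂volume.restrict (Icc 0 L), deriv u x = H x)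
    (hx : x ∈ Icc 0 L) : u x = u 0 + ∫ t in (0 : ℝ)..x, H t := by
  have h1 := (hu.1 0 ⟨le_rfl, hx.1.trans hx.2⟩ x hx).integral_deriv_eq_sub
  have h2 : ∫ t in (0 : ℝ)..x, deriv u t = ∫ t in (0 : ℝ)..x, H t := by
    refine intervalIntegral.integral_congr_ae ?_
    rw [ae_restrict_iff' measurableSet_Icc] at hH
    filter_upwards [hH] with t ht ht'
    rw [uIoc_of_le hx.1] at ht'
    exact ht ⟨ht'.1.le, ht'.2.trans hx.2⟩
  linarith

theorem ae_eq_of_integral_sq_eq_zero {g : ℝ → ℝ} {L : ℝ}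
    (hg : MemLp g 2 (volume.restrict (Icc 0 L))) (h : ∫ x in Icc 0 L, g x * g x = 0) :
    ∀ᵐ x ∂volume.restrict (Icc 0 L), g x = 0 := by
  have h1 := (integral_eq_zero_iff_of_nonneg_ae (μ := volume.restrict (Icc 0 L))
    (Eventually.of_forall fun x => mul_self_nonneg (g x)) (hg.integrable_mul hg)).1 h
  filter_upwards [h1] with x hx
  simpa using hx

variable {P : ℕ} {ℓ : ℝ} {u : ForkFun P}

/-- Regularity on a pendant, with the Neumann condition at the tip. -/
theorem IsBoundState.pendant_deriv (hℓ : 0 < ℓ) (hu : IsBoundState p ℓ u)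
    (i : Fin P) {h : ℝ → ℝ} (hh : Continuous h)
    (hhu : ∀ x ∈ Icc 0 ℓ, h x = force p (u.pendant i x)) :
    ∀ᵐ x ∂volume.restrict (Icc 0 ℓ), deriv (u.pendant i) x = ∫ t in ℓ..x, h t := by
  set H : ℝ → ℝ := fun x => ∫ t in ℓ..x, h t with hHdef
  have hH : ∀ x, HasDerivAt H (h x) x := fun x =>
    intervalIntegral.integral_hasDerivAt_right (hh.intervalIntegrable _ _)
      (hh.stronglyMeasurableAtFilter _ _) hh.continuousAt
  have hHc : Continuous H := continuous_iff_continuousAt.2 fun x => (hH x).continuousAt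
  have hui := (hu.1.2 i).1
  -- The test function has derivative `g`, vanishes at the vertex and lives on this pendant only.
  -- The boundary term at the tip vanishes because `H ℓ = 0`, so the weak form reads `∫ g² = 0`.
  set g : ℝ → ℝ := fun x => deriv (u.pendant i) x - H x with hgdef
  have hg : MemLp g 2 (volume.restrict (Icc 0 ℓ)) :=
    hui.2.2.sub (memLp_Icc_of_continuousOn hHc.continuousOn)
  have hη := memH1On_Icc_cutPrim hg
  set η : ForkFun P := ⟨fun _ => 0, fun j => if j = i then cutPrim g ℓ else fun _ => 0⟩
  have hηmem : MemH1 ℓ η := by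
    refine ⟨memH1On_zero _, fun j => ?_⟩
    by_cases hj : j = i
    · simp only [η, if_pos hj]
      exact ⟨hη, by simp [cutPrim]⟩
    · simp only [η, if_neg hj]
      exact ⟨memH1On_zero _, trivial⟩
  have hw := hu.2.2 η hηmem
  have e1 : ∫ x in Ici (0 : ℝ), weakIntegrand p u.halfLine η.halfLine x = 0 := by
    simp only [η, weakIntegrand_zero_right, integral_zero]
  have e2 : ∑ j, ∫ x in Icc 0 ℓ, weakIntegrand p (u.pendant j) (η.pendant j) x =
      ∫ x in Icc 0 ℓ, weakIntegrand p (u.pendant i) (cutPrim g ℓ) x := by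
    rw [Finset.sum_eq_single i]
    · simp [η]
    · intro j _ hj
      simp only [η, if_neg hj, weakIntegrand_zero_right, integral_zero]
    · simp
  rw [e1, e2, zero_add, integral_weakIntegrand_Icc hℓ.le hui hη hH hh hhu] at hw
  have e3 : H ℓ = 0 := by simp [hHdef]
  have e4 : cutPrim g ℓ 0 = 0 := by simp [cutPrim]
  have e5 : ∫ x in Icc 0 ℓ, (deriv (u.pendant i) x - H x) * deriv (cutPrim g ℓ) x =
      ∫ x in Icc 0 ℓ, g x * g x := by
    refine setIntegral_congr_ae measurableSet_Icc ?_
    filter_upwards [deriv_cutPrim hg] with x hx hx'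
    rw [hx, indicator_of_mem hx']
  rw [e3, e4, e5] at hw
  have := ae_eq_of_integral_sq_eq_zero hg (by linarith)
  filter_upwards [this] with x hx
  exact sub_eq_zero.1 hx

/-- Regularity on the half-line. -/
theorem IsBoundState.halfLine_deriv (hu : IsBoundState p ℓ u)
    {h : ℝ → ℝ} (hh : Continuous h) (hhu : ∀ x ∈ Ici 0, h x = force p (u.halfLine x)) :
    ∃ C : ℝ, ∀ L, ∀ᵐ x ∂volume.restrict (Icc 0 L),
      deriv u.halfLine x = C + ∫ t in (0 : ℝ)..x, h t := by
  set H : ℝ → ℝ := fun x => ∫ t in (0 : ℝ)..x, h t with hHdef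
  have hH : ∀ x, HasDerivAt H (h x) x := fun x =>
    intervalIntegral.integral_hasDerivAt_right (hh.intervalIntegrable _ _)
      (hh.stronglyMeasurableAtFilter _ _) hh.continuousAt
  have hHc : Continuous H := continuous_iff_continuousAt.2 fun x => (hH x).continuousAt
  have hu0 := hu.1.1
  have hmono : ∀ L : ℝ, MemH1On (Icc 0 L) u.halfLine := fun L =>
    ⟨fun a ha b hb => hu0.1 a ha.1 b hb.1,
      hu0.2.1.mono_measure (Measure.restrict_mono Icc_subset_Ici_self le_rfl),
      hu0.2.2.mono_measure (Measure.restrict_mono Icc_subset_Ici_self le_rfl)⟩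
  have key : ∀ L : ℝ, 0 < L → ∃ C : ℝ, ∀ᵐ x ∂volume.restrict (Icc 0 L),
      deriv u.halfLine x = C + H x := by
    intro L hL
    have hg0 : MemLp (fun x => deriv u.halfLine x - H x) 2 (volume.restrict (Icc 0 L)) :=
      (hmono L).2.2.sub (memLp_Icc_of_continuousOn hHc.continuousOn)
    -- The argument of du Bois-Reymond: subtracting the mean makes the primitive of `g` an
    -- admissible test function supported in `[0, L]`.
    set C : ℝ := (∫ x in Icc 0 L, (deriv u.halfLine x - H x)) / L with hC
    set g : ℝ → ℝ := fun x => deriv u.halfLine x - H x - C with hgdef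
    have hg : MemLp g 2 (volume.restrict (Icc 0 L)) := hg0.sub (memLp_const C)
    have hgint : ∫ x in Icc 0 L, g x = 0 := by
      rw [hgdef, integral_sub (intervalIntegrable_of_memLp hg0) (integrable_const C)]
      simp [hL.le]
      rw [hC]
      field_simp
      ring
    have hη := memH1On_Icc_cutPrim hg
    have hη' := memH1On_Ici_cutPrim hg hL.le hgint
    have hηL : cutPrim g L L = 0 := by rw [cutPrim_of_ge hL.le le_rfl, hgint]
    have hη0 : cutPrim g L 0 = 0 := by simp [cutPrim]
    have hw := hu.2.2 ⟨cutPrim g L, fun j => fun _ => 0⟩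
      ⟨hη', fun j => ⟨memH1On_zero _, hη0.symm⟩⟩
    simp only [weakIntegrand_zero_right, integral_zero, Finset.sum_const_zero, add_zero] at hw
    have e1 : ∫ x in Ici 0, weakIntegrand p u.halfLine (cutPrim g L) x =
        ∫ x in Icc 0 L, weakIntegrand p u.halfLine (cutPrim g L) x := by
      refine setIntegral_eq_of_subset_of_ae_sdiff_eq_zero measurableSet_Ici.nullMeasurableSet
        Icc_subset_Ici_self ?_
      filter_upwards [deriv_cutPrim hg] with x hx hx'
      have hxL : L < x := not_le.1 fun h => hx'.2 ⟨hx'.1, h⟩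
      rw [weakIntegrand_eq, hx, indicator_of_notMem hx'.2, cutPrim_of_ge hL.le hxL.le, hgint]
      ring
    rw [e1, integral_weakIntegrand_Icc hL.le (hmono L) hη hH hh (fun x hx => hhu x hx.1),
      hηL, hη0] at hw
    have e5 : ∫ x in Icc 0 L, (deriv u.halfLine x - H x) * deriv (cutPrim g L) x =
        ∫ x in Icc 0 L, (g x * g x + C * g x) := by
      refine setIntegral_congr_ae measurableSet_Icc ?_
      filter_upwards [deriv_cutPrim hg] with x hx hx'
      rw [hx, indicator_of_mem hx', hgdef]
      ring
    have e6 : ∫ x in Icc 0 L, (g x * g x + C * g x) =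
        (∫ x in Icc 0 L, g x * g x) + ∫ x in Icc 0 L, C * g x :=
      integral_add (hg.integrable_mul hg) ((intervalIntegrable_of_memLp hg).const_mul C)
    rw [e5, e6, integral_const_mul, hgint] at hw
    have := ae_eq_of_integral_sq_eq_zero hg (by linarith)
    refine ⟨C, ?_⟩
    filter_upwards [this] with x hx
    have : deriv u.halfLine x - H x - C = 0 := hx
    linarith
  -- The constants found for different `L` agree, since each can be read off from `u` on `[0, 1]`.
  have keyint : ∀ L : ℝ, 1 ≤ L → ∀ C : ℝ, (∀ᵐ x ∂volume.restrict (Icc 0 L),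
      deriv u.halfLine x = C + H x) →
      C = u.halfLine 1 - u.halfLine 0 - ∫ t in (0 : ℝ)..1, H t := by
    intro L hL C hC
    have h1 := eq_add_integral_of_deriv_ae (hmono L) hC ⟨zero_le_one, hL⟩
    rw [intervalIntegral.integral_add (by simp) (hHc.intervalIntegrable _ _)] at h1
    simp at h1
    linarith
  refine ⟨u.halfLine 1 - u.halfLine 0 - ∫ t in (0 : ℝ)..1, H t, fun L => ?_⟩
  obtain ⟨C, hC⟩ := key (max L 1) (lt_max_of_lt_right one_pos)
  rw [← keyint _ (le_max_right _ _) C hC]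
  exact ae_mono (Measure.restrict_mono (Icc_subset_Icc_right (le_max_left _ _)) le_rfl) hC

end Fork

/-! ### Bound-states as matching data at the vertex -/

namespace Fork

open ForkFun

variable {p : ℝ} {P : ℕ} {ℓ : ℝ} {u : ForkFun P}

theorem deriv_eq_of_eqOn {f g : ℝ → ℝ} {I : Set ℝ} {x : ℝ} (h : EqOn f g I) (hx : I ∈ 𝓝 x) :
    deriv f x = deriv g x :=
  EventuallyEq.deriv_eq (by filter_upwards [hx] with y hy using h hy)

theorem deriv_ae_eq_Icc {f g : ℝ → ℝ} {a b : ℝ} (h : EqOn f g (Icc a b)) :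
    ∀ᵐ x, x ∈ Icc a b → deriv f x = deriv g x := by
  filter_upwards [compl_mem_ae_iff.2 (measure_singleton a),
    compl_mem_ae_iff.2 (measure_singleton b)] with x hxa hxb hx
  have h1 : a < x := lt_of_le_of_ne hx.1 fun h => hxa h.symm
  have h2 : x < b := lt_of_le_of_ne hx.2 fun h => hxb h
  exact deriv_eq_of_eqOn h (Icc_mem_nhds h1 h2)

theorem deriv_ae_eq_Ici {f g : ℝ → ℝ} {a : ℝ} (h : EqOn f g (Ici a)) :
    ∀ᵐ x, x ∈ Ici a → deriv f x = deriv g x := by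
  filter_upwards [compl_mem_ae_iff.2 (measure_singleton a)] with x hxa hx
  have h1 : a < x := lt_of_le_of_ne hx fun h => hxa h.symm
  exact deriv_eq_of_eqOn h (Ici_mem_nhds h1)

/-- The function on the fork graph made of the decaying solution `hl p b` on the half-line and of
the solutions starting at rest from the values `d i` at the tips of the pendants. -/
def fork (p ℓ b : ℝ) (d : Fin P → ℝ) : ForkFun P :=
  ⟨hl p b, fun i x => sol p (d i) 0 (ℓ - x)⟩

/-- Continuity and Kirchhoff's condition at the vertex. -/
def Matching (p ℓ b : ℝ) (d : Fin P → ℝ) : Prop :=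
  (∀ i, sol p (d i) 0 ℓ = hl p b 0) ∧ hl' p b 0 = ∑ i, sol' p (d i) 0 ℓ

theorem hasDerivAt_pendant (hp : 2 < p) (d x : ℝ) :
    HasDerivAt (fun x => sol p d 0 (ℓ - x)) (-sol' p d 0 (ℓ - x)) x ∧
      HasDerivAt (fun x => -sol' p d 0 (ℓ - x)) (force p (sol p d 0 (ℓ - x))) x := by
  have h := isSol_sol hp d 0 (ℓ - x)
  exact ⟨h.1.comp_const_sub ℓ x, (h.2.comp_const_sub ℓ x).neg.congr_deriv (neg_neg _)⟩

theorem continuous_pendant (hp : 2 < p) (d : ℝ) : Continuous fun x => sol p d 0 (ℓ - x) :=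
  (isSol_sol hp d 0).continuous.comp (continuous_const.sub continuous_id)

theorem continuous_pendant' (hp : 2 < p) (d : ℝ) : Continuous fun x => -sol' p d 0 (ℓ - x) :=
  ((isSol_sol hp d 0).continuous'.comp (continuous_const.sub continuous_id)).neg

theorem memH1On_pendant (hp : 2 < p) (d : ℝ) :
    MemH1On (Icc 0 ℓ) fun x => sol p d 0 (ℓ - x) := by
  refine ⟨fun a _ b _ => absolutelyContinuous_of_hasDerivAt
    (fun x => (hasDerivAt_pendant hp d x).1) (continuous_pendant' hp d) a b,
    memLp_Icc_of_continuousOn (continuous_pendant hp d).continuousOn, ?_⟩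
  rw [show deriv (fun x => sol p d 0 (ℓ - x)) = fun x => -sol' p d 0 (ℓ - x) from
    funext fun x => (hasDerivAt_pendant hp d x).1.deriv]
  exact memLp_Icc_of_continuousOn (continuous_pendant' hp d).continuousOn

/-- Only the vertex contributes: the boundary term at the tip vanishes since the solution is at rest
there. -/
theorem integral_weakIntegrand_pendant (hp : 2 < p) (hℓ : 0 ≤ ℓ) (d : ℝ) {η : ℝ → ℝ}
    (hη : MemH1On (Icc 0 ℓ) η) :
    ∫ x in Icc 0 ℓ, weakIntegrand p (fun x => sol p d 0 (ℓ - x)) η x =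
      sol' p d 0 ℓ * η 0 := by
  rw [integral_weakIntegrand_Icc hℓ (memH1On_pendant hp d) hη
    (fun x => (hasDerivAt_pendant hp d x).2)
    ((continuous_force hp).comp (continuous_pendant hp d)) (fun x _ => rfl)]
  have : ∀ x, deriv (fun x => sol p d 0 (ℓ - x)) x - -sol' p d 0 (ℓ - x) = 0 := fun x => by
    rw [(hasDerivAt_pendant hp d x).1.deriv, sub_self]
  simp [this, sol'_zero hp]

theorem integrableOn_exp_neg_Ici {c : ℝ} (hc : 0 < c) :
    IntegrableOn (fun x => Real.exp (-c * x)) (Ici 0) :=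
  (integrableOn_Ici_iff_integrableOn_Ioi (by simp)).2 (exp_neg_integrableOn_Ioi 0 hc)

theorem memLp_of_abs_le_exp {f : ℝ → ℝ} (hf : Continuous f) {C : ℝ}
    (hC : ∀ x, |f x| ≤ C * Real.exp (-x)) : MemLp f 2 (volume.restrict (Ici 0)) := by
  rw [memLp_two_iff_integrable_sq hf.aestronglyMeasurable]
  refine ((integrableOn_exp_neg_Ici two_pos).const_mul (C ^ 2)).mono'
    (hf.pow 2).aestronglyMeasurable (Eventually.of_forall fun x => ?_)
  rw [Real.norm_eq_abs, abs_pow]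
  calc |f x| ^ 2 ≤ (C * Real.exp (-x)) ^ 2 := by
        gcongr
        exact hC x
    _ = C ^ 2 * Real.exp (-2 * x) := by
        rw [mul_pow, ← Real.exp_nat_mul]; congr 2; push_cast; ring

theorem memH1On_hl (hp : 2 < p) (b : ℝ) : MemH1On (Ici 0) (hl p b) := by
  have hs := isSol_hl hp b
  refine ⟨fun x _ y _ => absolutelyContinuous_of_hasDerivAt (fun x => (hs x).1) hs.continuous' x y,
    memLp_of_abs_le_exp hs.continuous (abs_hl_le hp b), ?_⟩
  rw [show deriv (hl p b) = hl' p b from funext fun x => (hs x).1.deriv]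
  exact memLp_of_abs_le_exp hs.continuous' fun x => (abs_hl'_le b x).trans (abs_hl_le hp b x)

/-- Integrate `(η²)' = 2ηη' ≤ η'² + η²`. Boundedness is what kills the boundary term at infinity in
the integration by parts. -/
theorem MemH1On.exists_bound {η : ℝ → ℝ} (hη : MemH1On (Ici 0) η) :
    ∃ C, ∀ x ∈ Ici (0 : ℝ), |η x| ≤ C := by
  have i1 : IntegrableOn (fun x => deriv η x ^ 2 + η x ^ 2) (Ici 0) :=
    hη.2.2.integrable_sq.add hη.2.1.integrable_sq
  refine ⟨η 0 ^ 2 + (∫ x in Ici (0 : ℝ), (deriv η x ^ 2 + η x ^ 2)) + 1, fun x hx => ?_⟩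
  have hx : (0 : ℝ) ≤ x := hx
  have h1 := hη.1 0 self_mem_Ici x hx
  have h2 := h1.integral_deriv_mul_eq_sub h1
  have i2 : IntegrableOn (fun x => deriv η x * η x + η x * deriv η x) (Ici 0) :=
    (hη.2.2.integrable_mul hη.2.1).add (hη.2.1.integrable_mul hη.2.2)
  have h3 : ∫ t in (0 : ℝ)..x, (deriv η t * η t + η t * deriv η t) ≤
      ∫ x in Ici (0 : ℝ), (deriv η x ^ 2 + η x ^ 2) := by
    rw [intervalIntegral.integral_of_le hx]
    have hsub : Ioc 0 x ⊆ Ici (0 : ℝ) := fun t ht => ht.1.le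
    calc ∫ t in Ioc 0 x, (deriv η t * η t + η t * deriv η t)
        ≤ ∫ t in Ioc 0 x, (deriv η t ^ 2 + η t ^ 2) := by
          refine setIntegral_mono (i2.mono_set hsub) (i1.mono_set hsub) fun t => ?_
          nlinarith [sq_nonneg (deriv η t - η t)]
      _ ≤ _ := setIntegral_mono_set i1 (Eventually.of_forall fun t => by positivity)
          hsub.eventuallyLE
  have h4 : η x ^ 2 ≤ η 0 ^ 2 + ∫ x in Ici (0 : ℝ), (deriv η x ^ 2 + η x ^ 2) := by nlinarith
  have h5 := abs_nonneg (η x)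
  rw [← sq_abs (η x)] at h4
  nlinarith [sq_nonneg (|η x| - 1)]

theorem integrableOn_weakIntegrand_hl (hp : 2 < p) (b : ℝ) {η : ℝ → ℝ}
    (hη : MemH1On (Ici 0) η) : IntegrableOn (weakIntegrand p (hl p b) η) (Ici 0) := by
  have hs := isSol_hl hp b
  rw [show weakIntegrand p (hl p b) η = fun x => deriv (hl p b) x * deriv η x +
    force p (hl p b x) * η x from funext fun x => weakIntegrand_eq _ η x]
  refine ((memH1On_hl hp b).2.2.integrable_mul hη.2.2).add
    (MemLp.integrable_mul (p := 2) (q := 2) ?_ hη.2.1)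
  obtain ⟨K, hK1, hK⟩ := force_lipschitzOn hp (peak p)
  refine ((memH1On_hl hp b).2.1.const_mul K).mono
    ((continuous_force hp).comp hs.continuous).aestronglyMeasurable
    (Eventually.of_forall fun x => ?_)
  have := hK _ (abs_hl_le_peak hp b x) 0 (by simpa using (zero_lt_one.trans (one_lt_peak hp)).le)
  rw [force_zero, sub_zero, sub_zero] at this
  rw [Real.norm_eq_abs, Real.norm_eq_abs, abs_mul, abs_of_nonneg (by linarith : 0 ≤ K)]
  exact this

theorem tendsto_hl' (hp : 2 < p) (b : ℝ) : Tendsto (hl' p b) atTop (𝓝 0) := by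
  have h1 : Tendsto (fun x : ℝ => (2 * p) ^ (1 / (p - 2)) * |b| * Real.exp (-x)) atTop (𝓝 0) := by
    simpa using (Real.tendsto_exp_neg_atTop_nhds_zero).const_mul ((2 * p) ^ (1 / (p - 2)) * |b|)
  exact squeeze_zero_norm (fun x => (abs_hl'_le b x).trans (abs_hl_le hp b x)) h1

theorem tendsto_hl (hp : 2 < p) (b : ℝ) : Tendsto (hl p b) atTop (𝓝 0) := by
  have h1 : Tendsto (fun x : ℝ => (2 * p) ^ (1 / (p - 2)) * |b| * Real.exp (-x)) atTop (𝓝 0) := by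
    simpa using (Real.tendsto_exp_neg_atTop_nhds_zero).const_mul ((2 * p) ^ (1 / (p - 2)) * |b|)
  exact squeeze_zero_norm (fun x => abs_hl_le hp b x) h1

theorem integral_weakIntegrand_hl (hp : 2 < p) (b : ℝ) {η : ℝ → ℝ}
    (hη : MemH1On (Ici 0) η) :
    ∫ x in Ici (0 : ℝ), weakIntegrand p (hl p b) η x = -(hl' p b 0 * η 0) := by
  have hs := isSol_hl hp b
  have hmono : ∀ L : ℝ, ∀ {f : ℝ → ℝ}, MemH1On (Ici 0) f → MemH1On (Icc 0 L) f := fun L f hf =>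
    ⟨fun a ha b hb => hf.1 a ha.1 b hb.1,
      hf.2.1.mono_measure (Measure.restrict_mono Icc_subset_Ici_self le_rfl),
      hf.2.2.mono_measure (Measure.restrict_mono Icc_subset_Ici_self le_rfl)⟩
  have h1 := intervalIntegral_tendsto_integral_Ioi 0
    ((integrableOn_Ici_iff_integrableOn_Ioi (by simp)).1 (integrableOn_weakIntegrand_hl hp b hη)) tendsto_id
  rw [integral_Ici_eq_integral_Ioi]
  refine tendsto_nhds_unique h1 ?_
  obtain ⟨C, hC⟩ := MemH1On.exists_bound hη
  have h2 : Tendsto (fun L => hl' p b L * η L) atTop (𝓝 0) := by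
    have h3 : Tendsto (fun L => |hl' p b L| * C) atTop (𝓝 0) := by
      simpa using (tendsto_hl' hp b).abs.mul_const C
    refine squeeze_zero_norm' ?_ h3
    filter_upwards [eventually_ge_atTop 0] with L hL
    rw [norm_mul]
    exact mul_le_mul_of_nonneg_left (hC L hL) (abs_nonneg _)
  have h3 := h2.sub_const (hl' p b 0 * η 0)
  rw [zero_sub] at h3
  refine h3.congr' ?_
  filter_upwards [eventually_ge_atTop 0] with L hL
  rw [id, intervalIntegral.integral_of_le hL, ← integral_Icc_eq_integral_Ioc,
    integral_weakIntegrand_Icc hL (hmono L (memH1On_hl hp b)) (hmono L hη) (fun x => (hs x).2)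
    ((continuous_force hp).comp hs.continuous) (fun x _ => rfl)]
  simp [fun x => (hs x).1.deriv]

theorem memH1_fork (hp : 2 < p) {b : ℝ} {d : Fin P → ℝ} (h : Matching p ℓ b d) :
    MemH1 ℓ (fork p ℓ b d) :=
  ⟨memH1On_hl hp b, fun i => ⟨memH1On_pendant hp (d i), by simpa [fork] using h.1 i⟩⟩

/-- Kirchhoff's condition gives the weak form of the equation. -/
theorem isBoundState_fork (hp : 2 < p) (hℓ : 0 ≤ ℓ) {b : ℝ} {d : Fin P → ℝ}
    (h : Matching p ℓ b d) (hne : b ≠ 0 ∨ ∃ i, d i ≠ 0) : IsBoundState p ℓ (fork p ℓ b d) := by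
  refine ⟨memH1_fork hp h, ?_, fun η hη => ?_⟩
  · rcases hne with hb | ⟨i, hi⟩
    · refine Or.inl ⟨0, self_mem_Ici, ?_⟩
      rcases lt_or_gt_of_ne hb with hb | hb
      · have := hl_pos hp (neg_pos.2 hb) 0
        rw [hl_neg] at this
        simp only [fork]
        linarith
      · exact (hl_pos hp hb 0).ne'
    · refine Or.inr ⟨i, ℓ, ⟨hℓ, le_rfl⟩, ?_⟩
      simpa [fork, sol_zero hp] using hi
  · simp only [fork]
    rw [integral_weakIntegrand_hl hp b hη.1]
    simp_rw [fun i => integral_weakIntegrand_pendant hp hℓ (d i) (hη.2 i).1, (hη.2 _).2]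
    rw [← Finset.sum_mul, h.2]
    ring

theorem integral_weakIntegrand_congr_Icc {f g η : ℝ → ℝ} (h : EqOn f g (Icc 0 ℓ)) :
    ∫ x in Icc 0 ℓ, weakIntegrand p f η x = ∫ x in Icc 0 ℓ, weakIntegrand p g η x := by
  refine setIntegral_congr_ae measurableSet_Icc ?_
  filter_upwards [deriv_ae_eq_Icc h] with x hx hx'
  rw [weakIntegrand, weakIntegrand, hx hx', h hx']

theorem integral_weakIntegrand_congr_Ici {f g η : ℝ → ℝ} (h : EqOn f g (Ici 0)) :
    ∫ x in Ici 0, weakIntegrand p f η x = ∫ x in Ici 0, weakIntegrand p g η x := by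
  refine setIntegral_congr_ae measurableSet_Ici ?_
  filter_upwards [deriv_ae_eq_Ici h] with x hx hx'
  rw [weakIntegrand, weakIntegrand, hx hx', h hx']

/-- Bootstrap: the weak derivative agrees almost everywhere with a continuously differentiable
function, so `u` is a classical solution, at rest at the tip, and uniqueness for the Cauchy problem
started at the tip identifies it. -/
theorem IsBoundState.pendant_eq (hp : 2 < p) (hℓ : 0 < ℓ) (hu : IsBoundState p ℓ u) (i : Fin P) :
    EqOn (u.pendant i) (fun x => sol p (u.pendant i ℓ) 0 (ℓ - x)) (Icc 0 ℓ) := by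
  have hui := (hu.1.2 i).1
  have hc := (hui.1 0 ⟨le_rfl, hℓ.le⟩ ℓ ⟨hℓ.le, le_rfl⟩).continuousOn
  rw [uIcc_of_le hℓ.le] at hc
  set h : ℝ → ℝ := fun x => force p (u.pendant i (projIcc 0 ℓ hℓ.le x)) with hhdef
  have hh : Continuous h := (continuous_force hp).comp
    (hc.comp_continuous (continuous_subtype_val.comp continuous_projIcc) fun x => Subtype.coe_prop _)
  have hhu : ∀ x ∈ Icc 0 ℓ, h x = force p (u.pendant i x) := fun x hx => by
    rw [hhdef]; simp only; rw [projIcc_of_mem hℓ.le hx]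
  have hd := IsBoundState.pendant_deriv hℓ hu i hh hhu
  set H : ℝ → ℝ := fun x => ∫ t in ℓ..x, h t with hHdef
  have hH : ∀ x, HasDerivAt H (h x) x := fun x =>
    intervalIntegral.integral_hasDerivAt_right (hh.intervalIntegrable _ _)
      (hh.stronglyMeasurableAtFilter _ _) hh.continuousAt
  have hHc : Continuous H := continuous_iff_continuousAt.2 fun x => (hH x).continuousAt
  set U : ℝ → ℝ := fun x => u.pendant i 0 + ∫ t in (0 : ℝ)..x, H t with hUdef
  have hU : ∀ x, HasDerivAt U (H x) x := fun x =>
    (intervalIntegral.integral_hasDerivAt_right (hHc.intervalIntegrable _ _)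
      (hHc.stronglyMeasurableAtFilter _ _) hHc.continuousAt).const_add _
  have hUc : Continuous U := continuous_iff_continuousAt.2 fun x => (hU x).continuousAt
  have huU : ∀ x ∈ Icc 0 ℓ, u.pendant i x = U x := fun x hx =>
    eq_add_integral_of_deriv_ae hui hd hx
  have key := (isSol_sol hp (u.pendant i ℓ) 0).eqOn hp (T := ℓ) (v' := fun t => U (ℓ - t))
    (w' := fun t => -H (ℓ - t)) (hUc.comp (continuous_const.sub continuous_id)).continuousOn
    (hHc.comp (continuous_const.sub continuous_id)).neg.continuousOn
    (fun t _ => ((hU (ℓ - t)).comp_const_sub ℓ t).hasDerivWithinAt)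
    (fun t ht => by
      have hmem : ℓ - t ∈ Icc 0 ℓ := ⟨by linarith [ht.2], by linarith [ht.1]⟩
      rw [← huU _ hmem, ← hhu _ hmem]
      exact (((hH (ℓ - t)).comp_const_sub ℓ t).neg.congr_deriv (neg_neg _)).hasDerivWithinAt)
    (by rw [sol_zero hp, sub_zero, huU ℓ ⟨hℓ.le, le_rfl⟩])
    (by rw [sol'_zero hp, sub_zero]; simp [hHdef])
  intro x hx
  have := key.1 (x := ℓ - x) ⟨by linarith [hx.2], by linarith [hx.1]⟩
  simp only [sub_sub_cancel] at this
  rw [huU x hx, this]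

/-- Each term of the energy is integrable on the half-line (the power `|v|^p` because `v` is
bounded), and a constant that is integrable over a set of infinite measure is zero. -/
theorem IsSol.zero_energy (hp : 2 < p) {v w : ℝ → ℝ} (h : IsSol p v w)
    (hv : MemLp v 2 (volume.restrict (Ici 0))) (hw : MemLp w 2 (volume.restrict (Ici 0))) :
    w 0 ^ 2 = 2 * pot p (v 0) := by
  set E := w 0 ^ 2 / 2 - pot p (v 0) with hE
  obtain ⟨M, hM0, hM⟩ := exists_energy_bound hp E
  have hEt : ∀ t, w t ^ 2 / 2 - pot p (v t) = E := fun t => h.energy hp t 0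
  have hvM : ∀ t, |v t| < M := fun t => (hM _ _ (hEt t).le).1
  have i1 : Integrable (fun t => |v t| ^ p) (volume.restrict (Ici 0)) := by
    refine (hv.integrable_sq.const_mul (M ^ (p - 2))).mono' ?_ (Eventually.of_forall fun t => ?_)
    · exact (h.continuous.abs.rpow_const fun t => Or.inr (by linarith)).aestronglyMeasurable
    · rw [Real.norm_eq_abs, abs_of_nonneg (by positivity), abs_rpow_eq hp]
      exact mul_le_mul_of_nonneg_right
        (Real.rpow_le_rpow (abs_nonneg _) (hvM t).le (by linarith)) (sq_nonneg _)
  have i2 : Integrable (fun _ : ℝ => E) (volume.restrict (Ici 0)) := by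
    have : (fun _ : ℝ => E) = fun t => w t ^ 2 / 2 - (v t ^ 2 / 2 - |v t| ^ p / p) :=
      funext fun t => (hEt t).symm
    rw [this]
    exact (hw.integrable_sq.div_const 2).sub ((hv.integrable_sq.div_const 2).sub (i1.div_const p))
  rw [integrable_const_iff] at i2
  rcases i2 with h0 | h0
  · linarith
  · exfalso
    have := h0.measure_univ_lt_top
    simp at this

theorem IsBoundState.halfLine_eq (hp : 2 < p) (hu : IsBoundState p ℓ u) :
    ∃ b, EqOn u.halfLine (hl p b) (Ici 0) := by
  have hu0 := hu.1.1
  have hc : ContinuousOn u.halfLine (Ici 0) := by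
    intro x hx
    have hx : (0 : ℝ) ≤ x := hx
    have h1 := (hu0.1 0 self_mem_Ici (x + 1) (by simp; linarith)).continuousOn
    rw [uIcc_of_le (by linarith)] at h1
    refine (h1 x ⟨hx, by linarith⟩).mono_of_mem_nhdsWithin ?_
    rw [← Ici_inter_Iic]
    exact inter_mem_nhdsWithin _ (Iic_mem_nhds (by linarith))
  set h : ℝ → ℝ := fun x => force p (u.halfLine (max x 0)) with hhdef
  have hh : Continuous h := (continuous_force hp).comp
    (hc.comp_continuous (continuous_id.max continuous_const) fun x => mem_Ici.2 (le_max_right _ _))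
  have hhu : ∀ x ∈ Ici (0 : ℝ), h x = force p (u.halfLine x) := fun x hx => by
    rw [hhdef]; simp only; rw [max_eq_left hx]
  obtain ⟨C, hC⟩ := IsBoundState.halfLine_deriv hu hh hhu
  set H : ℝ → ℝ := fun x => C + ∫ t in (0 : ℝ)..x, h t with hHdef
  have hH : ∀ x, HasDerivAt H (h x) x := fun x =>
    (intervalIntegral.integral_hasDerivAt_right (hh.intervalIntegrable _ _)
      (hh.stronglyMeasurableAtFilter _ _) hh.continuousAt).const_add C
  have hHc : Continuous H := continuous_iff_continuousAt.2 fun x => (hH x).continuousAt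
  set U : ℝ → ℝ := fun x => u.halfLine 0 + ∫ t in (0 : ℝ)..x, H t with hUdef
  have hU : ∀ x, HasDerivAt U (H x) x := fun x =>
    (intervalIntegral.integral_hasDerivAt_right (hHc.intervalIntegrable _ _)
      (hHc.stronglyMeasurableAtFilter _ _) hHc.continuousAt).const_add _
  have hUc : Continuous U := continuous_iff_continuousAt.2 fun x => (hU x).continuousAt
  have hmono : ∀ L : ℝ, MemH1On (Icc 0 L) u.halfLine := fun L =>
    ⟨fun a ha b hb => hu0.1 a ha.1 b hb.1,
      hu0.2.1.mono_measure (Measure.restrict_mono Icc_subset_Ici_self le_rfl),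
      hu0.2.2.mono_measure (Measure.restrict_mono Icc_subset_Ici_self le_rfl)⟩
  have huU : ∀ x ∈ Ici (0 : ℝ), u.halfLine x = U x := fun x hx =>
    eq_add_integral_of_deriv_ae (hmono x) (hC x) ⟨hx, le_rfl⟩
  set v := sol p (u.halfLine 0) C with hv
  set w := sol' p (u.halfLine 0) C with hw
  have hs : IsSol p v w := isSol_sol hp _ _
  have key : ∀ T : ℝ, EqOn U v (Icc 0 T) ∧ EqOn H w (Icc 0 T) := fun T =>
    hs.eqOn hp hUc.continuousOn hHc.continuousOn (fun t _ => (hU t).hasDerivWithinAt)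
      (fun t ht => by
        rw [← huU t ht.1, ← hhu t ht.1]
        exact (hH t).hasDerivWithinAt) (by simp [hUdef, hv, sol_zero hp])
      (by simp [hHdef, hw, sol'_zero hp])
  have huv : EqOn u.halfLine v (Ici 0) := fun x hx => by
    rw [huU x hx]; exact (key x).1 ⟨hx, le_rfl⟩
  have e1 : MemLp v 2 (volume.restrict (Ici 0)) := by
    refine hu0.2.1.ae_eq ?_
    filter_upwards [ae_restrict_mem measurableSet_Ici] with x hx using huv hx
  have e2 : MemLp w 2 (volume.restrict (Ici 0)) := by
    refine hu0.2.2.ae_eq ?_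
    rw [EventuallyEq, ae_restrict_iff' measurableSet_Ici]
    filter_upwards [deriv_ae_eq_Ici huv] with x hx hx'
    rw [hx hx', (hs x).1.deriv]
  obtain ⟨b, hb1, hb2⟩ := exists_hl_data hp (hs.zero_energy hp e1 e2)
  have := (isSol_hl hp b).unique hp hs hb1 hb2
  exact ⟨b, fun x hx => by rw [huv hx, this.1]⟩

/-- Bound-states are given by matching data. -/
theorem IsBoundState.exists_fork (hp : 2 < p) (hℓ : 0 < ℓ) (hu : IsBoundState p ℓ u) :
    ∃ (b : ℝ) (d : Fin P → ℝ), Matching p ℓ b d ∧ (b ≠ 0 ∨ ∃ i, d i ≠ 0) ∧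
      SameOn ℓ u (fork p ℓ b d) := by
  obtain ⟨b, hb⟩ := IsBoundState.halfLine_eq hp hu
  set d : Fin P → ℝ := fun i => u.pendant i ℓ with hd
  have hsame : SameOn ℓ u (fork p ℓ b d) := ⟨hb, fun i => IsBoundState.pendant_eq hp hℓ hu i⟩
  have h1 : ∀ i, sol p (d i) 0 ℓ = hl p b 0 := fun i => by
    have e1 := hsame.2 i ⟨le_rfl, hℓ.le⟩
    rw [(hu.1.2 i).2, hb self_mem_Ici] at e1
    simpa [fork] using e1.symm
  refine ⟨b, d, ⟨h1, ?_⟩, ?_, hsame⟩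
  -- Any test function that does not vanish at the vertex reveals Kirchhoff's condition.
  · set η : ForkFun P := ⟨hl p 1, fun _ _ => hl p 1 0⟩
    have hη : MemH1 ℓ η := ⟨memH1On_hl hp 1, fun i => ⟨⟨fun x _ y _ =>
      absolutelyContinuous_of_hasDerivAt (fun x => hasDerivAt_const x (hl p 1 0)) continuous_const
        x y, memLp_Icc_of_continuousOn continuousOn_const, by simp [η]⟩, rfl⟩⟩
    have hw := hu.2.2 η hη
    rw [integral_weakIntegrand_congr_Ici hb, integral_weakIntegrand_hl hp b hη.1] at hw
    have e2 : ∀ i, ∫ x in Icc 0 ℓ, weakIntegrand p (u.pendant i) (η.pendant i) x =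
        sol' p (d i) 0 ℓ * hl p 1 0 := fun i => by
      rw [integral_weakIntegrand_congr_Icc (hsame.2 i)]
      exact integral_weakIntegrand_pendant hp hℓ.le (d i) (hη.2 i).1
    simp_rw [e2] at hw
    rw [← Finset.sum_mul] at hw
    have h2 := hl_pos hp one_pos 0
    have h3 : hl p 1 0 * (hl' p b 0 - ∑ i, sol' p (d i) 0 ℓ) = 0 := by
      simp only [η] at hw
      linarith
    rcases mul_eq_zero.1 h3 with h4 | h4
    · linarith
    · linarith
  · by_contra! hcon
    rcases hu.2.1 with ⟨x, hx, hx'⟩ | ⟨i, x, hx, hx'⟩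
    · apply hx'
      rw [hb hx, hcon.1, hl_zero_left]
    · apply hx'
      rw [hsame.2 i hx]
      simp only [fork, hcon.2 i]
      exact (sol_equilibrium hp force_zero _).1

end Fork

namespace Fork

open scoped ENNReal

variable {p : ℝ}

/-! ### Branches of the potential -/

theorem continuous_rpow_sub_two (hp : 2 < p) : Continuous fun u : ℝ => u ^ (p - 2) :=
  Real.continuous_rpow_const (by linarith)

theorem pot_strictMonoOn_Ioo (hp : 2 < p) : StrictMonoOn (pot p) (Ioo 0 1) :=
  (pot_strictMonoOn hp).mono Ioo_subset_Icc_self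

theorem pot_strictAntiOn_Ioi (hp : 2 < p) : StrictAntiOn (pot p) (Ioi 1) :=
  (pot_strictAntiOn hp).mono Ioi_subset_Ici_self

/-- The inverse of `pot p` on `(0, 1)`. -/
def lowBranch (p h : ℝ) : ℝ := Function.invFunOn (pot p) (Ioo 0 1) h

/-- The inverse of `pot p` on `(1, ∞)`. -/
def highBranch (p h : ℝ) : ℝ := Function.invFunOn (pot p) (Ioi 1) h

theorem lowBranch_pot (hp : 2 < p) {u : ℝ} (hu : u ∈ Ioo (0 : ℝ) 1) :
    lowBranch p (pot p u) = u :=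
  (pot_strictMonoOn_Ioo hp).injOn.leftInvOn_invFunOn hu

theorem highBranch_pot (hp : 2 < p) {u : ℝ} (hu : 1 < u) : highBranch p (pot p u) = u :=
  (pot_strictAntiOn_Ioi hp).injOn.leftInvOn_invFunOn hu

theorem exists_pot_eq_low (hp : 2 < p) {h : ℝ} (h0 : 0 < h) (h1 : h < pot p 1) :
    ∃ u ∈ Ioo (0 : ℝ) 1, pot p u = h := by
  obtain ⟨u, hu, e⟩ := intermediate_value_Ioo zero_le_one (continuous_pot hp).continuousOn
    (show h ∈ Ioo (pot p 0) (pot p 1) from ⟨by rwa [pot_zero hp], h1⟩)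
  exact ⟨u, hu, e⟩

theorem exists_pot_eq_high (hp : 2 < p) {h : ℝ} (h0 : 0 < h) (h1 : h < pot p 1) :
    ∃ u ∈ Ioo 1 (peak p), pot p u = h := by
  obtain ⟨u, hu, e⟩ := intermediate_value_Ioo' (one_lt_peak hp).le
    (continuous_pot hp).continuousOn
    (show h ∈ Ioo (pot p (peak p)) (pot p 1) from ⟨by rwa [pot_peak hp], h1⟩)
  exact ⟨u, hu, e⟩

theorem lowBranch_spec (hp : 2 < p) {h : ℝ} (h0 : 0 < h) (h1 : h < pot p 1) :
    lowBranch p h ∈ Ioo (0 : ℝ) 1 ∧ pot p (lowBranch p h) = h :=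
  have h := exists_pot_eq_low hp h0 h1
  ⟨Function.invFunOn_mem h, Function.invFunOn_eq h⟩

theorem highBranch_spec (hp : 2 < p) {h : ℝ} (h0 : 0 < h) (h1 : h < pot p 1) :
    1 < highBranch p h ∧ pot p (highBranch p h) = h := by
  obtain ⟨u, hu, e⟩ := exists_pot_eq_high hp h0 h1
  exact ⟨Function.invFunOn_mem (s := Ioi 1) ⟨u, hu.1, e⟩, Function.invFunOn_eq ⟨u, hu.1, e⟩⟩

theorem lowBranch_strictMonoOn (hp : 2 < p) :
    StrictMonoOn (lowBranch p) (Ioo 0 (pot p 1)) := fun h hh k hk hhk => by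
  have h1 := lowBranch_spec hp hh.1 hh.2
  have h2 := lowBranch_spec hp hk.1 hk.2
  rw [← (pot_strictMonoOn_Ioo hp).lt_iff_lt h1.1 h2.1, h1.2, h2.2]
  exact hhk

theorem highBranch_strictAntiOn (hp : 2 < p) :
    StrictAntiOn (highBranch p) (Ioo 0 (pot p 1)) := fun h hh k hk hhk => by
  have h1 := highBranch_spec hp hh.1 hh.2
  have h2 := highBranch_spec hp hk.1 hk.2
  rw [← (pot_strictAntiOn_Ioi hp).lt_iff_gt h1.1 h2.1, h1.2, h2.2]
  exact hhk

/-! ### Monotonicity of `√pot / |force|` -/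

theorem pot_of_pos (hp : 2 < p) {u : ℝ} (hu : 0 < u) :
    pot p u = u ^ 2 * (1 / 2 - u ^ (p - 2) / p) := by
  rw [pot_eq hp, abs_of_pos hu]

theorem rpow_lt_one_of_lt_one (hp : 2 < p) {u : ℝ} (hu : 0 < u) (hu1 : u < 1) :
    u ^ (p - 2) < 1 := Real.rpow_lt_one hu.le hu1 (by linarith)

theorem one_lt_rpow_of_one_lt (hp : 2 < p) {u : ℝ} (hu : 1 < u) : 1 < u ^ (p - 2) :=
  Real.one_lt_rpow hu (by linarith)

/-- The factor `u²` cancels in `pot / force²`, leaving `(1/2 - r/p)/(1 - r)²` with `r = u^(p-2)`,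
which increases on `r < 1`. -/
theorem sqrt_pot_div_strictMonoOn (hp : 2 < p) :
    StrictMonoOn (fun u => √(pot p u) / |force p u|) (Ioo 0 1) := fun u hu v hv huv => by
  have hfu := force_pos hp hu.1 hu.2
  have hfv := force_pos hp hv.1 hv.2
  have hpu := pot_pos hp hu.1 (hu.2.trans (one_lt_peak hp))
  have hpv := pot_pos hp hv.1 (hv.2.trans (one_lt_peak hp))
  have hru := rpow_lt_one_of_lt_one hp hu.1 hu.2
  have hrv := rpow_lt_one_of_lt_one hp hv.1 hv.2
  have hr : u ^ (p - 2) < v ^ (p - 2) := Real.rpow_lt_rpow hu.1.le huv (by linarith)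
  simp only
  rw [abs_of_pos hfu, abs_of_pos hfv, div_lt_div_iff₀ hfu hfv]
  refine lt_of_pow_lt_pow_left₀ 2 (by positivity) ?_
  rw [mul_pow, mul_pow, Real.sq_sqrt hpu.le, Real.sq_sqrt hpv.le, force_of_pos hu.1,
    force_of_pos hv.1, pot_of_pos hp hu.1, pot_of_pos hp hv.1]
  have h0 := Real.rpow_pos_of_pos hu.1 (p - 2)
  generalize u ^ (p - 2) = r at *
  generalize v ^ (p - 2) = s at *
  have key : (1 / 2 - r / p) * (1 - s) ^ 2 < (1 / 2 - s / p) * (1 - r) ^ 2 := by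
    have : (1 / 2 - s / p) * (1 - r) ^ 2 - (1 / 2 - r / p) * (1 - s) ^ 2 =
        (s - r) * ((1 / 2 - 1 / p) * ((1 - r) + (1 - s)) + 1 / p * ((1 - r) * (1 - s))) := by
      ring
    have h1 := pot_one_pos hp
    have : 0 < (s - r) * ((1 / 2 - 1 / p) * ((1 - r) + (1 - s)) + 1 / p * ((1 - r) * (1 - s))) := by
      apply mul_pos (by linarith)
      have := mul_pos h1 (show 0 < 1 - r + (1 - s) by linarith)
      have := mul_pos (show 0 < 1 / p by positivity)
        (mul_pos (show 0 < 1 - r by linarith) (show 0 < 1 - s by linarith))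
      linarith
    linarith
  have := mul_lt_mul_of_pos_left key (show 0 < u ^ 2 * v ^ 2 by have := hu.1; have := hv.1; positivity)
  linarith

/-- The same function of `r = u^(p-2)`, now on the range `1 < r` and below the peak, where it
decreases. -/
theorem sqrt_pot_div_strictAntiOn (hp : 2 < p) :
    StrictAntiOn (fun u => √(pot p u) / |force p u|) (Ioo 1 (peak p)) := fun u hu v hv huv => by
  have hu0 : 0 < u := one_pos.trans hu.1
  have hv0 : 0 < v := one_pos.trans hv.1
  have hfu := force_neg_of_one_lt hp hu.1
  have hfv := force_neg_of_one_lt hp hv.1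
  have hpu := pot_pos hp hu0 hu.2
  have hpv := pot_pos hp hv0 hv.2
  have hru := one_lt_rpow_of_one_lt hp hu.1
  have hrv := one_lt_rpow_of_one_lt hp hv.1
  have hr : u ^ (p - 2) < v ^ (p - 2) := Real.rpow_lt_rpow hu0.le huv (by linarith)
  simp only
  rw [div_lt_div_iff₀ (abs_pos.2 hfv.ne) (abs_pos.2 hfu.ne)]
  refine lt_of_pow_lt_pow_left₀ 2 (by positivity) ?_
  rw [pot_of_pos hp hv0] at hpv
  have hs := pos_of_mul_pos_right hpv (sq_nonneg v)
  rw [mul_pow, mul_pow, Real.sq_sqrt hpu.le, Real.sq_sqrt (by rw [pot_of_pos hp hv0]; exact hpv.le),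
    sq_abs, sq_abs, force_of_pos hu0, force_of_pos hv0, pot_of_pos hp hu0, pot_of_pos hp hv0]
  generalize u ^ (p - 2) = r at *
  generalize v ^ (p - 2) = s at *
  have key : (1 / 2 - s / p) * (1 - r) ^ 2 < (1 / 2 - r / p) * (1 - s) ^ 2 := by
    have : (1 / 2 - r / p) * (1 - s) ^ 2 - (1 / 2 - s / p) * (1 - r) ^ 2 =
        (s - r) * ((1 / 2 - s / p) * (r - 1) + (1 / 2 - 1 / p) * (s - 1)) := by
      ring
    have h1 := pot_one_pos hp
    have : 0 < (s - r) * ((1 / 2 - s / p) * (r - 1) + (1 / 2 - 1 / p) * (s - 1)) := by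
      apply mul_pos (by linarith)
      have := mul_pos h1 (show 0 < s - 1 by linarith)
      have := mul_pos hs (show 0 < r - 1 by linarith)
      linarith
    linarith
  have := mul_lt_mul_of_pos_left key (show 0 < u ^ 2 * v ^ 2 by positivity)
  linarith

/-! ### The inequality behind the monotonicity of the period -/

theorem hasDerivAt_rpow_sub_two {u : ℝ} (hu : 0 < u) :
    HasDerivAt (fun u : ℝ => u ^ (p - 2)) ((p - 2) * u ^ (p - 2) / u) u := by
  have := Real.hasDerivAt_rpow_const (x := u) (p := p - 2) (Or.inl hu.ne')
  rw [Real.rpow_sub_one hu.ne'] at this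
  exact this.congr_deriv (by ring)

/-- An auxiliary function whose sign is that of the derivative of `periodDefect`. -/
def periodAux (p u : ℝ) : ℝ :=
  u ^ 3 * (u ^ (p - 2) - 1) ^ 2 * ((p - 1) - 1 / u ^ (p - 2)) - 2 * (p - 2) ^ 2 * (pot p 1 - pot p u)

/-- `λ V'³ + V'² - 2 V V''` for `V = pot p 1 - pot p` and `λ = (p-1)/(3(p-2))`. -/
def periodDefect (p u : ℝ) : ℝ :=
  (p - 1) / (3 * (p - 2)) * (u * (u ^ (p - 2) - 1)) ^ 3 + (u * (u ^ (p - 2) - 1)) ^ 2 -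
    2 * (pot p 1 - pot p u) * ((p - 1) * u ^ (p - 2) - 1)

theorem hasDerivAt_periodAux (hp : 2 < p) {u : ℝ} (hu : 0 < u) :
    HasDerivAt (periodAux p) (u * (u ^ (p - 2) - 1) *
      (u * ((p - 1) * (2 * p - 1) * u ^ (p - 2) - (4 * p - 2) + (5 - p) / u ^ (p - 2)) -
        2 * (p - 2) ^ 2)) u := by
  have hr := hasDerivAt_rpow_sub_two (p := p) hu
  have h0 := Real.rpow_pos_of_pos hu (p - 2)
  have hV := hasDerivAt_pot hp u
  rw [force_of_pos hu] at hV
  have := ((((hasDerivAt_id u).pow 3).mul ((hr.sub_const 1).pow 2)).mul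
    ((hr.inv h0.ne').const_sub (p - 1))).sub ((hV.const_sub (pot p 1)).const_mul (2 * (p - 2) ^ 2))
  refine HasDerivAt.congr_deriv (f' := _) (this.congr_of_eventuallyEq ?_) ?_
  · filter_upwards with x
    simp [periodAux]
  · simp
    generalize u ^ (p - 2) = r at *
    field_simp
    ring

/-- The terms `2V'V''` cancel, leaving `3λV'²V'' - 2VV'''`; `periodAux` is what remains after
removing a positive factor. -/
theorem hasDerivAt_periodDefect (hp : 2 < p) {u : ℝ} (hu : 0 < u) :
    HasDerivAt (periodDefect p)
      ((p - 1) / (p - 2) * (u ^ (p - 2) / u) * periodAux p u) u := by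
  have hr := hasDerivAt_rpow_sub_two (p := p) hu
  have h0 := Real.rpow_pos_of_pos hu (p - 2)
  have hV := hasDerivAt_pot hp u
  have hp2 : p - 2 ≠ 0 := by linarith
  rw [force_of_pos hu] at hV
  have hw := (hasDerivAt_id u).mul (hr.sub_const 1)
  have := (((hw.pow 3).const_mul ((p - 1) / (3 * (p - 2)))).add (hw.pow 2)).sub
    (((hV.const_sub (pot p 1)).const_mul 2).mul ((hr.const_mul (p - 1)).sub_const 1))
  refine HasDerivAt.congr_deriv (f' := _) (this.congr_of_eventuallyEq ?_) ?_
  · filter_upwards with x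
    simp [periodDefect]
  · simp [periodAux]
    generalize u ^ (p - 2) = r at *
    field_simp
    ring

theorem periodAux_one : periodAux p 1 = 0 := by simp [periodAux]

theorem periodDefect_one : periodDefect p 1 = 0 := by simp [periodDefect]

theorem periodAux_nonneg (hp : 2 < p) {u : ℝ} (hu : 1 ≤ u) : 0 ≤ periodAux p u := by
  have hmono : MonotoneOn (periodAux p) (Ici 1) := by
    apply monotoneOn_of_hasDerivWithinAt_nonneg (convex_Ici 1)
      (fun x hx => (hasDerivAt_periodAux hp (one_pos.trans_le hx)).continuousAt.continuousWithinAt)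
      (fun x hx => (hasDerivAt_periodAux hp
        (one_pos.trans (by simpa using hx))).hasDerivWithinAt)
    intro x hx
    have hx1 : 1 < x := by simpa using hx
    have hr := one_lt_rpow_of_one_lt hp hx1
    generalize x ^ (p - 2) = r at *
    -- The two sides agree at `r = 1`, so the difference factors through `r - 1`.
    have hB : 2 * (p - 2) ^ 2 ≤
        (p - 1) * (2 * p - 1) * r - (4 * p - 2) + (5 - p) / r := by
      have e : (p - 1) * (2 * p - 1) * r - (4 * p - 2) + (5 - p) / r - 2 * (p - 2) ^ 2 =
          (r - 1) * ((p - 1) * (2 * p - 1) - (5 - p) / r) := by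
        field_simp
        ring
      have : (5 - p) / r ≤ (p - 1) * (2 * p - 1) := by
        rw [div_le_iff₀ (by linarith)]
        nlinarith [mul_nonneg (show (0:ℝ) ≤ (p - 1) * (2 * p - 1) by nlinarith)
          (show 0 ≤ r - 1 by linarith)]
      have := mul_nonneg (show 0 ≤ r - 1 by linarith) (sub_nonneg.2 this)
      linarith
    apply mul_nonneg (mul_nonneg (by linarith) (by linarith))
    have h2 := sq_nonneg (p - 2)
    nlinarith
  rw [← periodAux_one (p := p)]
  exact hmono self_mem_Ici hu hu

theorem periodAux_nonpos (hp : 2 < p) {u : ℝ} (hu : 0 < u) (hu1 : u ≤ 1) :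
    periodAux p u ≤ 0 := by
  -- If `V'' ≤ 0` at `u`, both terms of `periodAux` are nonpositive. Otherwise `V'' > 0` on all of
  -- `[u, 1]`, and there `periodAux` increases up to its value `0` at `1`.
  rcases le_or_gt ((p - 1) * u ^ (p - 2)) 1 with hr | hr
  · have h0 := Real.rpow_pos_of_pos hu (p - 2)
    have h1 : (p - 1) - 1 / u ^ (p - 2) ≤ 0 := by
      rw [sub_nonpos, le_div_iff₀ h0]
      exact hr
    have h2 : pot p u ≤ pot p 1 := by rw [pot_one]; exact pot_le hp u
    have h3 := mul_nonpos_of_nonneg_of_nonpos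
      (show 0 ≤ u ^ 3 * (u ^ (p - 2) - 1) ^ 2 by positivity) h1
    have h4 := mul_nonneg (show 0 ≤ 2 * (p - 2) ^ 2 by positivity) (sub_nonneg.2 h2)
    unfold periodAux
    linarith
  have hmono : MonotoneOn (periodAux p) (Icc u 1) := by
    apply monotoneOn_of_hasDerivWithinAt_nonneg (convex_Icc u 1)
      (fun x hx => (hasDerivAt_periodAux hp (hu.trans_le hx.1)).continuousAt.continuousWithinAt)
      (fun x hx => (hasDerivAt_periodAux hp
        (hu.trans_le (interior_subset hx).1)).hasDerivWithinAt)
    intro x hx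
    rw [interior_Icc] at hx
    have hx0 := hu.trans hx.1
    have hr1 := rpow_lt_one_of_lt_one hp hx0 hx.2
    have hr2 : u ^ (p - 2) < x ^ (p - 2) := Real.rpow_lt_rpow hu.le hx.1 (by linarith)
    have hr3 : 1 < (p - 1) * x ^ (p - 2) :=
      hr.trans (mul_lt_mul_of_pos_left hr2 (by linarith))
    have hr0 := Real.rpow_pos_of_pos hx0 (p - 2)
    generalize x ^ (p - 2) = r at *
    have hB : (p - 1) * (2 * p - 1) * r - (4 * p - 2) + (5 - p) / r ≤ 2 * (p - 2) ^ 2 := by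
      have e : 2 * (p - 2) ^ 2 - ((p - 1) * (2 * p - 1) * r - (4 * p - 2) + (5 - p) / r) =
          (1 - r) * ((p - 1) * (2 * p - 1) - (5 - p) / r) := by
        field_simp
        ring
      have : (5 - p) / r ≤ (p - 1) * (2 * p - 1) := by
        rw [div_le_iff₀ hr0]
        nlinarith
      have := mul_nonneg (show 0 ≤ 1 - r by linarith) (sub_nonneg.2 this)
      linarith
    apply mul_nonneg_of_nonpos_of_nonpos
      (mul_nonpos_of_nonneg_of_nonpos hx0.le (by linarith))
    have h2 := sq_nonneg (p - 2)
    have h3 : x * (2 * (p - 2) ^ 2) ≤ 2 * (p - 2) ^ 2 := by nlinarith [hx.2]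
    have := mul_le_mul_of_nonneg_left hB hx0.le
    linarith
  rw [← periodAux_one (p := p)]
  exact hmono (left_mem_Icc.2 hu1) (right_mem_Icc.2 hu1) hu1

/-- The derivative has the sign of `periodAux`, which changes at `1`, so the minimum is the value
`0` there. The constant `λ = V'''(1)/(3V''(1)²)` is forced: it cancels the cubic term of the
expansion at `1`, without which the sign would differ on the two sides. -/
theorem periodDefect_nonneg (hp : 2 < p) {u : ℝ} (hu : 0 < u) : 0 ≤ periodDefect p u := by
  have hc : ∀ x : ℝ, 0 < x → 0 ≤ (p - 1) / (p - 2) * (x ^ (p - 2) / x) := fun x hx => by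
    have := Real.rpow_pos_of_pos hx (p - 2)
    have := div_pos (show 0 < p - 1 by linarith) (show 0 < p - 2 by linarith)
    positivity
  rw [← periodDefect_one (p := p)]
  rcases le_total u 1 with h | h
  · have : AntitoneOn (periodDefect p) (Icc u 1) := by
      apply antitoneOn_of_hasDerivWithinAt_nonpos (convex_Icc u 1)
        (fun x hx => (hasDerivAt_periodDefect hp
          (hu.trans_le hx.1)).continuousAt.continuousWithinAt)
        (fun x hx => (hasDerivAt_periodDefect hp
          (hu.trans_le (interior_subset hx).1)).hasDerivWithinAt)
      intro x hx
      have hx' := interior_subset hx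
      exact mul_nonpos_of_nonneg_of_nonpos (hc x (hu.trans_le hx'.1))
        (periodAux_nonpos hp (hu.trans_le hx'.1) hx'.2)
    exact this (left_mem_Icc.2 h) (right_mem_Icc.2 h) h
  · have : MonotoneOn (periodDefect p) (Ici 1) := by
      apply monotoneOn_of_hasDerivWithinAt_nonneg (convex_Ici 1)
        (fun x hx => (hasDerivAt_periodDefect hp
          (one_pos.trans_le hx)).continuousAt.continuousWithinAt)
        (fun x hx => (hasDerivAt_periodDefect hp
          (one_pos.trans_le (interior_subset hx))).hasDerivWithinAt)
      intro x hx
      have hx' : (1 : ℝ) ≤ x := interior_subset hx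
      exact mul_nonneg (hc x (one_pos.trans_le hx')) (periodAux_nonneg hp hx')
    exact this self_mem_Ici h h

/-- The function `√V / |V'|` for `V = pot p 1 - pot p`. -/
def kap (p u : ℝ) : ℝ := √(pot p 1 - pot p u) / |force p u|

theorem pot_lt_pot_one_high (hp : 2 < p) {u : ℝ} (hu : 1 < u) : pot p u < pot p 1 :=
  pot_strictAntiOn hp (mem_Ici.2 le_rfl) (mem_Ici.2 hu.le) hu

theorem pot_lt_pot_one_low (hp : 2 < p) {u : ℝ} (hu : u ∈ Ioo (0 : ℝ) 1) : pot p u < pot p 1 :=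
  pot_strictMonoOn hp ⟨hu.1.le, hu.2.le⟩ ⟨zero_le_one, le_rfl⟩ hu.2

/-- Here `-force = V'`, and the derivative of `√V / V' + λ√V` is `λV'³ + V'² - 2VV''` over a
positive denominator; this is the origin of `periodDefect`. -/
theorem hasDerivAt_sqrt_div (hp : 2 < p) {u : ℝ} (hu : 0 < u) (hV : pot p u < pot p 1)
    (hf : force p u ≠ 0) :
    HasDerivAt (fun u => √(pot p 1 - pot p u) / (-force p u) +
      (p - 1) / (3 * (p - 2)) * √(pot p 1 - pot p u))
      (periodDefect p u / (2 * √(pot p 1 - pot p u) * force p u ^ 2)) u := by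
  have h0 : 0 < pot p 1 - pot p u := sub_pos.2 hV
  have h1 := ((hasDerivAt_pot hp u).const_sub (pot p 1)).sqrt h0.ne'
  have h2 := hasDerivAt_force hp u
  rw [abs_of_pos hu] at h2
  refine ((h1.div (h2.fun_neg : HasDerivAt (fun u => -force p u) _ u) (neg_ne_zero.2 hf)).add
    (h1.const_mul ((p - 1) / (3 * (p - 2))))).congr_deriv ?_
  have h3 : 0 < √(pot p 1 - pot p u) := Real.sqrt_pos.2 h0
  have h4 : √(pot p 1 - pot p u) ^ 2 = pot p 1 - pot p u := Real.sq_sqrt h0.le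
  have h5 : u * (u ^ (p - 2) - 1) = -force p u := by rw [force_of_pos hu]; ring
  have hp2 : p - 2 ≠ 0 := by linarith
  rw [periodDefect, h5, ← h4, Real.sqrt_sq h3.le]
  generalize √(pot p 1 - pot p u) = x at *
  generalize force p u = y at *
  field_simp
  ring

theorem kap_add_monotoneOn (hp : 2 < p) :
    MonotoneOn (fun u => kap p u + (p - 1) / (3 * (p - 2)) * √(pot p 1 - pot p u)) (Ioi 1) := by
  have h : ∀ u ∈ Ioi (1 : ℝ), HasDerivAt (fun u => √(pot p 1 - pot p u) / (-force p u) +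
      (p - 1) / (3 * (p - 2)) * √(pot p 1 - pot p u))
      (periodDefect p u / (2 * √(pot p 1 - pot p u) * force p u ^ 2)) u := fun u hu =>
    hasDerivAt_sqrt_div hp (one_pos.trans hu) (pot_lt_pot_one_high hp hu)
      (force_neg_of_one_lt hp hu).ne
  have : MonotoneOn (fun u => √(pot p 1 - pot p u) / (-force p u) +
      (p - 1) / (3 * (p - 2)) * √(pot p 1 - pot p u)) (Ioi 1) := by
    apply monotoneOn_of_hasDerivWithinAt_nonneg (convex_Ioi 1)
      (fun x hx => (h x hx).continuousAt.continuousWithinAt)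
      (fun x hx => (h x (interior_subset hx)).hasDerivWithinAt)
    intro x hx
    exact div_nonneg (periodDefect_nonneg hp (one_pos.trans (interior_subset hx))) (by positivity)
  refine this.congr fun u hu => ?_
  simp only [kap]
  rw [abs_of_neg (force_neg_of_one_lt hp hu)]

/-- To the left of `1` one has `V' < 0`, so passing to `|V'|` reverses the monotonicity and the sign
of the correction. At points of equal potential the corrections of the two branches therefore
cancel. -/
theorem kap_sub_antitoneOn (hp : 2 < p) :
    AntitoneOn (fun u => kap p u - (p - 1) / (3 * (p - 2)) * √(pot p 1 - pot p u))
      (Ioo 0 1) := by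
  have h : ∀ u ∈ Ioo (0 : ℝ) 1, HasDerivAt (fun u => √(pot p 1 - pot p u) / (-force p u) +
      (p - 1) / (3 * (p - 2)) * √(pot p 1 - pot p u))
      (periodDefect p u / (2 * √(pot p 1 - pot p u) * force p u ^ 2)) u := fun u hu =>
    hasDerivAt_sqrt_div hp hu.1 (pot_lt_pot_one_low hp hu) (force_pos hp hu.1 hu.2).ne'
  have : MonotoneOn (fun u => √(pot p 1 - pot p u) / (-force p u) +
      (p - 1) / (3 * (p - 2)) * √(pot p 1 - pot p u)) (Ioo 0 1) := by
    apply monotoneOn_of_hasDerivWithinAt_nonneg (convex_Ioo 0 1)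
      (fun x hx => (h x hx).continuousAt.continuousWithinAt)
      (fun x hx => (h x (interior_subset hx)).hasDerivWithinAt)
    intro x hx
    exact div_nonneg (periodDefect_nonneg hp (interior_subset hx).1) (by positivity)
  refine this.neg.congr fun u hu => ?_
  simp only [kap]
  rw [abs_of_pos (force_pos hp hu.1 hu.2), div_neg]
  ring

end Fork

namespace Fork

open scoped ENNReal

variable {p : ℝ}

/-! ### Time maps -/

/-- The reciprocal speed at height `u` on the orbit of energy `e`; it vanishes where
`pot p u ≤ e`. -/
def slowness (p e u : ℝ) : ℝ := 1 / √(2 * (pot p u - e))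

theorem slowness_of_le {e u : ℝ} (h : pot p u ≤ e) : slowness p e u = 0 := by
  rw [slowness, Real.sqrt_eq_zero_of_nonpos (by linarith), div_zero]

/-- The time spent in `A` on the orbit of energy `e`. -/
def timeIn (p e : ℝ) (A : Set ℝ) : ℝ≥0∞ := ∫⁻ u in A, ENNReal.ofReal (slowness p e u)

theorem timeIn_inter (hp : 2 < p) (e : ℝ) {A : Set ℝ} (hA : MeasurableSet A) :
    timeIn p e A = timeIn p e (A ∩ {u | e < pot p u}) := by
  have hB : MeasurableSet {u | e < pot p u} :=
    (isOpen_lt continuous_const (continuous_pot hp)).measurableSet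
  rw [timeIn, ← lintegral_inter_add_sdiff _ A hB]
  have : ∫⁻ u in A \ {u | e < pot p u}, ENNReal.ofReal (slowness p e u) = 0 := by
    rw [setLIntegral_congr_fun (hA.diff hB) (g := fun _ => 0)
      fun u hu => by simp [slowness_of_le (not_lt.1 hu.2)], lintegral_zero]
  rw [this, add_zero, timeIn]

theorem timeIn_union (e : ℝ) {A B : Set ℝ} (hB : MeasurableSet B) (h : Disjoint A B) :
    timeIn p e (A ∪ B) = timeIn p e A + timeIn p e B := lintegral_union hB h

theorem timeIn_Ioi_eq_add (e : ℝ) {c : ℝ} (hc : 0 < c) :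
    timeIn p e (Ioi 0) = timeIn p e (Ioo 0 c) + timeIn p e (Ioi c) := by
  rw [← Ioc_union_Ioi_eq_Ioi hc.le, timeIn_union e measurableSet_Ioi
    (Set.disjoint_left.2 fun x hx hx' => not_lt.2 hx.2 hx')]
  congr 1
  exact setLIntegral_congr Ioo_ae_eq_Ioc.symm

/-- The substitution `s = φ u`, with inverse `U`. Time maps take values in `ℝ≥0∞` so that no
integrability is needed at the turning points. -/
theorem lintegral_reparam {φ φ' U g : ℝ → ℝ} {J S : Set ℝ} (hJ : MeasurableSet J)
    (hφ : ∀ u ∈ J, HasDerivAt φ (φ' u) u) (h0 : ∀ u ∈ J, φ' u ≠ 0)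
    (hU : ∀ u ∈ J, U (φ u) = u) (hS : ∀ u ∈ J, φ u ∈ S)
    (hS' : ∀ s ∈ S, U s ∈ J ∧ φ (U s) = s) :
    ∫⁻ u in J, ENNReal.ofReal (g u) = ∫⁻ s in S, ENNReal.ofReal (g (U s) / |φ' (U s)|) := by
  have hi : φ '' J = S := by
    ext s
    exact ⟨fun ⟨u, hu, e⟩ => e ▸ hS u hu, fun hs => ⟨U s, hS' s hs⟩⟩
  rw [← hi, lintegral_image_eq_lintegral_abs_deriv_mul hJ
    (fun u hu => (hφ u hu).hasDerivWithinAt) (LeftInvOn.injOn hU)]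
  refine setLIntegral_congr_fun hJ fun u hu => ?_
  rw [hU u hu, ← ENNReal.ofReal_mul (abs_nonneg _), mul_div_cancel₀ _ (abs_ne_zero.2 (h0 u hu))]

/-- The time an orbit needs is the time spent in its range. -/
theorem timeIn_eq {v w : ℝ → ℝ} {e L : ℝ} {A : Set ℝ} (hA : v '' Ioo 0 L = A)
    (hv : ∀ t ∈ Ioo 0 L, HasDerivAt v (w t) t) (hinj : InjOn v (Ioo 0 L))
    (hw : ∀ t ∈ Ioo 0 L, w t ≠ 0) (he : ∀ t ∈ Ioo 0 L, w t ^ 2 = 2 * (pot p (v t) - e)) :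
    timeIn p e A = ENNReal.ofReal L := by
  rw [timeIn, ← hA, lintegral_image_eq_lintegral_abs_deriv_mul measurableSet_Ioo
    (fun u hu => (hv u hu).hasDerivWithinAt) hinj,
    setLIntegral_congr_fun measurableSet_Ioo (g := fun _ => 1)]
  · simp
  intro t ht
  simp only
  rw [← ENNReal.ofReal_mul (abs_nonneg _), slowness, ← he t ht, Real.sqrt_sq_eq_abs,
    mul_one_div_cancel (abs_ne_zero.2 (hw t ht)), ENNReal.ofReal_one]

/-- The substitution `h = e + t²/2` turns the integrand into `1` on a bounded interval. -/
theorem lintegral_inv_sqrt_lt_top (e L : ℝ) :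
    ∫⁻ h in Ioo e L, ENNReal.ofReal (1 / √(2 * (h - e))) < ⊤ := by
  have h : ∫⁻ h in (fun t : ℝ => e + t ^ 2 / 2) '' Ioi 0 ∩ Iio L,
      ENNReal.ofReal (1 / √(2 * (h - e))) < ⊤ := by
    have : (fun t : ℝ => e + t ^ 2 / 2) '' Ioi 0 ∩ Iio L ⊆
        (fun t : ℝ => e + t ^ 2 / 2) '' Ioo 0 (1 + 2 * (L - e)) := by
      rintro _ ⟨⟨t, ht, rfl⟩, h⟩
      refine ⟨t, ⟨ht, ?_⟩, rfl⟩
      simp only [mem_Iio, mem_Ioi] at h ht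
      nlinarith [sq_nonneg (t - 1)]
    refine (lintegral_mono_set this).trans_lt ?_
    rw [lintegral_image_eq_lintegral_abs_deriv_mul (f' := fun t => t) measurableSet_Ioo,
      setLIntegral_congr_fun measurableSet_Ioo (g := fun _ => 1)]
    · simp
    · intro t ht
      simp only
      rw [← ENNReal.ofReal_mul (abs_nonneg _), show 2 * (e + t ^ 2 / 2 - e) = t ^ 2 by ring,
        Real.sqrt_sq_eq_abs, mul_one_div_cancel (abs_ne_zero.2 ht.1.ne'), ENNReal.ofReal_one]
    · intro t _
      exact ((((hasDerivAt_id t).pow 2).div_const 2).const_add e).hasDerivWithinAt.congr_deriv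
        (by simp)
    · intro s hs t ht hst
      simp only at hst
      have h1 := hs.1
      have h2 := ht.1
      nlinarith
  refine lt_of_le_of_lt (lintegral_mono_set fun h hh => ?_) h
  refine ⟨⟨√(2 * (h - e)), Real.sqrt_pos.2 (by linarith [hh.1]), ?_⟩, hh.2⟩
  simp only
  rw [Real.sq_sqrt (by linarith [hh.1])]
  ring

/-- With `h = pot u` as variable, `1 / |force|` stays bounded away from the equilibria, and only the
integrable singularity `1 / √(h - e)` remains. -/
theorem timeIn_lt_top (hp : 2 < p) {m : ℝ} {J : Set ℝ} (hJ : MeasurableSet J)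
    (hinj : InjOn (pot p) J) (hm : 0 < m) (hf : ∀ u ∈ J, m ≤ |force p u|) (e : ℝ) :
    timeIn p e J < ⊤ := by
  have hB : MeasurableSet {u | e < pot p u} :=
    (isOpen_lt continuous_const (continuous_pot hp)).measurableSet
  rw [timeIn_inter hp e hJ]
  calc timeIn p e (J ∩ {u | e < pot p u})
      ≤ ∫⁻ u in J ∩ {u | e < pot p u}, ENNReal.ofReal |force p u| *
        (ENNReal.ofReal m⁻¹ * ENNReal.ofReal (1 / √(2 * (pot p u - e)))) := by
        refine setLIntegral_mono' (hJ.inter hB) fun u hu => ?_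
        rw [← mul_assoc, ← ENNReal.ofReal_mul (abs_nonneg _), slowness]
        refine le_mul_of_one_le_left zero_le ?_
        rw [ENNReal.one_le_ofReal, ← div_eq_mul_inv, one_le_div hm]
        exact hf u hu.1
    _ = ∫⁻ h in pot p '' (J ∩ {u | e < pot p u}),
        ENNReal.ofReal m⁻¹ * ENNReal.ofReal (1 / √(2 * (h - e))) :=
        (lintegral_image_eq_lintegral_abs_deriv_mul (hJ.inter hB)
          (fun u _ => (hasDerivAt_pot hp u).hasDerivWithinAt)
          (hinj.mono inter_subset_left)
          fun h => ENNReal.ofReal m⁻¹ * ENNReal.ofReal (1 / √(2 * (h - e)))).symm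
    _ ≤ ∫⁻ h in Ioo e (pot p 1 + 1),
        ENNReal.ofReal m⁻¹ * ENNReal.ofReal (1 / √(2 * (h - e))) := by
        refine lintegral_mono_set ?_
        rintro _ ⟨u, hu, rfl⟩
        have := pot_le hp u
        rw [← pot_one] at this
        exact ⟨hu.2, by linarith⟩
    _ < ⊤ := by
        rw [lintegral_const_mul']
        · exact ENNReal.mul_lt_top ENNReal.ofReal_lt_top (lintegral_inv_sqrt_lt_top _ _)
        · exact ENNReal.ofReal_ne_top

/-- Time maps relative to the final height, in the variable `s = pot u / pot c`. -/
theorem timeIn_eq_of_ratio (hp : 2 < p) {θ X : ℝ} (hθ : 0 < θ) (hX : 0 < X) {U : ℝ → ℝ}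
    {J : Set ℝ} (hJ : MeasurableSet J) (hf : ∀ u ∈ J, force p u ≠ 0)
    (hU : ∀ u ∈ J, U (pot p u) = u) (hJX : ∀ u ∈ J, pot p u ∈ Ioo (θ * X) X)
    (hS : ∀ h ∈ Ioo (θ * X) X, U h ∈ J ∧ pot p (U h) = h) :
    timeIn p (θ * X) J = ∫⁻ s in Ioo θ 1, ENNReal.ofReal
      (√(pot p (U (s * X))) / |force p (U (s * X))| * (1 / (√s * √(2 * (s - θ))))) := by
  have hm : ∀ s ∈ Ioo θ 1, s * X ∈ Ioo (θ * X) X := fun s hs =>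
    ⟨mul_lt_mul_of_pos_right hs.1 hX, by nlinarith [hs.2]⟩
  rw [timeIn, lintegral_reparam (φ := fun u => pot p u / X) (φ' := fun u => force p u / X)
    (U := fun s => U (s * X)) (S := Ioo θ 1) hJ
    (fun u _ => (hasDerivAt_pot hp u).div_const X) (fun u hu => div_ne_zero (hf u hu) hX.ne')
    (fun u hu => by simp only [div_mul_cancel₀ _ hX.ne']; exact hU u hu)
    (fun u hu => ⟨(lt_div_iff₀ hX).2 (hJX u hu).1, (div_lt_one hX).2 (hJX u hu).2⟩)
    (fun s hs => ⟨(hS _ (hm s hs)).1, by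
      rw [(hS _ (hm s hs)).2, mul_div_cancel_right₀ _ hX.ne']⟩)]
  refine setLIntegral_congr_fun measurableSet_Ioo fun s hs => ?_
  congr 1
  have hs0 := hθ.trans hs.1
  have h1 : 0 < 2 * (s - θ) := by linarith [hs.1]
  rw [slowness, (hS _ (hm s hs)).2, show 2 * (s * X - θ * X) = X * (2 * (s - θ)) by ring,
    Real.sqrt_mul hX.le, Real.sqrt_mul hs0.le, abs_div, abs_of_pos hX]
  have h2 := Real.sqrt_pos.2 h1
  have h3 := Real.sqrt_pos.2 hX
  have h4 := Real.sqrt_pos.2 hs0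
  have h5 := abs_pos.2 (hf _ (hS _ (hm s hs)).1)
  field_simp
  rw [Real.sq_sqrt hX.le]

/-- Time maps relative to the top of the potential, in the variable
`s = (pot 1 - pot u) / (pot 1 - e)`. -/
theorem timeIn_eq_of_depth (hp : 2 < p) {e : ℝ} (he : e < pot p 1) {U : ℝ → ℝ}
    {J : Set ℝ} (hJ : MeasurableSet J) (hf : ∀ u ∈ J, force p u ≠ 0)
    (hU : ∀ u ∈ J, U (pot p u) = u) (hJX : ∀ u ∈ J, pot p u ∈ Ioo e (pot p 1))
    (hS : ∀ h ∈ Ioo e (pot p 1), U h ∈ J ∧ pot p (U h) = h) :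
    timeIn p e J = ∫⁻ s in Ioo 0 1, ENNReal.ofReal
      (kap p (U (pot p 1 - s * (pot p 1 - e))) * (1 / (√s * √(2 * (1 - s))))) := by
  set H := pot p 1 - e with hH
  have hH0 : 0 < H := sub_pos.2 he
  have hm : ∀ s ∈ Ioo (0 : ℝ) 1, pot p 1 - s * H ∈ Ioo e (pot p 1) := fun s hs =>
    ⟨by nlinarith [hs.2], by nlinarith [hs.1]⟩
  rw [timeIn, lintegral_reparam (φ := fun u => (pot p 1 - pot p u) / H)
    (φ' := fun u => -force p u / H)
    (U := fun s => U (pot p 1 - s * H)) (S := Ioo 0 1) hJ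
    (fun u _ => ((hasDerivAt_pot hp u).const_sub _).div_const H)
    (fun u hu => div_ne_zero (neg_ne_zero.2 (hf u hu)) hH0.ne')
    (fun u hu => by simp only [div_mul_cancel₀ _ hH0.ne', sub_sub_cancel]; exact hU u hu)
    (fun u hu => ⟨div_pos (sub_pos.2 (hJX u hu).2) hH0,
      (div_lt_one hH0).2 (by linarith [(hJX u hu).1])⟩)
    (fun s hs => ⟨(hS _ (hm s hs)).1, by
      rw [(hS _ (hm s hs)).2, sub_sub_cancel, mul_div_cancel_right₀ _ hH0.ne']⟩)]
  refine setLIntegral_congr_fun measurableSet_Ioo fun s hs => ?_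
  congr 1
  have hs0 := hs.1
  have h1 : 0 < 2 * (1 - s) := by linarith [hs.2]
  rw [kap, slowness, (hS _ (hm s hs)).2, sub_sub_cancel,
    show 2 * (pot p 1 - s * H - e) = H * (2 * (1 - s)) by rw [hH]; ring,
    Real.sqrt_mul hH0.le, Real.sqrt_mul hs0.le, abs_div, abs_neg, abs_of_pos hH0]
  have h2 := Real.sqrt_pos.2 h1
  have h3 := Real.sqrt_pos.2 hH0
  have h4 := Real.sqrt_pos.2 hs0
  have h5 := abs_pos.2 (hf _ (hS _ (hm s hs)).1)
  field_simp
  rw [Real.sq_sqrt hH0.le]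

theorem pot_mono_low (hp : 2 < p) {a b : ℝ} (ha : 0 ≤ a) (hab : a ≤ b) (hb : b ≤ 1) :
    pot p a ≤ pot p b :=
  (pot_strictMonoOn hp).monotoneOn ⟨ha, hab.trans hb⟩ ⟨ha.trans hab, hb⟩ hab

theorem pot_anti_high (hp : 2 < p) {a b : ℝ} (ha : 1 ≤ a) (hab : a ≤ b) : pot p b ≤ pot p a :=
  (pot_strictAntiOn hp).antitoneOn ha (ha.trans hab) hab

theorem measurableSet_pot (hp : 2 < p) (e : ℝ) : MeasurableSet {u | e < pot p u} :=
  (isOpen_lt continuous_const (continuous_pot hp)).measurableSet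

theorem timeIn_low_formula (hp : 2 < p) {θ c : ℝ} (hθ : 0 < θ) (hc : 0 < c) (hc1 : c ≤ 1) :
    timeIn p (θ * pot p c) (Ioo 0 c) = ∫⁻ s in Ioo θ 1, ENNReal.ofReal
      (√(pot p (lowBranch p (s * pot p c))) / |force p (lowBranch p (s * pot p c))| *
        (1 / (√s * √(2 * (s - θ))))) := by
  have hX := pot_pos hp hc (hc1.trans_lt (one_lt_peak hp))
  have hX1 : pot p c ≤ pot p 1 := pot_mono_low hp hc.le hc1 le_rfl
  rw [timeIn_inter hp _ measurableSet_Ioo]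
  refine timeIn_eq_of_ratio hp hθ hX (measurableSet_Ioo.inter (measurableSet_pot hp _))
    (fun u hu => (force_pos hp hu.1.1 (hu.1.2.trans_le hc1)).ne')
    (fun u hu => lowBranch_pot hp ⟨hu.1.1, hu.1.2.trans_le hc1⟩)
    (fun u hu => ⟨hu.2, pot_strictMonoOn hp ⟨hu.1.1.le, hu.1.2.le.trans hc1⟩ ⟨hc.le, hc1⟩ hu.1.2⟩)
    fun h hh => ?_
  obtain ⟨h1, h2⟩ := lowBranch_spec hp ((mul_pos hθ hX).trans hh.1) (hh.2.trans_le hX1)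
  refine ⟨⟨⟨h1.1, ?_⟩, by rw [mem_ofPred_eq, h2]; exact hh.1⟩, h2⟩
  rw [← (pot_strictMonoOn hp).lt_iff_lt ⟨h1.1.le, h1.2.le⟩ ⟨hc.le, hc1⟩, h2]
  exact hh.2

theorem timeIn_high_formula (hp : 2 < p) {θ c : ℝ} (hθ : 0 < θ) (hc : 1 ≤ c) (hc1 : c < peak p) :
    timeIn p (θ * pot p c) (Ioi c) = ∫⁻ s in Ioo θ 1, ENNReal.ofReal
      (√(pot p (highBranch p (s * pot p c))) / |force p (highBranch p (s * pot p c))| *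
        (1 / (√s * √(2 * (s - θ))))) := by
  have hX := pot_pos hp (one_pos.trans_le hc) hc1
  have hX1 : pot p c ≤ pot p 1 := pot_anti_high hp le_rfl hc
  rw [timeIn_inter hp _ measurableSet_Ioi]
  refine timeIn_eq_of_ratio hp hθ hX (measurableSet_Ioi.inter (measurableSet_pot hp _))
    (fun u hu => (force_neg_of_one_lt hp (hc.trans_lt hu.1)).ne)
    (fun u hu => highBranch_pot hp (hc.trans_lt hu.1))
    (fun u hu => ⟨hu.2, pot_strictAntiOn hp hc (hc.trans_lt hu.1).le hu.1⟩)
    fun h hh => ?_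
  obtain ⟨h1, h2⟩ := highBranch_spec hp ((mul_pos hθ hX).trans hh.1) (hh.2.trans_le hX1)
  refine ⟨⟨?_, by rw [mem_ofPred_eq, h2]; exact hh.1⟩, h2⟩
  rw [mem_Ioi, ← (pot_strictAntiOn hp).lt_iff_gt (mem_Ici.2 h1.le) (mem_Ici.2 hc), h2]
  exact hh.2

theorem lintegral_ratio_lt {θ : ℝ} (hθ : 0 < θ) (hθ1 : θ < 1) {F G : ℝ → ℝ}
    (hlt : ∀ s ∈ Ioo θ 1, F s < G s) (hF : ∀ s ∈ Ioo θ 1, 0 ≤ F s)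
    (hG : AEMeasurable G (volume.restrict (Ioo θ 1)))
    (hfin : ∫⁻ s in Ioo θ 1, ENNReal.ofReal (F s * (1 / (√s * √(2 * (s - θ))))) ≠ ⊤) :
    ∫⁻ s in Ioo θ 1, ENNReal.ofReal (F s * (1 / (√s * √(2 * (s - θ))))) <
      ∫⁻ s in Ioo θ 1, ENNReal.ofReal (G s * (1 / (√s * √(2 * (s - θ))))) := by
  refine lintegral_strict_mono ?_ ?_ hfin ?_
  · rw [Ne, Measure.restrict_eq_zero, Real.volume_Ioo, ENNReal.ofReal_eq_zero]
    linarith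
  · refine (hG.mul (Measurable.aemeasurable ?_)).ennreal_ofReal
    fun_prop
  · refine (ae_restrict_iff' measurableSet_Ioo).2 (ae_of_all _ fun s hs => ?_)
    have h1 : 0 < 1 / (√s * √(2 * (s - θ))) := by
      have := Real.sqrt_pos.2 (hθ.trans hs.1)
      have := Real.sqrt_pos.2 (show 0 < 2 * (s - θ) by linarith [hs.1])
      positivity
    rw [ENNReal.ofReal_lt_ofReal_iff_of_nonneg (mul_nonneg (hF s hs) h1.le)]
    exact mul_lt_mul_of_pos_right (hlt s hs) h1

theorem timeIn_low_lt_top (hp : 2 < p) {θ c : ℝ} (hθ : 0 < θ) (hc : 0 < c) (hc1 : c < 1) :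
    timeIn p (θ * pot p c) (Ioo 0 c) < ⊤ := by
  have hX := pot_pos hp hc (hc1.trans (one_lt_peak hp))
  have hX1 : pot p c < pot p 1 := pot_lt_pot_one_low hp ⟨hc, hc1⟩
  rw [timeIn_inter hp _ measurableSet_Ioo]
  -- For `1 ≤ θ` the orbit visits no height below `c`. Otherwise it visits only heights in `[a, c]`
  -- with `a` the near turning point, and `c < 1` keeps `force` bounded below there.
  rcases le_or_gt 1 θ with h | hθ1
  · have : Ioo 0 c ∩ {u | θ * pot p c < pot p u} = ∅ := by
      ext u
      simp only [mem_inter_iff, mem_Ioo, mem_ofPred_eq, mem_empty_iff_false, iff_false, not_and]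
      intro hu
      have := pot_mono_low hp hu.1.le hu.2.le hc1.le
      nlinarith
    simp [this, timeIn]
  obtain ⟨ha, hae⟩ := lowBranch_spec hp (mul_pos hθ hX) (show θ * pot p c < pot p 1 by nlinarith)
  set a := lowBranch p (θ * pot p c)
  have hac : a < c := by
    rw [← (pot_strictMonoOn hp).lt_iff_lt ⟨ha.1.le, ha.2.le⟩ ⟨hc.le, hc1.le⟩, hae]
    nlinarith
  obtain ⟨x, hx, hmin⟩ := (isCompact_Icc (a := a) (b := c)).exists_isMinOn
    (nonempty_Icc.2 hac.le) (continuous_force (p := p) hp).continuousOn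
  refine timeIn_lt_top hp (measurableSet_Ioo.inter (measurableSet_pot hp _))
    ((pot_strictMonoOn_Ioo hp).injOn.mono fun u hu => mem_Ioo.2 ⟨hu.1.1, hu.1.2.trans hc1⟩)
    (force_pos hp (ha.1.trans_le hx.1) (hx.2.trans_lt hc1)) (fun u hu => ?_) _
  refine (isMinOn_iff.1 hmin u (mem_Icc.2 ⟨?_, hu.1.2.le⟩)).trans (le_abs_self _)
  rw [← (pot_strictMonoOn hp).le_iff_le ⟨ha.1.le, ha.2.le⟩ ⟨hu.1.1.le, (hu.1.2.trans hc1).le⟩, hae]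
  exact hu.2.le

theorem timeIn_high_lt_top (hp : 2 < p) {c : ℝ} (hc : 1 < c) (e : ℝ) :
    timeIn p e (Ioi c) < ⊤ := by
  refine timeIn_lt_top hp measurableSet_Ioi
    ((pot_strictAntiOn_Ioi hp).injOn.mono fun u hu => hc.trans hu)
    (neg_pos.2 (force_neg_of_one_lt hp hc)) (fun u hu => ?_) _
  have : force p u < force p c := force_strictAntiOn hp (mem_Ici.2 hc.le)
    (mem_Ici.2 (hc.trans hu).le) hu
  have h2 := neg_le_abs (force p u)
  linarith

/-- The time to climb to a height `c ≤ 1` increases with `c`. -/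
theorem timeIn_low_lt (hp : 2 < p) {θ c₁ c₂ : ℝ} (hθ : 0 < θ) (hθ1 : θ < 1) (h0 : 0 < c₁)
    (h : c₁ < c₂) (h1 : c₂ ≤ 1) :
    timeIn p (θ * pot p c₁) (Ioo 0 c₁) < timeIn p (θ * pot p c₂) (Ioo 0 c₂) := by
  have hfin := timeIn_low_lt_top hp hθ h0 (h.trans_le h1)
  have hX1 := pot_pos hp h0 ((h.trans_le h1).trans (one_lt_peak hp))
  have hX : pot p c₁ < pot p c₂ :=
    pot_strictMonoOn hp ⟨h0.le, (h.trans_le h1).le⟩ ⟨(h0.trans h).le, h1⟩ h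
  have hX2 := hX1.trans hX
  have hX3 : pot p c₂ ≤ pot p 1 := pot_mono_low hp (h0.trans h).le h1 le_rfl
  have hm1 : ∀ s ∈ Ioo θ 1, s * pot p c₁ ∈ Ioo 0 (pot p 1) := fun s hs =>
    ⟨mul_pos (hθ.trans hs.1) hX1, by nlinarith [hs.2]⟩
  have hm2 : ∀ s ∈ Ioo θ 1, s * pot p c₂ ∈ Ioo 0 (pot p 1) := fun s hs =>
    ⟨mul_pos (hθ.trans hs.1) hX2, by nlinarith [hs.2]⟩
  rw [timeIn_low_formula hp hθ h0 (h.le.trans h1)] at hfin ⊢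
  rw [timeIn_low_formula hp hθ (h0.trans h) h1]
  refine lintegral_ratio_lt hθ hθ1 (fun s hs => ?_) (fun s _ => by positivity)
    (aemeasurable_restrict_of_monotoneOn measurableSet_Ioo fun s hs t ht hst => ?_) hfin.ne
  · exact sqrt_pot_div_strictMonoOn hp (lowBranch_spec hp (hm1 s hs).1 (hm1 s hs).2).1
      (lowBranch_spec hp (hm2 s hs).1 (hm2 s hs).2).1
      (lowBranch_strictMonoOn hp (hm1 s hs) (hm2 s hs)
        (mul_lt_mul_of_pos_left hX (hθ.trans hs.1)))
  · exact (sqrt_pot_div_strictMonoOn hp).monotoneOn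
      (lowBranch_spec hp (hm2 s hs).1 (hm2 s hs).2).1
      (lowBranch_spec hp (hm2 t ht).1 (hm2 t ht).2).1
      ((lowBranch_strictMonoOn hp).monotoneOn (hm2 s hs) (hm2 t ht)
        (mul_le_mul_of_nonneg_right hst hX2.le))

/-- The time to descend to a height `c ≥ 1` decreases with `c`. -/
theorem timeIn_high_lt (hp : 2 < p) {θ c₁ c₂ : ℝ} (hθ : 0 < θ) (hθ1 : θ < 1) (h0 : 1 ≤ c₁)
    (h : c₁ < c₂) (h1 : c₂ < peak p) :
    timeIn p (θ * pot p c₂) (Ioi c₂) < timeIn p (θ * pot p c₁) (Ioi c₁) := by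
  have hfin := timeIn_high_lt_top hp (h0.trans_lt h) (θ * pot p c₂)
  have hc0 : 0 < c₁ := one_pos.trans_le h0
  have hX2 := pot_pos hp (hc0.trans h) h1
  have hX : pot p c₂ < pot p c₁ := pot_strictAntiOn hp h0 (h0.trans h.le) h
  have hX1 := hX2.trans hX
  have hX3 : pot p c₁ ≤ pot p 1 := pot_anti_high hp le_rfl h0
  have hm1 : ∀ s ∈ Ioo θ 1, s * pot p c₁ ∈ Ioo 0 (pot p 1) := fun s hs =>
    ⟨mul_pos (hθ.trans hs.1) hX1, by nlinarith [hs.2]⟩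
  have hm2 : ∀ s ∈ Ioo θ 1, s * pot p c₂ ∈ Ioo 0 (pot p 1) := fun s hs =>
    ⟨mul_pos (hθ.trans hs.1) hX2, by nlinarith [hs.2]⟩
  have hmem : ∀ y ∈ Ioo 0 (pot p 1), highBranch p y ∈ Ioo 1 (peak p) := fun y hy => by
    obtain ⟨h2, h3⟩ := highBranch_spec hp hy.1 hy.2
    exact ⟨h2, (le_abs_self _).trans_lt (abs_lt_peak hp (h3.symm ▸ hy.1))⟩
  rw [timeIn_high_formula hp hθ (h0.trans h.le) h1] at hfin ⊢
  rw [timeIn_high_formula hp hθ h0 (h.trans h1)]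
  refine lintegral_ratio_lt hθ hθ1 (fun s hs => ?_) (fun s _ => by positivity)
    (aemeasurable_restrict_of_monotoneOn measurableSet_Ioo fun s hs t ht hst => ?_) hfin.ne
  · exact sqrt_pot_div_strictAntiOn hp (hmem _ (hm1 s hs)) (hmem _ (hm2 s hs))
      (highBranch_strictAntiOn hp (hm2 s hs) (hm1 s hs)
        (mul_lt_mul_of_pos_left hX (hθ.trans hs.1)))
  · exact (sqrt_pot_div_strictAntiOn hp).antitoneOn (hmem _ (hm1 t ht)) (hmem _ (hm1 s hs))
      ((highBranch_strictAntiOn hp).antitoneOn (hm1 s hs) (hm1 t ht)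
        (mul_le_mul_of_nonneg_right hst hX1.le))

theorem timeIn_Ioi_formula (hp : 2 < p) {e : ℝ} (he0 : 0 < e) (he : e < pot p 1) :
    timeIn p e (Ioi 0) =
      ∫⁻ s in Ioo 0 1, (ENNReal.ofReal
        (kap p (lowBranch p (pot p 1 - s * (pot p 1 - e))) * (1 / (√s * √(2 * (1 - s))))) +
      ENNReal.ofReal
        (kap p (highBranch p (pot p 1 - s * (pot p 1 - e))) * (1 / (√s * √(2 * (1 - s)))))) := by
  have hm : ∀ s ∈ Ioo (0 : ℝ) 1, pot p 1 - s * (pot p 1 - e) ∈ Ioo 0 (pot p 1) := fun s hs =>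
    ⟨by nlinarith [hs.2], by nlinarith [hs.1]⟩
  rw [timeIn_Ioi_eq_add e one_pos, timeIn_inter hp _ measurableSet_Ioo,
    timeIn_inter hp _ measurableSet_Ioi,
    timeIn_eq_of_depth hp he (U := lowBranch p)
      (measurableSet_Ioo.inter (measurableSet_pot hp _))
      (fun u hu => (force_pos hp hu.1.1 hu.1.2).ne') (fun u hu => lowBranch_pot hp hu.1)
      (fun u hu => ⟨hu.2, pot_lt_pot_one_low hp hu.1⟩)
      (fun h hh => by
        obtain ⟨h1, h2⟩ := lowBranch_spec hp (he0.trans hh.1) hh.2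
        exact ⟨⟨h1, by rw [mem_ofPred_eq, h2]; exact hh.1⟩, h2⟩),
    timeIn_eq_of_depth hp he (U := highBranch p)
      (measurableSet_Ioi.inter (measurableSet_pot hp _))
      (fun u hu => (force_neg_of_one_lt hp hu.1).ne) (fun u hu => highBranch_pot hp hu.1)
      (fun u hu => ⟨hu.2, pot_lt_pot_one_high hp hu.1⟩)
      (fun h hh => by
        obtain ⟨h1, h2⟩ := highBranch_spec hp (he0.trans hh.1) hh.2
        exact ⟨⟨h1, by rw [mem_ofPred_eq, h2]; exact hh.1⟩, h2⟩),
    lintegral_add_left']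
  refine AEMeasurable.ennreal_ofReal (AEMeasurable.mul ?_ (Measurable.aemeasurable (by fun_prop)))
  have hk : Measurable (kap p) := by
    unfold kap
    have := (continuous_pot hp).measurable
    have := (continuous_force hp).measurable
    fun_prop
  refine hk.comp_aemeasurable (aemeasurable_restrict_of_antitoneOn measurableSet_Ioo
    fun s hs t ht hst => ?_)
  refine (lowBranch_strictMonoOn hp).monotoneOn (hm t ht) (hm s hs) ?_
  have := mul_le_mul_of_nonneg_right hst (sub_pos.2 he).le
  linarith

/-- The period is a nonincreasing function of the energy. -/
theorem timeIn_Ioi_anti (hp : 2 < p) {e₁ e₂ : ℝ} (h0 : 0 < e₁) (h : e₁ ≤ e₂) (h1 : e₂ < pot p 1) :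
    timeIn p e₂ (Ioi 0) ≤ timeIn p e₁ (Ioi 0) := by
  have hm : ∀ e, 0 < e → e < pot p 1 → ∀ s ∈ Ioo (0 : ℝ) 1,
      pot p 1 - s * (pot p 1 - e) ∈ Ioo 0 (pot p 1) := fun e he0 he s hs =>
    ⟨by nlinarith [hs.2], by nlinarith [hs.1]⟩
  rw [timeIn_Ioi_formula hp h0 (h.trans_lt h1), timeIn_Ioi_formula hp (h0.trans_le h) h1]
  refine setLIntegral_mono' measurableSet_Ioo fun s hs => ?_
  have hk : ∀ u, 0 ≤ kap p u := fun u => by unfold kap; positivity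
  have h3 : 0 ≤ 1 / (√s * √(2 * (1 - s))) := by positivity
  rw [← ENNReal.ofReal_add (mul_nonneg (hk _) h3) (mul_nonneg (hk _) h3),
    ← ENNReal.ofReal_add (mul_nonneg (hk _) h3) (mul_nonneg (hk _) h3), ← add_mul, ← add_mul]
  refine ENNReal.ofReal_le_ofReal (mul_le_mul_of_nonneg_right ?_ h3)
  have hm1 := hm e₁ h0 (h.trans_lt h1) s hs
  have hm2 := hm e₂ (h0.trans_le h) h1 s hs
  have hle : pot p 1 - s * (pot p 1 - e₁) ≤ pot p 1 - s * (pot p 1 - e₂) := by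
    nlinarith [hs.1]
  generalize pot p 1 - s * (pot p 1 - e₁) = y₁ at *
  generalize pot p 1 - s * (pot p 1 - e₂) = y₂ at *
  have l1 := lowBranch_spec hp hm1.1 hm1.2
  have l2 := lowBranch_spec hp hm2.1 hm2.2
  have k1 := highBranch_spec hp hm1.1 hm1.2
  have k2 := highBranch_spec hp hm2.1 hm2.2
  -- Both branches are taken at the same potential, so the terms `λ√V` drop out when `a1` and `a2`
  -- are added.
  have a1 := kap_sub_antitoneOn hp l1.1 l2.1 ((lowBranch_strictMonoOn hp).monotoneOn hm1 hm2 hle)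
  have a2 := kap_add_monotoneOn hp (mem_Ioi.2 k2.1) (mem_Ioi.2 k1.1)
    ((highBranch_strictAntiOn hp).antitoneOn hm1 hm2 hle)
  simp only [l1.2, l2.2, k1.2, k2.2] at a1 a2
  linarith

/-- A solution descending for a given time from the far turning point is determined by its final
height. -/
theorem timeIn_Ioi_injective (hp : 2 < p) {θ c₁ c₂ : ℝ} (hθ : 0 < θ) (hθ1 : θ < 1) (h0 : 0 < c₁)
    (h : c₁ < c₂) (h1 : c₂ < peak p) {L : ℝ}
    (e₁ : timeIn p (θ * pot p c₁) (Ioi c₁) = ENNReal.ofReal L)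
    (e₂ : timeIn p (θ * pot p c₂) (Ioi c₂) = ENNReal.ofReal L) : False := by
  -- Below the equilibrium the descent is the total time minus the arc below `c`. As `c` grows, the
  -- total does not increase and the arc strictly increases, so the descent takes strictly less
  -- time.
  have key : ∀ c, c₁ < c → c ≤ 1 →
      timeIn p (θ * pot p c) (Ioi c) < ENNReal.ofReal L := fun c hc hc1 => by
    have hX := pot_strictMonoOn hp ⟨h0.le, hc.le.trans hc1⟩ ⟨(h0.trans hc).le, hc1⟩ hc
    have hX0 := pot_pos hp h0 (h.trans h1)
    have hX1 := pot_mono_low hp (h0.trans hc).le hc1 le_rfl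
    have hT := timeIn_Ioi_anti hp (e₁ := θ * pot p c₁) (e₂ := θ * pot p c) (by positivity)
      (by gcongr) (by nlinarith)
    rw [timeIn_Ioi_eq_add (θ * pot p c₁) h0, timeIn_Ioi_eq_add (θ * pot p c) (h0.trans hc), e₁] at hT
    have hA := timeIn_low_lt hp hθ hθ1 h0 hc hc1
    by_contra! hcon
    have h2 := timeIn_low_lt_top hp hθ h0 (hc.trans_le hc1)
    exact absurd hT (not_le.2 (ENNReal.add_lt_add_of_lt_of_le ENNReal.ofReal_ne_top hA hcon))
  rcases le_or_gt c₂ 1 with hc2 | hc2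
  · exact (key c₂ h hc2).ne e₂
  -- Heights on opposite sides of the equilibrium are compared through the height `1`.
  have hB : ENNReal.ofReal L < timeIn p (θ * pot p (max c₁ 1)) (Ioi (max c₁ 1)) := by
    rw [← e₂]
    exact timeIn_high_lt hp hθ hθ1 (le_max_right _ _) (max_lt h hc2) h1
  rcases le_or_gt 1 c₁ with hc1 | hc1
  · rw [max_eq_left hc1, e₁] at hB
    exact lt_irrefl _ hB
  · rw [max_eq_right hc1.le] at hB
    exact lt_asymm hB (key 1 hc1 le_rfl)

/-- A solution climbing for a given time from the near turning point is determined by its final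
height. -/
theorem timeIn_Ioo_injective (hp : 2 < p) {θ c₁ c₂ : ℝ} (hθ : 0 < θ) (hθ1 : θ < 1) (h0 : 0 < c₁)
    (h : c₁ < c₂) (h1 : c₂ < peak p) {L : ℝ}
    (e₁ : timeIn p (θ * pot p c₁) (Ioo 0 c₁) = ENNReal.ofReal L)
    (e₂ : timeIn p (θ * pot p c₂) (Ioo 0 c₂) = ENNReal.ofReal L) : False := by
  -- The mirror argument: above the equilibrium the climb is the total time minus the arc above `c`.
  have key : ∀ c, 1 ≤ c → c < c₂ →
      timeIn p (θ * pot p c) (Ioo 0 c) < ENNReal.ofReal L := fun c hc hc1 => by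
    have hc0 : 0 < c := one_pos.trans_le hc
    have hX : pot p c₂ < pot p c := pot_strictAntiOn hp hc (hc.trans hc1.le) hc1
    have hX0 := pot_pos hp (h0.trans h) h1
    have hX1 := pot_anti_high hp le_rfl hc
    have hT := timeIn_Ioi_anti hp (e₁ := θ * pot p c₂) (e₂ := θ * pot p c) (by positivity)
      (by gcongr) (by nlinarith)
    rw [timeIn_Ioi_eq_add (θ * pot p c) hc0, timeIn_Ioi_eq_add (θ * pot p c₂) (h0.trans h), e₂] at hT
    have hA := timeIn_high_lt hp hθ hθ1 hc hc1 h1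
    by_contra! hcon
    exact absurd hT (not_le.2 (ENNReal.add_lt_add_of_le_of_lt ENNReal.ofReal_ne_top hcon hA))
  rcases le_or_gt 1 c₁ with hc1 | hc1
  · exact (key c₁ hc1 h).ne e₁
  have hB : ENNReal.ofReal L < timeIn p (θ * pot p (min c₂ 1)) (Ioo 0 (min c₂ 1)) := by
    rw [← e₁]
    exact timeIn_low_lt hp hθ hθ1 h0 (lt_min h hc1) (min_le_right _ _)
  rcases le_or_gt c₂ 1 with hc2 | hc2
  · rw [min_eq_left hc2, e₂] at hB
    exact lt_irrefl _ hB
  · rw [min_eq_right hc2.le] at hB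
    exact lt_asymm hB (key 1 le_rfl hc2)

end Fork

namespace Fork

open ForkFun

variable {p : ℝ} {P : ℕ} {ℓ : ℝ} {u : ForkFun P}

/-! ### Symmetric positive bound-states -/

theorem pos_of_hl_pos (hp : 2 < p) {b x : ℝ} (h : 0 < hl p b x) : 0 < b := by
  rcases lt_trichotomy b 0 with hb | rfl | hb
  · have := hl_pos hp (neg_pos.2 hb) x
    rw [hl_neg] at this
    linarith
  · rw [hl_zero_left] at h
    exact absurd h (lt_irrefl 0)
  · exact hb

theorem hl_eq_of_data (hp : 2 < p) {b b' : ℝ} (h : hl p b 0 = hl p b' 0)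
    (h' : hl' p b 0 = hl' p b' 0) : hl p b = hl p b' :=
  ((isSol_hl hp b).unique hp (isSol_hl hp b') h h').1

/-- At a zero of `v` the energy would be `w²/2 ≥ 0`. -/
theorem IsSol.pos_of_energy_neg (hp : 2 < p) {v w : ℝ → ℝ} (h : IsSol p v w) {s : ℝ}
    (he : w s ^ 2 / 2 - pot p (v s) < 0) (h0 : 0 < v s) (t : ℝ) : 0 < v t := by
  by_contra! hcon
  obtain ⟨x, -, hx⟩ := intermediate_value_uIcc h.continuous.continuousOn
    (show (0 : ℝ) ∈ uIcc (v t) (v s) from mem_uIcc.2 (Or.inl ⟨hcon, h0.le⟩))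
  rw [h.energy hp s x, hx, pot_zero hp] at he
  linarith [sq_nonneg (w x)]

theorem exists_forkFun_of_symmetric (hp : 2 < p) (hP : 2 ≤ P) (hℓ : 0 < ℓ)
    (hu : IsBoundState p ℓ u) (hs : IsCoreSymmetric ℓ u) :
    ∃ b δ : ℝ, Matching p ℓ b (fun _ : Fin P => δ) ∧ (b ≠ 0 ∨ δ ≠ 0) ∧
      SameOn ℓ u (fork p ℓ b fun _ => δ) := by
  obtain ⟨b, d, hm, hne, hsame⟩ := IsBoundState.exists_fork hp hℓ hu
  have i₀ : Fin P := ⟨0, by omega⟩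
  have hd : d = fun _ => d i₀ := by
    ext i
    have h1 := hsame.2 i (right_mem_Icc.2 hℓ.le)
    have h2 := hsame.2 i₀ (right_mem_Icc.2 hℓ.le)
    simp only [fork, sub_self, sol_zero hp] at h1 h2
    rw [← h1, ← h2]
    exact hs i i₀ (right_mem_Icc.2 hℓ.le)
  rw [hd] at hm hne hsame
  exact ⟨b, d i₀, hm, hne.imp_right fun ⟨_, h⟩ => h, hsame⟩

theorem Matching.symm_iff (hP : 2 ≤ P) {b δ : ℝ} :
    Matching p ℓ b (fun _ : Fin P => δ) ↔
      sol p δ 0 ℓ = hl p b 0 ∧ hl' p b 0 = P * sol' p δ 0 ℓ := by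
  have i₀ : Fin P := ⟨0, by omega⟩
  simp only [Matching, Finset.sum_const, Finset.card_univ, Fintype.card_fin, nsmul_eq_mul]
  exact ⟨fun h => ⟨h.1 i₀, h.2⟩, fun h => ⟨fun _ => h.1, h.2⟩⟩

/-- The squared slopes at the vertex are `2 pot c` on the half-line and `2 (pot c - pot δ)` on a
pendant, and Kirchhoff's condition makes their ratio `P²`. -/
theorem Matching.symm_energy (hp : 2 < p) (hP : 2 ≤ P) {b δ : ℝ}
    (h : Matching p ℓ b (fun _ : Fin P => δ)) :
    pot p δ = (1 - 1 / (P : ℝ) ^ 2) * pot p (hl p b 0) := by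
  obtain ⟨h1, h2⟩ := (Matching.symm_iff hP).1 h
  have he := (isSol_sol hp δ 0).energy hp 0 ℓ
  have hs := hl'_sq hp b 0
  rw [sol_zero hp, sol'_zero hp, h1] at he
  rw [h2] at hs
  have hP0 : (0 : ℝ) < P := by exact_mod_cast (by omega : 0 < P)
  field_simp
  linear_combination (-(P : ℝ) ^ 2) * he - hs / 2

theorem theta_pos (hP : 2 ≤ P) : 0 < 1 - 1 / (P : ℝ) ^ 2 := by
  have hP' : (2 : ℝ) ≤ P := by exact_mod_cast hP
  rw [sub_pos, div_lt_one (by positivity)]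
  nlinarith

theorem theta_lt_one (hP : 2 ≤ P) : 1 - 1 / (P : ℝ) ^ 2 < 1 := by
  have hP' : (2 : ℝ) ≤ P := by exact_mod_cast hP
  have : 0 < 1 / (P : ℝ) ^ 2 := by positivity
  linarith

/-- The data of a positive symmetric bound-state. -/
theorem exists_positive_data (hp : 2 < p) (hP : 2 ≤ P) (hℓ : 0 < ℓ)
    (hu : IsBoundState p ℓ u) (hpos : IsPositive ℓ u) (hs : IsSymmetric ℓ u) :
    ∃ b δ : ℝ, Matching p ℓ b (fun _ : Fin P => δ) ∧ 0 < b ∧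
      (∀ t ∈ Icc 0 ℓ, 0 < sol p δ 0 t) ∧ SameOn ℓ u (fork p ℓ b fun _ => δ) := by
  obtain ⟨b, δ, hm, -, hsame⟩ := exists_forkFun_of_symmetric hp hP hℓ hu hs
  refine ⟨b, δ, hm, pos_of_hl_pos hp (x := 0) ?_, fun t ht => ?_, hsame⟩
  · have := hsame.1 (mem_Ici.2 le_rfl)
    simp only [fork] at this
    rw [← this]
    exact hpos.1 0 (mem_Ici.2 le_rfl)
  · have ht' : ℓ - t ∈ Icc 0 ℓ := ⟨by linarith [ht.2], by linarith [ht.1]⟩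
    have := hsame.2 ⟨0, by omega⟩ ht'
    simp only [fork, sub_sub_cancel] at this
    rw [← this]
    exact hpos.2 _ _ ht'

/-- A vertex value equal to the peak would give `pot δ = 0`, hence `δ` equal to the peak as well. -/
theorem pot_vertex_pos (hp : 2 < p) (hP : 2 ≤ P) {b δ : ℝ}
    (h : Matching p ℓ b (fun _ : Fin P => δ)) (hb : 0 < b) (hδ : 0 < δ)
    (hne : sol p δ 0 ℓ ≠ δ) : 0 < pot p (hl p b 0) ∧ hl p b 0 < peak p := by
  have h1 := abs_hl_le_peak hp b 0
  have h2 := hl_pos hp hb 0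
  rw [abs_of_pos h2] at h1
  have key : hl p b 0 < peak p := by
    refine h1.lt_of_ne fun e => hne ?_
    have h3 := Matching.symm_energy hp hP h
    rw [e, pot_peak hp, mul_zero] at h3
    rw [((Matching.symm_iff hP).1 h).1, e]
    have h4 := abs_le_peak hp h3.ge
    rw [abs_of_pos hδ] at h4
    by_contra h5
    exact (pot_pos hp hδ (h4.lt_of_ne' h5)).ne' h3
  exact ⟨pot_pos hp h2 key, key⟩

theorem strictAntiOn_of_increasing (hP : 2 ≤ P) {b δ : ℝ}
    (hsame : SameOn ℓ u (fork p ℓ b fun _ => δ)) (hinc : IsCoreIncreasing ℓ u) :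
    StrictAntiOn (sol p δ 0) (Icc 0 ℓ) := fun s hs t ht hst => by
  have hs' : ℓ - s ∈ Icc 0 ℓ := ⟨by linarith [hs.2], by linarith [hs.1]⟩
  have ht' : ℓ - t ∈ Icc 0 ℓ := ⟨by linarith [ht.2], by linarith [ht.1]⟩
  have i₀ : Fin P := ⟨0, by omega⟩
  have := hinc i₀ ht' hs' (by linarith)
  rw [hsame.2 i₀ ht', hsame.2 i₀ hs'] at this
  simpa only [fork, sub_sub_cancel] using this

theorem strictMonoOn_of_decreasing (hP : 2 ≤ P) {b δ : ℝ}
    (hsame : SameOn ℓ u (fork p ℓ b fun _ => δ)) (hdec : IsCoreDecreasing ℓ u) :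
    StrictMonoOn (sol p δ 0) (Icc 0 ℓ) := fun s hs t ht hst => by
  have hs' : ℓ - s ∈ Icc 0 ℓ := ⟨by linarith [hs.2], by linarith [hs.1]⟩
  have ht' : ℓ - t ∈ Icc 0 ℓ := ⟨by linarith [ht.2], by linarith [ht.1]⟩
  have i₀ : Fin P := ⟨0, by omega⟩
  have := hdec i₀ ht' hs' (by linarith)
  rw [hsame.2 i₀ ht', hsame.2 i₀ hs'] at this
  simpa only [fork, sub_sub_cancel] using this

theorem IsSol.deriv_nonneg_of_strictMonoOn {v w : ℝ → ℝ} (h : IsSol p v w)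
    (hm : StrictMonoOn v (Icc 0 ℓ)) {t : ℝ} (ht : t ∈ Ioo 0 ℓ) : 0 ≤ w t := by
  have : 0 ≤ derivWithin v (Icc 0 ℓ) t := hm.monotoneOn.derivWithin_nonneg
  rwa [(h t).1.hasDerivWithinAt.derivWithin
    (uniqueDiffOn_Icc (ht.1.trans ht.2) t (Ioo_subset_Icc_self ht))] at this

/-- An interior zero of `w ≥ 0` is a minimum of `w`, so `w' = force v` vanishes there too; the
solution is then at rest at an equilibrium, hence constant. -/
theorem IsSol.deriv_pos_of_strictMonoOn (hp : 2 < p) {v w : ℝ → ℝ} (h : IsSol p v w)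
    (hm : StrictMonoOn v (Icc 0 ℓ)) {t : ℝ} (ht : t ∈ Ioo 0 ℓ) :
    0 < w t := by
  refine (h.deriv_nonneg_of_strictMonoOn hm ht).lt_of_ne fun e => ?_
  have hmin : IsLocalMin w t := by
    filter_upwards [Ioo_mem_nhds ht.1 ht.2] with s hs
    rw [← e]
    exact h.deriv_nonneg_of_strictMonoOn hm hs
  have hf := hmin.hasDerivAt_eq_zero (h t).2
  have hc := h.eq_const hp hf e.symm
  have hℓ := ht.1.trans ht.2
  have := hm (left_mem_Icc.2 hℓ.le) (right_mem_Icc.2 hℓ.le) hℓ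
  rw [(hc 0).1, (hc ℓ).1] at this
  exact lt_irrefl _ this

theorem IsSol.deriv_neg_of_strictAntiOn (hp : 2 < p) {v w : ℝ → ℝ} (h : IsSol p v w)
    (hm : StrictAntiOn v (Icc 0 ℓ)) {t : ℝ} (ht : t ∈ Ioo 0 ℓ) :
    w t < 0 := by
  have hneg := h.neg
  have hmin' : ∀ s ∈ Ioo 0 ℓ, 0 ≤ -w s := fun s hs =>
    hneg.deriv_nonneg_of_strictMonoOn hm.neg hs
  refine lt_of_le_of_ne (by linarith [hmin' t ht]) fun e => ?_
  have hmax : IsLocalMax w t := by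
    filter_upwards [Ioo_mem_nhds ht.1 ht.2] with s hs
    rw [e]
    linarith [hmin' s hs]
  have hf := hmax.hasDerivAt_eq_zero (h t).2
  have hc := h.eq_const hp hf e
  have hℓ := ht.1.trans ht.2
  have := hm (left_mem_Icc.2 hℓ.le) (right_mem_Icc.2 hℓ.le) hℓ
  rw [(hc 0).1, (hc ℓ).1] at this
  exact lt_irrefl _ this

/-- Starting at rest from `δ ≤ 1` and decreasing, the solution would stay in `(0, 1)`, where it is
convex, so its slope could not become negative. -/
theorem one_lt_of_strictAntiOn (hp : 2 < p) (hℓ : 0 < ℓ) {δ : ℝ}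
    (hm : StrictAntiOn (sol p δ 0) (Icc 0 ℓ)) (hv : ∀ t ∈ Icc 0 ℓ, 0 < sol p δ 0 t) : 1 < δ := by
  by_contra! hδ
  have hs := isSol_sol hp δ 0
  have hmono : MonotoneOn (sol' p δ 0) (Icc 0 ℓ) := by
    refine monotoneOn_of_hasDerivWithinAt_nonneg (convex_Icc 0 ℓ) hs.continuous'.continuousOn
      (fun x _ => (hs x).2.hasDerivWithinAt) fun x hx => ?_
    rw [interior_Icc] at hx
    have := hm (left_mem_Icc.2 hℓ.le) (Ioo_subset_Icc_self hx) hx.1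
    rw [sol_zero hp] at this
    exact (force_pos hp (hv x (Ioo_subset_Icc_self hx)) (this.trans_le hδ)).le
  have hmid : ℓ / 2 ∈ Ioo 0 ℓ := ⟨by linarith, by linarith⟩
  have h1 := hmono (left_mem_Icc.2 hℓ.le) (Ioo_subset_Icc_self hmid) hmid.1.le
  rw [sol'_zero hp] at h1
  exact absurd h1 (not_le.2 (hs.deriv_neg_of_strictAntiOn hp hm hmid))

theorem lt_one_of_strictMonoOn (hp : 2 < p) (hℓ : 0 < ℓ) {δ : ℝ}
    (hm : StrictMonoOn (sol p δ 0) (Icc 0 ℓ)) : δ < 1 := by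
  by_contra! hδ
  have hs := isSol_sol hp δ 0
  have hmono : AntitoneOn (sol' p δ 0) (Icc 0 ℓ) := by
    refine antitoneOn_of_hasDerivWithinAt_nonpos (convex_Icc 0 ℓ) hs.continuous'.continuousOn
      (fun x _ => (hs x).2.hasDerivWithinAt) fun x hx => ?_
    rw [interior_Icc] at hx
    have := hm (left_mem_Icc.2 hℓ.le) (Ioo_subset_Icc_self hx) hx.1
    rw [sol_zero hp] at this
    exact (force_neg_of_one_lt hp (hδ.trans_lt this)).le
  have hmid : ℓ / 2 ∈ Ioo 0 ℓ := ⟨by linarith, by linarith⟩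
  have h1 := hmono (left_mem_Icc.2 hℓ.le) (Ioo_subset_Icc_self hmid) hmid.1.le
  rw [sol'_zero hp] at h1
  exact absurd h1 (not_le.2 (hs.deriv_pos_of_strictMonoOn hp hm hmid))

theorem sol_energy (hp : 2 < p) (δ t : ℝ) :
    sol' p δ 0 t ^ 2 = 2 * (pot p (sol p δ 0 t) - pot p δ) := by
  have := (isSol_sol hp δ 0).energy hp 0 t
  rw [sol_zero hp, sol'_zero hp] at this
  linarith

theorem timeIn_of_strictAntiOn (hp : 2 < p) (hℓ : 0 < ℓ) {δ c : ℝ} (hc : sol p δ 0 ℓ = c)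
    (hm : StrictAntiOn (sol p δ 0) (Icc 0 ℓ)) (hv : ∀ t ∈ Icc 0 ℓ, 0 < sol p δ 0 t) :
    timeIn p (pot p δ) (Ioi c) = ENNReal.ofReal ℓ := by
  have hs := isSol_sol hp δ 0
  have hδ := one_lt_of_strictAntiOn hp hℓ hm hv
  have hw : ∀ t ∈ Ioo 0 ℓ, sol' p δ 0 t ≠ 0 := fun t ht =>
    (hs.deriv_neg_of_strictAntiOn hp hm ht).ne
  rw [timeIn_inter hp _ measurableSet_Ioi]
  refine timeIn_eq (v := sol p δ 0) (w := sol' p δ 0) ?_ (fun t _ => (hs t).1)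
    (hm.injOn.mono Ioo_subset_Icc_self) hw (fun t _ => sol_energy hp δ t)
  ext x
  constructor
  · rintro ⟨t, ht, rfl⟩
    refine ⟨?_, ?_⟩
    · rw [← hc]
      exact hm (Ioo_subset_Icc_self ht) (right_mem_Icc.2 hℓ.le) ht.2
    · have h1 := sol_energy hp δ t
      have h2 := sq_pos_of_ne_zero (hw t ht)
      simp only [mem_ofPred_eq]
      linarith
  · rintro ⟨h1, h2⟩
    simp only [mem_Ioi, mem_ofPred_eq] at h1 h2
    have h3 : x < δ := by
      by_contra! h
      exact absurd h2 (not_lt.2 (pot_anti_high hp hδ.le h))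
    exact intermediate_value_Ioo' hℓ.le hs.continuous.continuousOn
      ⟨by rwa [hc], by rwa [sol_zero hp]⟩

theorem timeIn_of_strictMonoOn (hp : 2 < p) (hℓ : 0 < ℓ) {δ c : ℝ} (hc : sol p δ 0 ℓ = c)
    (hm : StrictMonoOn (sol p δ 0) (Icc 0 ℓ)) (hv : ∀ t ∈ Icc 0 ℓ, 0 < sol p δ 0 t) :
    timeIn p (pot p δ) (Ioo 0 c) = ENNReal.ofReal ℓ := by
  have hs := isSol_sol hp δ 0
  have hδ := lt_one_of_strictMonoOn hp hℓ hm
  have hw : ∀ t ∈ Ioo 0 ℓ, sol' p δ 0 t ≠ 0 := fun t ht =>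
    (hs.deriv_pos_of_strictMonoOn hp hm ht).ne'
  rw [timeIn_inter hp _ measurableSet_Ioo]
  refine timeIn_eq (v := sol p δ 0) (w := sol' p δ 0) ?_ (fun t _ => (hs t).1)
    (hm.injOn.mono Ioo_subset_Icc_self) hw (fun t _ => sol_energy hp δ t)
  ext x
  constructor
  · rintro ⟨t, ht, rfl⟩
    refine ⟨⟨hv t (Ioo_subset_Icc_self ht), ?_⟩, ?_⟩
    · rw [← hc]
      exact hm (Ioo_subset_Icc_self ht) (right_mem_Icc.2 hℓ.le) ht.2
    · have h1 := sol_energy hp δ t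
      have h2 := sq_pos_of_ne_zero (hw t ht)
      simp only [mem_ofPred_eq]
      linarith
  · rintro ⟨h1, h2⟩
    simp only [mem_ofPred_eq] at h2
    have h3 : δ < x := by
      by_contra! h
      exact absurd h2 (not_lt.2 (pot_mono_low hp h1.1.le h hδ.le))
    exact intermediate_value_Ioo hℓ.le hs.continuous.continuousOn
      ⟨by rwa [sol_zero hp], by rw [hc]; exact h1.2⟩

theorem sameOn_of_data (hp : 2 < p) {v : ForkFun P} {b b' δ : ℝ}
    (hu : SameOn ℓ u (fork p ℓ b fun _ => δ)) (hv : SameOn ℓ v (fork p ℓ b' fun _ => δ))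
    (h : hl p b 0 = hl p b' 0) (h' : hl' p b 0 = hl' p b' 0) : SameOn ℓ v u := by
  have := hl_eq_of_data hp h h'
  refine ⟨fun x hx => ?_, fun i x hx => ?_⟩
  · rw [hu.1 hx, hv.1 hx]
    simp only [fork, this]
  · rw [hu.2 i hx, hv.2 i hx]
    rfl

/-- The length `ℓ` determines `c` through the time map; `pot δ = θ pot c` then determines `δ` on the
branch above `1`; value and sign of the slope at the vertex determine the half-line part. -/
theorem IsIncSymPosBoundState.sameOn (hp : 2 < p) (hP : 2 ≤ P) (hℓ : 0 < ℓ) {v : ForkFun P}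
    (hu : IsIncSymPosBoundState p ℓ u) (hv : IsIncSymPosBoundState p ℓ v) : SameOn ℓ v u := by
  have key : ∀ u : ForkFun P, IsIncSymPosBoundState p ℓ u → ∃ b δ : ℝ,
      SameOn ℓ u (fork p ℓ b fun _ => δ) ∧ 1 < δ ∧ 0 < hl p b 0 ∧ hl p b 0 < peak p ∧
      pot p δ = (1 - 1 / (P : ℝ) ^ 2) * pot p (hl p b 0) ∧ hl' p b 0 ≤ 0 ∧
      timeIn p (pot p δ) (Ioi (hl p b 0)) = ENNReal.ofReal ℓ := fun u hu => by
    obtain ⟨b, δ, hm, hb, hvpos, hsame⟩ := exists_positive_data hp hP hℓ hu.1 hu.2.1 hu.2.2.1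
    have hanti := strictAntiOn_of_increasing hP hsame hu.2.2.2.1
    have hδ := one_lt_of_strictAntiOn hp hℓ hanti hvpos
    have hne := (hanti (left_mem_Icc.2 hℓ.le) (right_mem_Icc.2 hℓ.le) hℓ).ne
    rw [sol_zero hp] at hne
    have hpk := pot_vertex_pos hp hP hm hb (one_pos.trans hδ) hne
    obtain ⟨h1, h2⟩ := (Matching.symm_iff hP).1 hm
    refine ⟨b, δ, hsame, hδ, hl_pos hp hb 0, hpk.2, Matching.symm_energy hp hP hm, ?_,
      timeIn_of_strictAntiOn hp hℓ h1 hanti hvpos⟩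
    rw [h2]
    have hcl : ∀ t ∈ closure (Ioo 0 ℓ), sol' p δ 0 t ≤ 0 :=
      fun t ht => closure_minimal (fun s hs =>
        ((isSol_sol hp δ 0).deriv_neg_of_strictAntiOn hp hanti hs).le)
        (isClosed_le (isSol_sol hp δ 0).continuous' continuous_const) ht
    rw [closure_Ioo hℓ.ne] at hcl
    exact mul_nonpos_of_nonneg_of_nonpos (Nat.cast_nonneg _) (hcl ℓ (right_mem_Icc.2 hℓ.le))
  obtain ⟨b, δ, h1, h2, h3, h4, h5, h6, h7⟩ := key u hu
  obtain ⟨b', δ', k1, k2, k3, k4, k5, k6, k7⟩ := key v hv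
  have hc : hl p b 0 = hl p b' 0 := by
    rw [h5] at h7
    rw [k5] at k7
    rcases lt_trichotomy (hl p b 0) (hl p b' 0) with h | h | h
    · exact (timeIn_Ioi_injective hp (theta_pos hP) (theta_lt_one hP) h3 h k4 h7 k7).elim
    · exact h
    · exact (timeIn_Ioi_injective hp (theta_pos hP) (theta_lt_one hP) k3 h h4 k7 h7).elim
  have hδ : δ' = δ := (pot_strictAntiOn hp).injOn (mem_Ici.2 k2.le) (mem_Ici.2 h2.le)
    (by rw [h5, k5, hc])
  rw [hδ] at k1
  refine sameOn_of_data hp h1 k1 hc ?_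
  have e1 := hl'_sq hp b 0
  have e2 := hl'_sq hp b' 0
  rw [← hc, ← e1, sq_eq_sq_iff_abs_eq_abs, abs_of_nonpos h6, abs_of_nonpos k6] at e2
  linarith

theorem IsCoreDecSymPosBoundState.exists_data (hp : 2 < p) (hP : 2 ≤ P) (hℓ : 0 < ℓ)
    (hu : IsCoreDecSymPosBoundState p ℓ u) : ∃ b δ : ℝ,
      SameOn ℓ u (fork p ℓ b fun _ => δ) ∧ 0 < δ ∧ δ < 1 ∧ 0 < hl p b 0 ∧ hl p b 0 < peak p ∧
      pot p δ = (1 - 1 / (P : ℝ) ^ 2) * pot p (hl p b 0) ∧ 0 ≤ hl' p b 0 ∧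
      hl' p b 0 = P * sol' p δ 0 ℓ ∧
      timeIn p (pot p δ) (Ioo 0 (hl p b 0)) = ENNReal.ofReal ℓ ∧
      ∀ t ∈ Icc 0 ℓ, 0 < sol p δ 0 t := by
  obtain ⟨b, δ, hm, hb, hvpos, hsame⟩ := exists_positive_data hp hP hℓ hu.1 hu.2.1 hu.2.2.1
  have hmono := strictMonoOn_of_decreasing hP hsame hu.2.2.2
  have hδ := lt_one_of_strictMonoOn hp hℓ hmono
  have hδ0 := hvpos 0 (left_mem_Icc.2 hℓ.le)
  have hne := (hmono (left_mem_Icc.2 hℓ.le) (right_mem_Icc.2 hℓ.le) hℓ).ne'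
  rw [sol_zero hp] at hne hδ0
  have hpk := pot_vertex_pos hp hP hm hb hδ0 hne
  obtain ⟨h1, h2⟩ := (Matching.symm_iff hP).1 hm
  refine ⟨b, δ, hsame, hδ0, hδ, hl_pos hp hb 0, hpk.2, Matching.symm_energy hp hP hm, ?_, h2,
    timeIn_of_strictMonoOn hp hℓ h1 hmono hvpos, hvpos⟩
  rw [h2]
  have hcl : ∀ t ∈ closure (Ioo 0 ℓ), 0 ≤ sol' p δ 0 t :=
    fun t ht => closure_minimal (fun s hs =>
      ((isSol_sol hp δ 0).deriv_pos_of_strictMonoOn hp hmono hs).le)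
      (isClosed_le continuous_const (isSol_sol hp δ 0).continuous') ht
  rw [closure_Ioo hℓ.ne] at hcl
  exact mul_nonneg (Nat.cast_nonneg _) (hcl ℓ (right_mem_Icc.2 hℓ.le))

theorem IsCoreDecSymPosBoundState.sameOn (hp : 2 < p) (hP : 2 ≤ P) (hℓ : 0 < ℓ) {v : ForkFun P}
    (hu : IsCoreDecSymPosBoundState p ℓ u) (hv : IsCoreDecSymPosBoundState p ℓ v) :
    SameOn ℓ v u := by
  obtain ⟨b, δ, h1, h0, h2, h3, h4, h5, h6, -, h7, -⟩ :=
    IsCoreDecSymPosBoundState.exists_data hp hP hℓ hu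
  obtain ⟨b', δ', k1, k0, k2, k3, k4, k5, k6, -, k7, -⟩ :=
    IsCoreDecSymPosBoundState.exists_data hp hP hℓ hv
  have hc : hl p b 0 = hl p b' 0 := by
    rw [h5] at h7
    rw [k5] at k7
    rcases lt_trichotomy (hl p b 0) (hl p b' 0) with h | h | h
    · exact (timeIn_Ioo_injective hp (theta_pos hP) (theta_lt_one hP) h3 h k4 h7 k7).elim
    · exact h
    · exact (timeIn_Ioo_injective hp (theta_pos hP) (theta_lt_one hP) k3 h h4 k7 h7).elim
  have hδ : δ' = δ := (pot_strictMonoOn hp).injOn ⟨k0.le, k2.le⟩ ⟨h0.le, h2.le⟩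
    (by rw [h5, k5, hc])
  rw [hδ] at k1
  refine sameOn_of_data hp h1 k1 hc ?_
  have e1 := hl'_sq hp b 0
  have e2 := hl'_sq hp b' 0
  rw [← hc, ← e1, sq_eq_sq_iff_abs_eq_abs, abs_of_nonneg h6, abs_of_nonneg k6] at e2
  linarith

/-! ### The threshold for core-decreasing bound-states -/

/-- On `(0, 1)` this is `(1 - r)² < 1 - 2r/p` with `r = v^(p-2)`. It says that the `arsinh` clock
runs slower than time. -/
theorem force_lt_sqrt (hp : 2 < p) {v : ℝ} (hv : 0 < v) (hF : 0 < pot p v) :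
    force p v < √(2 * pot p v) := by
  rcases le_or_gt 1 v with h | h
  · refine lt_of_le_of_lt ?_ (Real.sqrt_pos.2 (by linarith))
    rcases h.eq_or_lt with rfl | h
    · rw [force_one]
    · exact (force_neg_of_one_lt hp h).le
  · refine Real.lt_sqrt_of_sq_lt ?_
    have hr := rpow_lt_one_of_lt_one hp hv h
    have hr0 := Real.rpow_pos_of_pos hv (p - 2)
    rw [force_of_pos hv, pot_of_pos hp hv]
    generalize v ^ (p - 2) = r at *
    have key : (1 - r) ^ 2 < 1 - 2 * (r / p) := by
      have : r / p < r / 2 := div_lt_div_of_pos_left hr0 two_pos hp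
      nlinarith
    have := mul_lt_mul_of_pos_left key (sq_pos_of_pos hv)
    linarith

/-- For the linear equation `v'' = v` one has `w = √(2e) sinh t` from the turning point, so this
quantity would be the time itself. -/
theorem hasDerivAt_arsinh_speed {v w : ℝ → ℝ} (h : IsSol p v w) {e : ℝ} (he : 0 < e)
    (hE : ∀ t, w t ^ 2 = 2 * (pot p (v t) - e)) (t : ℝ) :
    HasDerivAt (fun t => Real.arsinh (w t / √(2 * e)))
      (force p (v t) / √(2 * pot p (v t))) t := by
  refine (((h t).2.div_const _).arsinh).congr_deriv ?_
  have h1 := Real.sqrt_pos.2 (show 0 < 2 * e by linarith)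
  have h2 : 1 + (w t / √(2 * e)) ^ 2 = 2 * pot p (v t) / (2 * e) := by
    rw [div_pow, hE, Real.sq_sqrt (by linarith)]
    field_simp
    ring
  rw [h2, Real.sqrt_div' _ (by linarith)]
  have h3 : 0 < pot p (v t) := by nlinarith [hE t, sq_nonneg (w t)]
  have h4 := Real.sqrt_pos.2 (show 0 < 2 * pot p (v t) by linarith)
  simp only [smul_eq_mul]
  field_simp

/-- The pendant slope at the vertex in the units of the clock: the height cancels, so the threshold
depends on `P` only. -/
theorem speed_ratio (hP : 2 ≤ P) {F : ℝ} (hF : 0 < F) :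
    √(2 * F) / P / √(2 * ((1 - 1 / (P : ℝ) ^ 2) * F)) = 1 / √((P : ℝ) ^ 2 - 1) := by
  have hP' : (2 : ℝ) ≤ P := by exact_mod_cast hP
  have h1 : 0 < (P : ℝ) ^ 2 - 1 := by nlinarith
  have h2 : 2 * ((1 - 1 / (P : ℝ) ^ 2) * F) = 2 * F * (((P : ℝ) ^ 2 - 1) / P ^ 2) := by
    field_simp
  rw [h2, Real.sqrt_mul (x := 2 * F) (by linarith), Real.sqrt_div h1.le, Real.sqrt_sq (by linarith)]
  have h3 := Real.sqrt_pos.2 h1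
  have h4 := Real.sqrt_pos.2 (show 0 < 2 * F by linarith)
  field_simp

/-- Time minus clock is `0` at the tip and strictly increases, and at the vertex the clock shows the
threshold. -/
theorem IsCoreDecSymPosBoundState.threshold_lt (hp : 2 < p) (hP : 2 ≤ P) (hℓ : 0 < ℓ)
    (hu : IsCoreDecSymPosBoundState p ℓ u) : Real.arsinh (1 / √((P : ℝ) ^ 2 - 1)) < ℓ := by
  obtain ⟨b, δ, -, h0, h2, h3, h4, h5, h6, h7, -, hpos⟩ :=
    IsCoreDecSymPosBoundState.exists_data hp hP hℓ hu
  have hs := isSol_sol hp δ 0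
  have hF := pot_pos hp h3 h4
  have he : 0 < pot p δ := pot_pos hp h0 (h2.trans (one_lt_peak hp))
  have hD := hasDerivAt_arsinh_speed hs he (sol_energy hp δ)
  have hmono : StrictMonoOn (fun t => t - Real.arsinh (sol' p δ 0 t / √(2 * pot p δ)))
      (Icc 0 ℓ) := by
    refine strictMonoOn_of_hasDerivWithinAt_pos (convex_Icc 0 ℓ)
      (fun t _ => ((hasDerivAt_id t).sub (hD t)).continuousAt.continuousWithinAt)
      (fun t _ => ((hasDerivAt_id t).sub (hD t)).hasDerivWithinAt) fun t ht => ?_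
    have h8 := sol_energy hp δ t
    have h9 : 0 < pot p (sol p δ 0 t) := by nlinarith [sq_nonneg (sol' p δ 0 t)]
    rw [sub_pos, div_lt_one (Real.sqrt_pos.2 (by linarith))]
    exact force_lt_sqrt hp (hpos t (interior_subset ht)) h9
  have h10 := hmono (left_mem_Icc.2 hℓ.le) (right_mem_Icc.2 hℓ.le) hℓ
  simp only [sol'_zero hp, zero_div, Real.arsinh_zero, sub_zero] at h10
  have hP' : (0 : ℝ) < P := by exact_mod_cast (by omega : 0 < P)
  have h11 : sol' p δ 0 ℓ = √(2 * pot p (hl p b 0)) / P := by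
    rw [← hl'_sq hp, Real.sqrt_sq h6, h7]
    field_simp
  rw [h11, h5, speed_ratio hP hF] at h10
  linarith

end Fork

namespace Fork

open ForkFun

variable {p : ℝ} {P : ℕ} {ℓ : ℝ} {u : ForkFun P}

/-! ### Shooting -/

/-- The minimum of `G σ` over the compact interval is continuous in `σ`, so the intermediate value
theorem applies to it. -/
theorem exists_shooting {G : ℝ → ℝ → ℝ} (hG : Continuous (Function.uncurry G)) {α β : ℝ}
    (hℓ : 0 ≤ ℓ) (hα : ∀ t ∈ Icc 0 ℓ, 0 < G α t) (hβ : ∃ t ∈ Icc 0 ℓ, G β t < 0) :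
    ∃ σ ∈ uIcc α β, (∀ t ∈ Icc 0 ℓ, 0 ≤ G σ t) ∧ ∃ t ∈ Icc 0 ℓ, G σ t = 0 := by
  have hc : Continuous fun σ => sInf (G σ '' Icc 0 ℓ) := isCompact_Icc.continuous_sInf hG
  have hGc : ∀ σ, ContinuousOn (G σ) (Icc 0 ℓ) := fun σ =>
    (hG.comp (Continuous.prodMk_right σ)).continuousOn
  have hmem : ∀ σ, sInf (G σ '' Icc 0 ℓ) ∈ G σ '' Icc 0 ℓ := fun σ =>
    (isCompact_Icc.image_of_continuousOn (hGc σ)).sInf_mem ((nonempty_Icc.2 hℓ).image _)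
  have hle : ∀ σ, ∀ t ∈ Icc 0 ℓ, sInf (G σ '' Icc 0 ℓ) ≤ G σ t := fun σ t ht =>
    csInf_le (isCompact_Icc.image_of_continuousOn (hGc σ)).bddBelow (mem_image_of_mem _ ht)
  have h1 : 0 < sInf (G α '' Icc 0 ℓ) := by
    obtain ⟨t, ht, e⟩ := hmem α
    rw [← e]
    exact hα t ht
  have h2 : sInf (G β '' Icc 0 ℓ) < 0 := by
    obtain ⟨t, ht, h⟩ := hβ
    exact (hle β t ht).trans_lt h
  obtain ⟨σ, hσ, e⟩ := intermediate_value_uIcc hc.continuousOn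
    (show (0 : ℝ) ∈ uIcc (sInf (G α '' Icc 0 ℓ)) (sInf (G β '' Icc 0 ℓ)) from
      mem_uIcc.2 (Or.inr ⟨h2.le, h1.le⟩))
  refine ⟨σ, hσ, fun t ht => e ▸ hle σ t ht, ?_⟩
  obtain ⟨t, ht, h⟩ := hmem σ
  exact ⟨t, ht, h.trans e⟩

/-- A zero of the signed slope strictly between the ends is a minimum, hence an equilibrium point,
and the solution would be constant, against `z 0 ≠ 0`. So the slope can touch zero only at `ℓ`. The
factor `ε` treats rising and falling solutions at once. -/
theorem IsSol.tip (hp : 2 < p) {y z : ℝ → ℝ} (h : IsSol p y z) {ε : ℝ} (hε : ε ≠ 0)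
    (h0 : z 0 ≠ 0) (hnn : ∀ t ∈ Icc 0 ℓ, 0 ≤ ε * z t) (hz : ∃ t ∈ Icc 0 ℓ, z t = 0) :
    z ℓ = 0 ∧ ∀ t ∈ Ico 0 ℓ, 0 < ε * z t := by
  have key : ∀ t ∈ Ico 0 ℓ, 0 < ε * z t := fun t ht => by
    refine (hnn t (Ico_subset_Icc_self ht)).lt_of_ne fun e => ?_
    have hzt : z t = 0 := by
      rcases mul_eq_zero.1 e.symm with h | h
      · exact absurd h hε
      · exact h
    have ht0 : 0 < t := ht.1.lt_of_ne fun e => h0 (by rw [← e] at hzt; exact hzt)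
    have hmin : IsLocalMin (fun s => ε * z s) t := by
      filter_upwards [Ioo_mem_nhds ht0 ht.2] with s hs
      rw [← e]
      exact hnn s (Ioo_subset_Icc_self hs)
    have hf := hmin.hasDerivAt_eq_zero ((h t).2.const_mul ε)
    exact h0 (h.eq_const hp ((mul_eq_zero.1 hf).resolve_left hε) hzt 0).2
  refine ⟨?_, key⟩
  obtain ⟨t, ht, e⟩ := hz
  rcases ht.2.eq_or_lt with rfl | h'
  · exact e
  · have := key t ⟨ht.1, h'⟩
    rw [e, mul_zero] at this
    exact absurd this (lt_irrefl _)

theorem IsSol.reverse (hp : 2 < p) {y z : ℝ → ℝ} (h : IsSol p y z) (hz : z ℓ = 0) (t : ℝ) :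
    sol p (y ℓ) 0 t = y (ℓ - t) ∧ sol' p (y ℓ) 0 t = -z (ℓ - t) := by
  have := ((h.comp_add ℓ).comp_neg).eq_sol hp (a := y ℓ) (b := 0) (by simp) (by simp [hz])
  rw [← this.1, ← this.2]
  simp only
  rw [neg_add_eq_sub]
  exact ⟨rfl, rfl⟩

theorem hl_strictAntiOn (hp : 2 < p) {b : ℝ} (hb : 0 < b) (h : hl' p b 0 < 0) :
    StrictAntiOn (hl p b) (Ici 0) := by
  refine strictAntiOn_of_hasDerivWithinAt_neg (convex_Ici 0)
    (fun x _ => (hasDerivAt_hl hp b x).continuousAt.continuousWithinAt)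
    (fun x _ => (hasDerivAt_hl hp b x).hasDerivWithinAt) fun x hx => ?_
  have hx0 : (0 : ℝ) ≤ x := interior_subset hx
  rw [hl'_neg_iff hp hb] at h ⊢
  refine lt_of_le_of_lt ?_ h
  unfold rho
  gcongr _ * Real.exp ?_
  nlinarith

theorem neg_energy_of_kirchhoff (hP : 2 ≤ P) {c z : ℝ} (hF : 0 < pot p c)
    (hz : z ^ 2 = 2 * pot p c / P ^ 2) : z ^ 2 / 2 - pot p c < 0 := by
  have h := theta_pos hP
  have e : z ^ 2 / 2 - pot p c = -((1 - 1 / (P : ℝ) ^ 2) * pot p c) := by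
    rw [hz]
    ring
  rw [e]
  have := mul_pos h hF
  linarith

/-- The solution on a pendant, started at the vertex, with the initial slope dictated by a
half-line solution with value `c` and slope `-√(2 pot c)` (`ε = 1`) or `√(2 pot c)` (`ε = -1`). -/
def shot (p : ℝ) (P : ℕ) (ε c : ℝ) : ℝ → ℝ := sol p c (ε * (√(2 * pot p c) / P))

def shot' (p : ℝ) (P : ℕ) (ε c : ℝ) : ℝ → ℝ := sol' p c (ε * (√(2 * pot p c) / P))

theorem isSol_shot (hp : 2 < p) (ε c : ℝ) : IsSol p (shot p P ε c) (shot' p P ε c) :=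
  isSol_sol hp _ _

theorem continuous_shot' (hp : 2 < p) (ε : ℝ) :
    Continuous (Function.uncurry fun c t => ε * shot' p P ε c t) := by
  have h := (continuous_pot hp).comp (continuous_fst (X := ℝ) (Y := ℝ))
  exact continuous_const.mul (Continuous.sol' hp continuous_fst
    (continuous_const.mul ((continuous_const.mul h).sqrt.div_const _)) continuous_snd)

theorem shot_zero (hp : 2 < p) (ε c : ℝ) : shot p P ε c 0 = c := sol_zero hp _ _

theorem shot'_zero (hp : 2 < p) (ε c : ℝ) :
    shot' p P ε c 0 = ε * (√(2 * pot p c) / P) := sol'_zero hp _ _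

theorem shot_energy (hp : 2 < p) {ε c : ℝ} (hε : ε ^ 2 = 1) (hF : 0 ≤ pot p c) (t : ℝ) :
    shot' p P ε c t ^ 2 =
      2 * (pot p (shot p P ε c t) - (1 - 1 / (P : ℝ) ^ 2) * pot p c) := by
  have h := (isSol_shot (P := P) hp ε c).energy hp 0 t
  rw [shot_zero hp, shot'_zero hp, mul_pow, hε, one_mul, div_pow,
    Real.sq_sqrt (by linarith)] at h
  have : (1 - 1 / (P : ℝ) ^ 2) * pot p c = pot p c - 2 * pot p c / P ^ 2 / 2 := by ring
  rw [this]
  linarith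

theorem shot_pos (hp : 2 < p) (hP : 2 ≤ P) {ε c : ℝ} (hε : ε ^ 2 = 1) (hc : 0 < c)
    (hF : 0 < pot p c) (t : ℝ) : 0 < shot p P ε c t := by
  refine (isSol_shot hp ε c).pos_of_energy_neg hp (s := 0) ?_ (by rwa [shot_zero hp]) t
  have h := shot_energy (P := P) hp hε hF.le 0
  rw [shot_zero hp] at h ⊢
  refine neg_energy_of_kirchhoff hP hF ?_
  rw [h]
  ring

theorem exists_boundState_of_shot (hp : 2 < p) (hP : 2 ≤ P) (hℓ : 0 < ℓ) {ε c : ℝ}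
    (hε : ε ^ 2 = 1) (hc : 0 < c) (hc1 : c < peak p)
    (hnn : ∀ t ∈ Icc 0 ℓ, 0 ≤ ε * shot' p P ε c t) (hz : ∃ t ∈ Icc 0 ℓ, ε * shot' p P ε c t = 0) :
    ∃ b δ, 0 < b ∧ hl' p b 0 = -(ε * √(2 * pot p c)) ∧
      IsBoundState p ℓ (fork p ℓ b fun _ : Fin P => δ) ∧
      IsPositive ℓ (fork p ℓ b fun _ : Fin P => δ) ∧
      (∀ t, sol p δ 0 (ℓ - t) = shot p P ε c t) ∧ ∀ t ∈ Ico 0 ℓ, 0 < ε * shot' p P ε c t := by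
  have hF := pot_pos hp hc hc1
  have hε0 : ε ≠ 0 := by
    rintro rfl
    norm_num at hε
  have hP0 : (0 : ℝ) < P := by exact_mod_cast (by omega : 0 < P)
  have hs := isSol_shot (P := P) hp ε c
  have h00 : shot' p P ε c 0 ≠ 0 := by
    rw [shot'_zero hp]
    have := Real.sqrt_pos.2 (show 0 < 2 * pot p c by linarith)
    positivity
  obtain ⟨h1, h2⟩ := hs.tip hp hε0 h00 hnn
    (hz.imp fun t h => ⟨h.1, (mul_eq_zero.1 h.2).resolve_left hε0⟩)
  have hrev := hs.reverse hp h1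
  obtain ⟨b, hb, hb'⟩ := exists_hl_data hp (c := c) (w := -(ε * √(2 * pot p c))) (by
    rw [neg_sq, mul_pow, hε, Real.sq_sqrt (by linarith), one_mul])
  have hb0 : 0 < b := pos_of_hl_pos hp (x := 0) (hb ▸ hc)
  have hm : Matching p ℓ b (fun _ : Fin P => shot p P ε c ℓ) := by
    rw [Matching.symm_iff hP, (hrev ℓ).1, (hrev ℓ).2, sub_self, shot_zero hp, shot'_zero hp, hb,
      hb']
    refine ⟨rfl, ?_⟩
    field_simp
  have hrev' : ∀ t, sol p (shot p P ε c ℓ) 0 (ℓ - t) = shot p P ε c t := fun t => by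
    rw [(hrev _).1, sub_sub_cancel]
  refine ⟨b, shot p P ε c ℓ, hb0, hb', isBoundState_fork hp hℓ.le hm (Or.inl hb0.ne'),
    ⟨fun x _ => hl_pos hp hb0 x, fun i x _ => ?_⟩, hrev', h2⟩
  simp only [fork, hrev']
  exact shot_pos hp hP hε hc hF x

theorem sqrt_two_pot_le (hp : 2 < p) {c : ℝ} (hc : 0 ≤ c) : √(2 * pot p c) ≤ c := by
  rw [Real.sqrt_le_iff]
  exact ⟨hc, by linarith [pot_le_sq hp c]⟩

theorem shot_strictMonoOn (hp : 2 < p) {c : ℝ} (h : ∀ t ∈ Ico 0 ℓ, 0 < 1 * shot' p P 1 c t) :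
    StrictMonoOn (shot p P 1 c) (Icc 0 ℓ) := by
  refine strictMonoOn_of_hasDerivWithinAt_pos (convex_Icc 0 ℓ)
    (isSol_shot hp 1 c).continuous.continuousOn
    (fun x _ => (isSol_shot hp 1 c x).1.hasDerivWithinAt) fun x hx => ?_
  rw [interior_Icc] at hx
  simpa using h x (Ioo_subset_Ico_self hx)

theorem shot_strictAntiOn (hp : 2 < p) {c : ℝ} (h : ∀ t ∈ Ico 0 ℓ, 0 < -1 * shot' p P (-1) c t) :
    StrictAntiOn (shot p P (-1) c) (Icc 0 ℓ) := by
  refine strictAntiOn_of_hasDerivWithinAt_neg (convex_Icc 0 ℓ)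
    (isSol_shot hp (-1) c).continuous.continuousOn
    (fun x _ => (isSol_shot hp (-1) c x).1.hasDerivWithinAt) fun x hx => ?_
  rw [interior_Icc] at hx
  linarith [h x (Ioo_subset_Ico_self hx)]

/-- Shots from a low vertex stay low. -/
theorem exists_shot_le (hp : 2 < p) (hP : 2 ≤ P) (ℓ : ℝ) {ε : ℝ} (hε : ε ^ 2 = 1) :
    ∃ L : ℝ, 0 < L ∧ ∀ c, 0 ≤ c → c ≤ 1 → ∀ t ∈ Icc 0 ℓ, |shot p P ε c t| ≤ L * c := by
  obtain ⟨L, hL, h⟩ := sol_dist_le hp 1 ℓ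
  have hP1 : (1 : ℝ) ≤ P := by exact_mod_cast (by omega : 1 ≤ P)
  refine ⟨L, hL, fun c hc hc1 t ht => ?_⟩
  have hz : |ε * (√(2 * pot p c) / P)| ≤ c := by
    have hε1 : |ε| = 1 := by rw [← abs_one, ← sq_eq_sq_iff_abs_eq_abs, hε, one_pow]
    rw [abs_mul, hε1, one_mul, abs_of_nonneg (by positivity)]
    exact (div_le_self (Real.sqrt_nonneg _) hP1).trans (sqrt_two_pot_le hp hc)
  have := (h c (ε * (√(2 * pot p c) / P)) 0 0 (by rwa [abs_of_nonneg hc]) (hz.trans hc1)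
    (by simp) (by simp) t (by rw [abs_of_nonneg ht.1]; exact ht.2)).1
  rw [(sol_equilibrium hp force_zero t).1, sub_zero, sub_zero, sub_zero, abs_of_nonneg hc,
    max_eq_left hz] at this
  exact this

/-- Kirchhoff's slope vanishes at the peak, and a solution starting there at rest is pushed down at
once. -/
theorem exists_shot'_peak_neg (hp : 2 < p) (hℓ : 0 < ℓ) :
    ∃ t ∈ Icc 0 ℓ, shot' p P 1 (peak p) t < 0 := by
  by_contra! hcon
  have hs := isSol_shot (P := P) hp 1 (peak p)
  have h0 := shot'_zero (P := P) hp 1 (peak p)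
  rw [pot_peak hp, mul_zero, Real.sqrt_zero, zero_div, mul_zero] at h0
  have hmono : MonotoneOn (shot p P 1 (peak p)) (Icc 0 ℓ) :=
    monotoneOn_of_hasDerivWithinAt_nonneg (convex_Icc 0 ℓ) hs.continuous.continuousOn
      (fun x _ => (hs x).1.hasDerivWithinAt) fun x hx => hcon x (interior_subset hx)
  have hanti : StrictAntiOn (shot' p P 1 (peak p)) (Icc 0 ℓ) := by
    refine strictAntiOn_of_hasDerivWithinAt_neg (convex_Icc 0 ℓ) hs.continuous'.continuousOn
      (fun x _ => (hs x).2.hasDerivWithinAt) fun x hx => ?_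
    have hx' := interior_subset hx
    have := hmono (left_mem_Icc.2 hℓ.le) hx' hx'.1
    rw [shot_zero hp] at this
    exact force_neg_of_one_lt hp ((one_lt_peak hp).trans_le this)
  have h1 := hanti (left_mem_Icc.2 hℓ.le) (right_mem_Icc.2 hℓ.le) hℓ
  have h2 := hcon ℓ (right_mem_Icc.2 hℓ.le)
  rw [h0] at h1
  linarith

theorem exists_isIncSymPosBoundState (hp : 2 < p) (hP : 2 ≤ P) (hℓ : 0 < ℓ) :
    ∃ u : ForkFun P, IsIncSymPosBoundState p ℓ u := by
  have hP0 : (0 : ℝ) < P := by exact_mod_cast (by omega : 0 < P)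
  obtain ⟨L, hL, hLc⟩ := exists_shot_le hp hP ℓ (one_pow 2)
  -- Makes `L * α ≤ 1/2`: the shot from `α` stays below `1`, where the force is positive, so its
  -- slope grows from a positive value.
  set α := min (1 / 2) (1 / (2 * L)) with hα
  have hα0 : 0 < α := by positivity
  have hα1 : α ≤ 1 / 2 := min_le_left _ _
  have hαL : L * α ≤ 1 / 2 := by
    calc L * α ≤ L * (1 / (2 * L)) := by gcongr; exact min_le_right _ _
      _ = 1 / 2 := by field_simp
  have hpk := one_lt_peak hp
  have hFα := pot_pos hp hα0 (by linarith)
  have hlow : ∀ t ∈ Icc 0 ℓ, 0 < 1 * shot' p P 1 α t := fun t ht => by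
    have hs := isSol_shot (P := P) hp 1 α
    have hpos := shot_pos hp hP (one_pow 2) hα0 hFα
    have hmono : MonotoneOn (shot' p P 1 α) (Icc 0 ℓ) := by
      refine monotoneOn_of_hasDerivWithinAt_nonneg (convex_Icc 0 ℓ) hs.continuous'.continuousOn
        (fun x _ => (hs x).2.hasDerivWithinAt) fun x hx => ?_
      have h1 := hLc α hα0.le (by linarith) x (interior_subset hx)
      rw [abs_of_pos (hpos x)] at h1
      exact (force_pos hp (hpos x) (by linarith)).le
    have h1 := hmono (left_mem_Icc.2 hℓ.le) ht ht.1
    rw [shot'_zero hp] at h1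
    have := Real.sqrt_pos.2 (show 0 < 2 * pot p α by linarith)
    have : 0 < 1 * (√(2 * pot p α) / P) := by positivity
    linarith
  have hhigh : ∃ t ∈ Icc 0 ℓ, 1 * shot' p P 1 (peak p) t < 0 := by
    simpa using exists_shot'_peak_neg (P := P) hp hℓ
  obtain ⟨σ, hσ, hnn, hz⟩ := exists_shooting (continuous_shot' (P := P) hp 1) hℓ.le hlow hhigh
  rw [uIcc_of_le (by linarith)] at hσ
  have hσ1 : σ < peak p := by
    refine hσ.2.lt_of_ne fun e => ?_
    obtain ⟨t, ht, h⟩ := exists_shot'_peak_neg (P := P) hp hℓ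
    rw [e] at hnn
    linarith [hnn t ht]
  obtain ⟨b, δ, hb, hb', h1, h2, h3, h4⟩ := exists_boundState_of_shot hp hP hℓ (one_pow 2)
    (hα0.trans_le hσ.1) hσ1 hnn hz
  refine ⟨_, h1, h2, fun i j x _ => rfl, fun i => ?_, ?_⟩
  · refine (shot_strictMonoOn hp h4).congr fun x _ => ?_
    simp only [fork, h3]
  · have := Real.sqrt_pos.2 (show 0 < 2 * pot p σ by
      linarith [pot_pos hp (hα0.trans_le hσ.1) hσ1])
    exact hl_strictAntiOn hp hb (by rw [hb']; linarith)

/-- From a low vertex the clock starts at minus the threshold and, while the shot descends, runs at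
speed at least `1 - c^(p-2)`. For small `c` it would pass `0` before time `ℓ`, so the slope must
change sign. -/
theorem exists_low_shot (hp : 2 < p) (hP : 2 ≤ P)
    (hℓ : Real.arsinh (1 / √((P : ℝ) ^ 2 - 1)) < ℓ) :
    ∃ c, 0 < c ∧ c < 1 ∧ ∃ t ∈ Icc 0 ℓ, -1 * shot' p P (-1) c t < 0 := by
  have hε : (-1 : ℝ) ^ 2 = 1 := by norm_num
  have hθ := theta_pos hP
  have ha : 0 ≤ Real.arsinh (1 / √((P : ℝ) ^ 2 - 1)) := Real.arsinh_nonneg_iff.2 (by positivity)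
  set a := Real.arsinh (1 / √((P : ℝ) ^ 2 - 1)) with haa
  have hℓ0 : 0 < ℓ := ha.trans_lt hℓ
  obtain ⟨c, hc0, hc1, hc⟩ : ∃ c : ℝ, 0 < c ∧ c < 1 ∧ a < (1 - c ^ (p - 2)) * ℓ := by
    have h1 : Tendsto (fun c : ℝ => (1 - c ^ (p - 2)) * ℓ) (𝓝[>] 0) (𝓝 ((1 - 0) * ℓ)) := by
      refine ((tendsto_const_nhds.sub ?_).mul_const _)
      have := (continuous_rpow_sub_two hp).tendsto 0
      rw [Real.zero_rpow (by linarith)] at this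
      exact this.mono_left nhdsWithin_le_nhds
    have h2 := h1.eventually_const_lt (show a < (1 - 0) * ℓ by linarith)
    have h3 : ∀ᶠ c : ℝ in 𝓝[>] 0, c ∈ Ioo (0 : ℝ) 1 := Ioo_mem_nhdsGT one_pos
    obtain ⟨c, hc, hc'⟩ := (h2.and h3).exists
    exact ⟨c, hc'.1, hc'.2, hc⟩
  refine ⟨c, hc0, hc1, ?_⟩
  by_contra! hcon
  have hF := pot_pos hp hc0 (hc1.trans (one_lt_peak hp))
  have hs := isSol_shot (P := P) hp (-1) c
  have hpos := shot_pos hp hP hε hc0 hF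
  have hanti : AntitoneOn (shot p P (-1) c) (Icc 0 ℓ) :=
    antitoneOn_of_hasDerivWithinAt_nonpos (convex_Icc 0 ℓ) hs.continuous.continuousOn
      (fun x _ => (hs x).1.hasDerivWithinAt) fun x hx => by
        linarith [hcon x (interior_subset hx)]
  have hle : ∀ t ∈ Icc 0 ℓ, shot p P (-1) c t ≤ c := fun t ht => by
    have := hanti (left_mem_Icc.2 hℓ0.le) ht ht.1
    rwa [shot_zero hp] at this
  set e := (1 - 1 / (P : ℝ) ^ 2) * pot p c with he
  have he0 : 0 < e := mul_pos hθ hF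
  have hE := shot_energy (P := P) hp hε hF.le
  have hD := hasDerivAt_arsinh_speed hs he0 hE
  have hmono : MonotoneOn (fun t => Real.arsinh (shot' p P (-1) c t / √(2 * e)) -
      (1 - c ^ (p - 2)) * t) (Icc 0 ℓ) := by
    refine monotoneOn_of_hasDerivWithinAt_nonneg (convex_Icc 0 ℓ)
      (fun t _ => ((hD t).sub ((hasDerivAt_id t).const_mul _)).continuousAt.continuousWithinAt)
      (fun t _ => ((hD t).sub ((hasDerivAt_id t).const_mul _)).hasDerivWithinAt) fun t ht => ?_
    have h1 := hle t (interior_subset ht)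
    have h2 := hpos t
    have h3 : 0 < pot p (shot p P (-1) c t) :=
      pot_pos hp h2 ((h1.trans_lt hc1).trans (one_lt_peak hp))
    rw [mul_one, sub_nonneg, le_div_iff₀ (Real.sqrt_pos.2 (by linarith)), force_of_pos h2,
      mul_comm _ (1 - _)]
    have h4 : shot p P (-1) c t ^ (p - 2) ≤ c ^ (p - 2) :=
      Real.rpow_le_rpow h2.le h1 (by linarith)
    have h5 := rpow_lt_one_of_lt_one hp hc0 hc1
    exact mul_le_mul (by linarith) (sqrt_two_pot_le hp h2.le) (Real.sqrt_nonneg _) (by linarith)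
  have h1 := hmono (left_mem_Icc.2 hℓ0.le) (right_mem_Icc.2 hℓ0.le) hℓ0.le
  have h2 : Real.arsinh (shot' p P (-1) c 0 / √(2 * e)) = -a := by
    rw [shot'_zero hp, haa, ← speed_ratio hP hF, ← Real.arsinh_neg, neg_one_mul, neg_div]
  have h3 : Real.arsinh (shot' p P (-1) c ℓ / √(2 * e)) ≤ 0 := by
    rw [Real.arsinh_nonpos_iff]
    exact div_nonpos_of_nonpos_of_nonneg (by linarith [hcon ℓ (right_mem_Icc.2 hℓ0.le)])
      (Real.sqrt_nonneg _)
  simp only [h2, mul_zero, sub_zero] at h1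
  linarith

/-- The shot from the peak is the soliton, bounded below by some `m > 0` on `[0, ℓ]`, and so are
nearby shots. At a turning point the potential would be below `pot c < pot m`, impossible at heights
between `m` and `c`. -/
theorem exists_high_shot (hp : 2 < p) (hP : 2 ≤ P) (hℓ : 0 < ℓ) :
    ∃ c, 0 < c ∧ c < peak p ∧ ∀ t ∈ Icc 0 ℓ, 0 < -1 * shot' p P (-1) c t := by
  have hε : (-1 : ℝ) ^ 2 = 1 := by norm_num
  have hpk := one_lt_peak hp
  have hP0 : (0 : ℝ) < P := by exact_mod_cast (by omega : 0 < P)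
  have hsc : Continuous fun z : ℝ × ℝ => shot p P (-1) z.1 z.2 := by
    have h := (continuous_pot hp).comp (continuous_fst (X := ℝ) (Y := ℝ))
    exact Continuous.sol hp continuous_fst
      (continuous_const.mul ((continuous_const.mul h).sqrt.div_const _)) continuous_snd
  have hpeak : ∀ t, 0 < shot p P (-1) (peak p) t := fun t => by
    obtain ⟨b, hb, hb'⟩ := exists_hl_data hp (c := peak p) (w := 0) (by rw [pot_peak hp]; norm_num)
    have h0 := shot'_zero (P := P) hp (-1) (peak p)
    rw [pot_peak hp, mul_zero, Real.sqrt_zero, zero_div, mul_zero] at h0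
    have := ((isSol_shot (P := P) hp (-1) (peak p)).unique hp (isSol_hl hp b)
      (by rw [shot_zero hp, hb]) (by rw [h0, hb'])).1
    rw [this]
    exact hl_pos hp (pos_of_hl_pos hp (x := 0) (by rw [hb]; linarith)) t
  obtain ⟨m, hm0, hm1, hm⟩ : ∃ m : ℝ, 0 < m ∧ m < 1 ∧
      ∀ t ∈ Icc 0 ℓ, m < shot p P (-1) (peak p) t := by
    obtain ⟨x, -, hx⟩ := (isCompact_Icc (a := (0 : ℝ)) (b := ℓ)).exists_isMinOn
      (nonempty_Icc.2 hℓ.le) (isSol_shot (P := P) hp (-1) (peak p)).continuous.continuousOn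
    refine ⟨min (1 / 2) (shot p P (-1) (peak p) x / 2),
      lt_min (by norm_num) (half_pos (hpeak x)), (min_le_left _ _).trans_lt (by norm_num),
      fun t ht => (min_le_right _ _).trans_lt ?_⟩
    have := isMinOn_iff.1 hx t ht
    have := hpeak x
    linarith
  have hev : ∀ᶠ c in 𝓝 (peak p), ∀ t ∈ Icc 0 ℓ, m < shot p P (-1) c t := by
    refine isCompact_Icc.eventually_forall_of_forall_eventually fun t ht => ?_
    exact (hsc.tendsto (peak p, t)).eventually_const_lt (hm t ht)
  have hev2 : ∀ᶠ c in 𝓝 (peak p), pot p c < pot p m := by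
    refine ((continuous_pot hp).tendsto (peak p)).eventually_lt_const ?_
    rw [pot_peak hp]
    exact pot_pos hp hm0 (hm1.trans hpk)
  have hev3 : ∀ᶠ c in 𝓝[<] (peak p), c ∈ Ioo 1 (peak p) := Ioo_mem_nhdsLT hpk
  obtain ⟨c, ⟨hc1, hc2⟩, hc3⟩ :=
    ((hev.and hev2).filter_mono nhdsWithin_le_nhds |>.and hev3).exists
  have hc0 : 0 < c := one_pos.trans hc3.1
  refine ⟨c, hc0, hc3.2, ?_⟩
  have hF := pot_pos hp hc0 hc3.2
  have hs := isSol_shot (P := P) hp (-1) c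
  by_contra! hcon
  obtain ⟨t, ht, hzt, hlt⟩ := exists_first_zero (T := ℓ)
    (g := fun t => -1 * shot' p P (-1) c t) (continuous_const.mul hs.continuous').continuousOn (by
      rw [shot'_zero hp]
      have := Real.sqrt_pos.2 (show 0 < 2 * pot p c by linarith)
      have : 0 < √(2 * pot p c) / P := by positivity
      linarith) hcon
  have hanti : AntitoneOn (shot p P (-1) c) (Icc 0 t) := by
    refine antitoneOn_of_hasDerivWithinAt_nonpos (convex_Icc 0 t) hs.continuous.continuousOn
      (fun x _ => (hs x).1.hasDerivWithinAt) fun x hx => ?_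
    rw [interior_Icc] at hx
    have := hlt x (Ioo_subset_Ico_self hx)
    linarith
  have h1 := hanti (left_mem_Icc.2 ht.1.le) (right_mem_Icc.2 ht.1.le) ht.1.le
  rw [shot_zero hp] at h1
  have h2 := shot_energy (P := P) hp hε hF.le t
  have hz0 : shot' p P (-1) c t = 0 := by simpa using hzt
  rw [hz0] at h2
  have h3 : pot p (shot p P (-1) c t) < pot p c := by
    have := mul_lt_mul_of_pos_right (theta_lt_one hP) hF
    linarith
  have h4 := hc1 t (Ioc_subset_Icc_self ht)
  rcases le_or_gt 1 (shot p P (-1) c t) with h | h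
  · exact absurd h3 (not_lt.2 (pot_anti_high hp h h1))
  · have := pot_mono_low hp hm0.le h4.le h.le
    linarith

theorem exists_isCoreDecSymPosBoundState (hp : 2 < p) (hP : 2 ≤ P)
    (hℓ : Real.arsinh (1 / √((P : ℝ) ^ 2 - 1)) < ℓ) :
    ∃ u : ForkFun P, IsCoreDecSymPosBoundState p ℓ u := by
  have ha : 0 ≤ Real.arsinh (1 / √((P : ℝ) ^ 2 - 1)) := Real.arsinh_nonneg_iff.2 (by positivity)
  have hℓ0 : 0 < ℓ := ha.trans_lt hℓ
  have hε : (-1 : ℝ) ^ 2 = 1 := by norm_num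
  obtain ⟨β, hβ0, hβ1, hβ⟩ := exists_low_shot hp hP hℓ
  obtain ⟨α, hα0, hα1, hα⟩ := exists_high_shot (P := P) hp hP hℓ0
  obtain ⟨σ, hσ, hnn, hz⟩ := exists_shooting (continuous_shot' (P := P) hp (-1)) hℓ0.le hα hβ
  have hσ0 : 0 < σ ∧ σ < peak p := by
    have hβ2 := hβ1.trans (one_lt_peak hp)
    rcases mem_uIcc.1 hσ with h | h
    · exact ⟨hα0.trans_le h.1, h.2.trans_lt hβ2⟩
    · exact ⟨hβ0.trans_le h.1, h.2.trans_lt hα1⟩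
  obtain ⟨b, δ, hb, hb', h1, h2, h3, h4⟩ := exists_boundState_of_shot hp hP hℓ0 hε
    hσ0.1 hσ0.2 hnn hz
  refine ⟨_, h1, h2, fun i j x _ => rfl, fun i => ?_⟩
  refine (shot_strictAntiOn hp h4).congr fun x _ => ?_
  simp only [fork, h3]

end Fork

namespace Fork

open ForkFun

variable {p : ℝ} {P : ℕ} {ℓ : ℝ} {u : ForkFun P}

/-! ### The action of a bound-state -/

theorem integral_Icc_comp_sub (hℓ : 0 ≤ ℓ) (g : ℝ → ℝ) :
    ∫ x in Icc 0 ℓ, g (ℓ - x) = ∫ t in 0..ℓ, g t := by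
  rw [integral_Icc_eq_integral_Ioc, ← intervalIntegral.integral_of_le hℓ,
    intervalIntegral.integral_comp_sub_left, sub_self, sub_zero]

theorem integrableOn_Ici_of_abs_le_exp {f : ℝ → ℝ} (hf : Continuous f) {C c : ℝ} (hc : 0 < c)
    (hC : ∀ x, |f x| ≤ C * Real.exp (-c * x)) : IntegrableOn f (Ici 0) :=
  Integrable.mono' ((integrableOn_exp_neg_Ici hc).const_mul C) hf.aestronglyMeasurable
    (ae_of_all _ hC)

theorem exists_abs_hl_le (hp : 2 < p) (b : ℝ) :
    ∃ C, 0 ≤ C ∧ ∀ x, |hl p b x| ≤ C * Real.exp (-x) := by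
  refine ⟨(2 * p) ^ (1 / (p - 2)) * |b|, ?_, abs_hl_le hp b⟩
  have : 0 < 2 * p := by linarith
  positivity

theorem continuous_hl (hp : 2 < p) (b : ℝ) : Continuous (hl p b) := (isSol_hl hp b).continuous

theorem continuous_hl' (hp : 2 < p) (b : ℝ) : Continuous (hl' p b) := (isSol_hl hp b).continuous'

theorem sq_le_exp {y C x : ℝ} (h : |y| ≤ C * Real.exp (-x)) :
    |y ^ 2| ≤ C ^ 2 * Real.exp (-2 * x) := by
  rw [abs_pow]
  calc |y| ^ 2 ≤ (C * Real.exp (-x)) ^ 2 := by gcongr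
    _ = C ^ 2 * Real.exp (-2 * x) := by
      rw [mul_pow, ← Real.exp_nat_mul]
      congr 2
      push_cast
      ring

theorem integrableOn_hl_sq (hp : 2 < p) (b : ℝ) :
    IntegrableOn (fun x => hl p b x ^ 2) (Ici 0) := by
  obtain ⟨C, -, hC⟩ := exists_abs_hl_le hp b
  exact integrableOn_Ici_of_abs_le_exp ((continuous_hl hp b).pow 2) two_pos
    fun x => sq_le_exp (hC x)

theorem integrableOn_hl'_sq (hp : 2 < p) (b : ℝ) :
    IntegrableOn (fun x => hl' p b x ^ 2) (Ici 0) := by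
  obtain ⟨C, -, hC⟩ := exists_abs_hl_le hp b
  exact integrableOn_Ici_of_abs_le_exp ((continuous_hl' hp b).pow 2) two_pos
    fun x => sq_le_exp ((abs_hl'_le b x).trans (hC x))

theorem continuous_abs_rpow (hp : 2 < p) : Continuous fun x : ℝ => |x| ^ p :=
  continuous_abs.rpow_const fun _ => Or.inr (by linarith)

theorem abs_hl_rpow_le (hp : 2 < p) {b B : ℝ} (hb : |b| ≤ B) (x : ℝ) :
    |hl p b x| ^ p ≤ ((2 * p) ^ (1 / (p - 2)) * B) ^ p * Real.exp (-p * x) := by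
  have h2p : 0 < 2 * p := by linarith
  have hB := (abs_nonneg b).trans hb
  calc |hl p b x| ^ p ≤ ((2 * p) ^ (1 / (p - 2)) * B * Real.exp (-x)) ^ p := by
        refine Real.rpow_le_rpow (abs_nonneg _) ((abs_hl_le hp b x).trans ?_) (by linarith)
        gcongr
    _ = _ := by
        rw [Real.mul_rpow (by positivity) (Real.exp_pos _).le, ← Real.exp_mul]
        ring_nf

theorem integrableOn_hl_rpow (hp : 2 < p) (b : ℝ) :
    IntegrableOn (fun x => |hl p b x| ^ p) (Ici 0) := by
  refine integrableOn_Ici_of_abs_le_exp ((continuous_abs_rpow hp).comp (continuous_hl hp b))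
    (C := ((2 * p) ^ (1 / (p - 2)) * |b|) ^ p) (by linarith : (0 : ℝ) < p) fun x => ?_
  rw [abs_of_nonneg (by positivity)]
  exact abs_hl_rpow_le hp le_rfl x

/-- The action of `hl p b`. -/
def halfLineAction (p b : ℝ) : ℝ := ∫ x in Ici 0, (hl' p b x ^ 2 / 2 + pot p (hl p b x))

/-- The action of `sol p d 0` on `[0, ℓ]`. -/
def pendantAction (p ℓ d : ℝ) : ℝ := ∫ t in 0..ℓ, (sol' p d 0 t ^ 2 / 2 + pot p (sol p d 0 t))

def halfLineMass (p b : ℝ) : ℝ := ∫ x in Ici 0, |hl p b x| ^ p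

def pendantMass (p ℓ d : ℝ) : ℝ := ∫ t in 0..ℓ, |sol p d 0 t| ^ p

theorem continuous_sol (hp : 2 < p) (a b : ℝ) : Continuous (sol p a b) :=
  (isSol_sol hp a b).continuous

theorem continuous_sol' (hp : 2 < p) (a b : ℝ) : Continuous (sol' p a b) :=
  (isSol_sol hp a b).continuous'

theorem action_fork (hp : 2 < p) (hℓ : 0 ≤ ℓ) (b : ℝ) (d : Fin P → ℝ) :
    action p ℓ (fork p ℓ b d) = halfLineAction p b + ∑ i, pendantAction p ℓ (d i) := by
  have h1 : halfLineAction p b = (1 / 2) * (∫ x in Ici (0 : ℝ),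
      (deriv (hl p b) x ^ 2 + hl p b x ^ 2)) - (1 / p) * ∫ x in Ici (0 : ℝ), |hl p b x| ^ p := by
    rw [← integral_const_mul, ← integral_const_mul, ← integral_sub]
    · refine integral_congr_ae (ae_of_all _ fun x => ?_)
      simp only [(hasDerivAt_hl hp b x).deriv, pot]
      ring
    · refine ((integrableOn_hl'_sq hp b).add (integrableOn_hl_sq hp b)).const_mul (1 / 2) |>.congr
        (ae_of_all _ fun x => ?_)
      simp only [(hasDerivAt_hl hp b x).deriv, Pi.add_apply]
    · exact (integrableOn_hl_rpow hp b).const_mul _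
  have h2 : ∀ i, pendantAction p ℓ (d i) = (1 / 2) * (∫ x in Icc 0 ℓ,
      (deriv (fun x => sol p (d i) 0 (ℓ - x)) x ^ 2 + sol p (d i) 0 (ℓ - x) ^ 2)) -
      (1 / p) * ∫ x in Icc 0 ℓ, |sol p (d i) 0 (ℓ - x)| ^ p := fun i => by
    have hv := continuous_sol hp (d i) 0
    have hw := continuous_sol' hp (d i) 0
    have e : ∀ x, deriv (fun x => sol p (d i) 0 (ℓ - x)) x ^ 2 + sol p (d i) 0 (ℓ - x) ^ 2 =
        (fun t => sol' p (d i) 0 t ^ 2 + sol p (d i) 0 t ^ 2) (ℓ - x) := fun x => by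
      rw [(hasDerivAt_pendant hp (d i) x).1.deriv, neg_sq]
    simp only [e]
    rw [integral_Icc_comp_sub hℓ (fun t => sol' p (d i) 0 t ^ 2 + sol p (d i) 0 t ^ 2),
      integral_Icc_comp_sub hℓ (fun t => |sol p (d i) 0 t| ^ p),
      ← intervalIntegral.integral_const_mul, ← intervalIntegral.integral_const_mul,
      ← intervalIntegral.integral_sub]
    · refine intervalIntegral.integral_congr fun x _ => ?_
      simp only [pot]
      ring
    · exact (continuous_const.mul ((hw.pow 2).add (hv.pow 2))).intervalIntegrable _ _
    · exact (continuous_const.mul ((continuous_abs_rpow hp).comp hv)).intervalIntegrable _ _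
  simp only [action, fork, h1, h2, Finset.sum_sub_distrib, ← Finset.mul_sum]
  ring

/-- Integrate `(v w)' = w² + v * force v` over the pendant. -/
theorem pendantAction_eq (hp : 2 < p) (d : ℝ) : pendantAction p ℓ d =
    (1 / 2 - 1 / p) * pendantMass p ℓ d + sol' p d 0 ℓ * sol p d 0 ℓ / 2 := by
  have hs := isSol_sol hp d 0
  have hv := hs.continuous
  have hw := hs.continuous'
  have hN : IntervalIntegrable (fun t => |sol p d 0 t| ^ p) volume 0 ℓ :=
    ((continuous_abs_rpow hp).comp hv).intervalIntegrable _ _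
  have h := intervalIntegral.integral_eq_sub_of_hasDerivAt (a := 0) (b := ℓ)
    (fun t _ => ((hs t).1.mul (hs t).2))
    (((hw.mul hw).add (hv.mul ((continuous_force hp).comp hv))).intervalIntegrable _ _)
  simp only [Pi.mul_apply, sol'_zero hp, mul_zero, sub_zero] at h
  rw [pendantAction, pendantMass, mul_comm (sol' p d 0 ℓ), ← h,
    ← intervalIntegral.integral_const_mul, ← intervalIntegral.integral_div,
    ← intervalIntegral.integral_add (hN.const_mul _)]
  · refine intervalIntegral.integral_congr fun t _ => ?_
    have := abs_rpow_eq hp (sol p d 0 t)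
    simp only [pot, force]
    linear_combination (-1 / 2) * this
  · exact (((hw.mul hw).add (hv.mul ((continuous_force hp).comp hv))).div_const
      2).intervalIntegrable _ _

theorem halfLineAction_eq (hp : 2 < p) (b : ℝ) : halfLineAction p b =
    (1 / 2 - 1 / p) * halfLineMass p b - hl' p b 0 * hl p b 0 / 2 := by
  have h := integral_weakIntegrand_hl hp b (memH1On_hl hp b)
  have hi := integrableOn_weakIntegrand_hl hp b (memH1On_hl hp b)
  have e : -(hl' p b 0 * hl p b 0) / 2 =
      ∫ x in Ici 0, weakIntegrand p (hl p b) (hl p b) x / 2 := by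
    rw [integral_div, h]
  rw [halfLineAction, halfLineMass, sub_eq_add_neg, ← neg_div, e, ← integral_const_mul,
    ← integral_add ((integrableOn_hl_rpow hp b).const_mul _) (hi.div_const 2)]
  refine integral_congr_ae (ae_of_all _ fun x => ?_)
  have := abs_rpow_eq hp (hl p b x)
  simp only [pot, weakIntegrand, (hasDerivAt_hl hp b x).deriv]
  linear_combination (-1 / 2) * this

/-- The boundary terms at the vertex cancel by continuity and Kirchhoff's condition. -/
theorem Matching.action_eq (hp : 2 < p) (hℓ : 0 ≤ ℓ) {b : ℝ} {d : Fin P → ℝ}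
    (h : Matching p ℓ b d) : action p ℓ (fork p ℓ b d) =
      (1 / 2 - 1 / p) * (halfLineMass p b + ∑ i, pendantMass p ℓ (d i)) := by
  rw [action_fork hp hℓ, halfLineAction_eq hp]
  simp only [pendantAction_eq hp, h.1, Finset.sum_add_distrib, ← Finset.mul_sum,
    ← Finset.sum_div, ← Finset.sum_mul]
  rw [← h.2]
  ring

theorem halfLineMass_nonneg (b : ℝ) : 0 ≤ halfLineMass p b :=
  integral_nonneg fun _ => by positivity

theorem pendantMass_nonneg (hℓ : 0 ≤ ℓ) (d : ℝ) : 0 ≤ pendantMass p ℓ d :=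
  intervalIntegral.integral_nonneg hℓ fun _ _ => by positivity

theorem action_congr {v : ForkFun P} (h : SameOn ℓ u v) : action p ℓ u = action p ℓ v := by
  unfold action
  have hd := deriv_ae_eq_Ici h.1
  congr 3
  · refine setIntegral_congr_ae measurableSet_Ici ?_
    filter_upwards [hd] with x hx hx'
    rw [hx hx', h.1 hx']
  · refine Finset.sum_congr rfl fun i _ => setIntegral_congr_ae measurableSet_Icc ?_
    filter_upwards [deriv_ae_eq_Icc (h.2 i)] with x hx hx'
    rw [hx hx', h.2 i hx']
  · exact setIntegral_congr_fun measurableSet_Ici fun x hx => by simp only [h.1 hx]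
  · exact Finset.sum_congr rfl fun i _ =>
      setIntegral_congr_fun measurableSet_Icc fun x hx => by simp only [h.2 i hx]

theorem neg_halfLine : (-u).halfLine = fun x => -u.halfLine x := rfl

theorem neg_pendant (i : Fin P) : (-u).pendant i = fun x => -u.pendant i x := rfl

theorem action_neg : action p ℓ (-u) = action p ℓ u := by
  simp [action, neg_halfLine, neg_pendant]

theorem fork_neg (hp : 2 < p) (b : ℝ) (d : Fin P → ℝ) :
    fork p ℓ (-b) (fun i => -d i) = -fork p ℓ b d := by
  have h : ∀ i x, sol p (-d i) 0 x = -sol p (d i) 0 x := fun i x => by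
    simpa using (sol_neg hp (d i) 0 x).1
  change ForkFun.mk _ _ = ForkFun.mk _ _
  simp only [fork, h]
  congr 1
  ext x
  exact hl_neg b x

theorem Matching.neg (hp : 2 < p) {b : ℝ} {d : Fin P → ℝ} (h : Matching p ℓ b d) :
    Matching p ℓ (-b) fun i => -d i := by
  have e : ∀ i, sol p (-d i) 0 ℓ = -sol p (d i) 0 ℓ ∧ sol' p (-d i) 0 ℓ = -sol' p (d i) 0 ℓ :=
    fun i => by simpa using sol_neg hp (d i) 0 ℓ
  refine ⟨fun i => ?_, ?_⟩
  · rw [(e i).1, h.1 i, hl_neg]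
  · rw [hl'_neg, h.2, ← Finset.sum_neg_distrib]
    exact Finset.sum_congr rfl fun i _ => (e i).2.symm

/-! ### Calibration -/

/-- The primitive of `√(2 pot)` vanishing at `0`. -/
def calib (p s : ℝ) : ℝ := ∫ x in 0..s, √(2 * pot p x)

theorem continuous_sqrt_pot (hp : 2 < p) : Continuous fun x => √(2 * pot p x) :=
  (continuous_const.mul (continuous_pot hp)).sqrt

theorem hasDerivAt_calib (hp : 2 < p) (s : ℝ) : HasDerivAt (calib p) (√(2 * pot p s)) s :=
  (continuous_sqrt_pot hp).integral_hasStrictDerivAt 0 s |>.hasDerivAt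

theorem calib_zero : calib p 0 = 0 := intervalIntegral.integral_same

theorem continuous_calib (hp : 2 < p) : Continuous (calib p) :=
  continuous_iff_continuousAt.2 fun s => (hasDerivAt_calib hp s).continuousAt

theorem calib_mono (hp : 2 < p) : Monotone (calib p) :=
  monotone_of_hasDerivAt_nonneg (hasDerivAt_calib hp) fun _ => Real.sqrt_nonneg _

theorem calib_strictMonoOn (hp : 2 < p) : StrictMonoOn (calib p) (Icc 0 (peak p)) := by
  refine strictMonoOn_of_hasDerivWithinAt_pos (convex_Icc _ _) (continuous_calib hp).continuousOn
    (fun x _ => (hasDerivAt_calib hp x).hasDerivWithinAt) fun x hx => ?_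
  rw [interior_Icc] at hx
  exact Real.sqrt_pos.2 (by linarith [pot_pos hp hx.1 hx.2])

theorem calib_pos (hp : 2 < p) {s : ℝ} (hs : 0 < s) : 0 < calib p s := by
  have hpk := (zero_lt_one' ℝ).trans (one_lt_peak hp)
  have h : 0 < min s (peak p) := lt_min hs hpk
  have := calib_strictMonoOn hp (left_mem_Icc.2 hpk.le) ⟨h.le, min_le_right _ _⟩ h
  rw [calib_zero] at this
  exact this.trans_le (calib_mono hp (min_le_left _ _))

theorem pot_nonpos_of_peak_le (hp : 2 < p) {s : ℝ} (hs : peak p ≤ s) : pot p s ≤ 0 := by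
  rw [← pot_peak hp]
  exact pot_anti_high hp (one_lt_peak hp).le hs

/-- Beyond the peak the potential is nonpositive, the square root is `0` by convention, and `calib`
stops growing. -/
theorem calib_le_peak (hp : 2 < p) (s : ℝ) : calib p s ≤ calib p (peak p) := by
  rcases le_total s (peak p) with h | h
  · exact calib_mono hp h
  · have : AntitoneOn (calib p) (Ici (peak p)) :=
      antitoneOn_of_hasDerivWithinAt_nonpos (convex_Ici _) (continuous_calib hp).continuousOn
        (fun x _ => (hasDerivAt_calib hp x).hasDerivWithinAt) fun x hx => by
          rw [Real.sqrt_eq_zero_of_nonpos]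
          linarith [pot_nonpos_of_peak_le hp (interior_subset hx : peak p ≤ x)]
    exact this self_mem_Ici h h

theorem IsSol.continuous_lagrangian (hp : 2 < p) {v w : ℝ → ℝ} (h : IsSol p v w) :
    Continuous fun t => w t ^ 2 / 2 + pot p (v t) :=
  ((h.continuous'.pow 2).div_const 2).add ((continuous_pot hp).comp h.continuous)

/-- Pointwise, `w²/2 + pot v ≥ √(2 pot v) |w| = |(calib v)'|`. -/
theorem IsSol.calib_le (hp : 2 < p) {v w : ℝ → ℝ} (h : IsSol p v w) {a b : ℝ} (hab : a ≤ b)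
    (hF : ∀ t ∈ Icc a b, 0 ≤ pot p (v t)) :
    |calib p (v b) - calib p (v a)| ≤ ∫ t in a..b, (w t ^ 2 / 2 + pot p (v t)) := by
  have hd : ∀ t, HasDerivAt (fun t => calib p (v t)) (√(2 * pot p (v t)) * w t) t := fun t =>
    (hasDerivAt_calib hp (v t)).comp t (h t).1
  have hc : Continuous fun t => √(2 * pot p (v t)) * w t :=
    ((continuous_sqrt_pot hp).comp h.continuous).mul h.continuous'
  rw [← intervalIntegral.integral_eq_sub_of_hasDerivAt (fun t _ => hd t)
    (hc.intervalIntegrable _ _)]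
  refine (intervalIntegral.abs_integral_le_integral_abs hab).trans ?_
  refine intervalIntegral.integral_mono_on hab (hc.abs.intervalIntegrable _ _)
    ((h.continuous_lagrangian hp).intervalIntegrable _ _) fun t ht => ?_
  have h1 := Real.sq_sqrt (show 0 ≤ 2 * pot p (v t) by linarith [hF t ht])
  rw [abs_mul, abs_of_nonneg (Real.sqrt_nonneg _)]
  nlinarith [sq_nonneg (√(2 * pot p (v t)) - |w t|), sq_abs (w t)]

theorem pendantAction_nonneg_of_pot (hℓ : 0 ≤ ℓ) {d : ℝ}
    (hF : ∀ t ∈ Icc 0 ℓ, 0 ≤ pot p (sol p d 0 t)) : 0 ≤ pendantAction p ℓ d :=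
  intervalIntegral.integral_nonneg hℓ fun t ht => by
    have := hF t ht
    positivity

theorem abs_calib_sub_le_pendantAction (hp : 2 < p) {d t : ℝ} (ht : t ∈ Icc 0 ℓ)
    (hF : ∀ t ∈ Icc 0 ℓ, 0 ≤ pot p (sol p d 0 t)) :
    |calib p (sol p d 0 ℓ) - calib p (sol p d 0 t)| ≤ pendantAction p ℓ d := by
  have hs := isSol_sol hp d 0
  have hc := hs.continuous_lagrangian hp
  rw [pendantAction, ← intervalIntegral.integral_add_adjacent_intervals
    (hc.intervalIntegrable 0 t) (hc.intervalIntegrable t ℓ)]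
  have h1 : 0 ≤ ∫ t in 0..t, (sol' p d 0 t ^ 2 / 2 + pot p (sol p d 0 t)) :=
    intervalIntegral.integral_nonneg ht.1 fun s hs => by
      have := hF s ⟨hs.1, hs.2.trans ht.2⟩
      positivity
  have h2 := hs.calib_le hp ht.2 fun s hs' => hF s ⟨ht.1.trans hs'.1, hs'.2⟩
  linarith

theorem integrableOn_hl_lagrangian (hp : 2 < p) (b : ℝ) :
    IntegrableOn (fun x => hl' p b x ^ 2 / 2 + pot p (hl p b x)) (Ici 0) :=
  ((integrableOn_hl'_sq hp b).div_const 2).add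
    (((integrableOn_hl_sq hp b).div_const 2).sub ((integrableOn_hl_rpow hp b).div_const p))

theorem integral_le_halfLineAction (hp : 2 < p) (b : ℝ) {X : ℝ} (hX : 0 ≤ X) :
    ∫ x in 0..X, (hl' p b x ^ 2 / 2 + pot p (hl p b x)) ≤ halfLineAction p b := by
  rw [intervalIntegral.integral_of_le hX]
  refine setIntegral_mono_set (integrableOn_hl_lagrangian hp b) (ae_of_all _ fun x => ?_)
    (Ioc_subset_Icc_self.trans Icc_subset_Ici_self).eventuallyLE
  have := pot_hl_nonneg hp b x
  simp only [Pi.zero_apply]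
  positivity

/-- The path goes from the vertex value to the value at `x`, then down to `0` at infinity, and each
piece pays its variation of `calib`. -/
theorem halfLineAction_ge (hp : 2 < p) (b : ℝ) {x : ℝ} (hx : 0 ≤ x) :
    |calib p (hl p b x) - calib p (hl p b 0)| + calib p (hl p b x) ≤ halfLineAction p b := by
  have hs := isSol_hl hp b
  have hc := hs.continuous_lagrangian hp
  have hlim : Tendsto (fun X => |calib p (hl p b x) - calib p (hl p b 0)| +
      (calib p (hl p b x) - calib p (hl p b X))) atTop
      (𝓝 (|calib p (hl p b x) - calib p (hl p b 0)| + (calib p (hl p b x) - calib p 0))) :=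
    tendsto_const_nhds.add (tendsto_const_nhds.sub
      (((continuous_calib hp).tendsto 0).comp (tendsto_hl hp b)))
  rw [calib_zero, sub_zero] at hlim
  refine le_of_tendsto hlim ?_
  filter_upwards [eventually_ge_atTop x] with X hX
  have h1 := hs.calib_le hp hx fun t _ => pot_hl_nonneg hp b t
  have h2 := hs.calib_le hp hX fun t _ => pot_hl_nonneg hp b t
  have h3 := integral_le_halfLineAction hp b (hx.trans hX)
  rw [← intervalIntegral.integral_add_adjacent_intervals
    (hc.intervalIntegrable 0 x) (hc.intervalIntegrable x X)] at h3
  have h4 := neg_abs_le (calib p (hl p b X) - calib p (hl p b x))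
  linarith

theorem calib_le_halfLineAction (hp : 2 < p) (b : ℝ) :
    calib p (hl p b 0) ≤ halfLineAction p b := by
  have := halfLineAction_ge hp b le_rfl
  rwa [sub_self, abs_zero, zero_add] at this

theorem halfLineAction_nonneg (hp : 2 < p) (b : ℝ) : 0 ≤ halfLineAction p b :=
  integral_nonneg fun x => by
    have := pot_hl_nonneg hp b x
    simp only [Pi.zero_apply]
    positivity

theorem rho_log {b : ℝ} (hb : 0 < b) : rho p b (Real.log b) = 1 := by
  rw [rho, abs_of_pos hb, Real.rpow_def_of_pos hb, ← Real.exp_add]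
  simp
  ring

theorem hl_log (hp : 2 < p) {b : ℝ} (hb : 0 < b) : hl p b (Real.log b) = peak p := by
  refine hl_eq_peak hp hb ?_
  rw [hl', rho_log hb, sub_self, zero_div, mul_zero]

/-- If the soliton has its peak on the half-line, its action is at least `2K - K(c)`, where `K` is the
calibration of the peak and `K(c)` that of the value `c` at the vertex. -/
theorem halfLineAction_ge_of_one_le (hp : 2 < p) {b : ℝ} (hb : 1 ≤ b) :
    2 * calib p (peak p) - calib p (hl p b 0) ≤ halfLineAction p b := by
  have h := halfLineAction_ge hp b (Real.log_nonneg hb)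
  rw [hl_log hp (by linarith)] at h
  have := le_abs_self (calib p (peak p) - calib p (hl p b 0))
  linarith

theorem hl'_nonneg (hp : 2 < p) {b : ℝ} (hb : 1 ≤ b) : 0 ≤ hl' p b 0 := by
  by_contra! h
  rw [hl'_neg_iff hp (by linarith), rho] at h
  have := Real.one_le_rpow (x := |b|) (z := p - 2) (by rw [abs_of_nonneg (by linarith)]; exact hb)
    (by linarith)
  simp at h
  linarith

/-- For `b < 1` the peak is not on the half-line, so `hl' = -√(2 pot)` throughout; the calibration
inequality is then an equality and the integral telescopes. -/
theorem halfLineAction_le (hp : 2 < p) {b : ℝ} (hb : 0 < b) (hb1 : b < 1) :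
    halfLineAction p b ≤ calib p (hl p b 0) := by
  have hd : ∀ t, HasDerivAt (fun t => calib p (hl p b t)) (√(2 * pot p (hl p b t)) * hl' p b t) t :=
    fun t => (hasDerivAt_calib hp _).comp t (hasDerivAt_hl hp b t)
  have hs : ∀ x ∈ Ici (0 : ℝ), hl' p b x ^ 2 / 2 + pot p (hl p b x) =
      -(√(2 * pot p (hl p b x)) * hl' p b x) := fun x hx => by
    have h1 : hl' p b x < 0 := (hl'_neg_iff hp hb).2
      (rho_lt_one hp (by rwa [abs_of_pos hb]) hx)
    have h2 := hl'_sq hp b x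
    rw [← h2, Real.sqrt_sq_eq_abs, abs_of_neg h1]
    linarith
  have hi := integrableOn_hl_lagrangian hp b
  rw [halfLineAction, setIntegral_congr_fun measurableSet_Ici hs, integral_neg]
  have hi' : IntegrableOn (fun x => √(2 * pot p (hl p b x)) * hl' p b x) (Ioi 0) := by
    have := (hi.congr_fun hs measurableSet_Ici).neg.mono_set Ioi_subset_Ici_self
    refine this.congr_fun (fun x _ => ?_) measurableSet_Ioi
    simp
  rw [integral_Ici_eq_integral_Ioi, integral_Ioi_of_hasDerivAt_of_tendsto
    (hd 0).continuousAt.continuousWithinAt (fun x _ => hd x) hi'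
    (((continuous_calib hp).tendsto 0).comp (tendsto_hl hp b)), calib_zero]
  linarith

/-! ### Small solutions -/

/-- The derivative of `v w` is `w² + v² (1 - |v|^(p-2))`, nonnegative below the equilibrium. -/
theorem IsSol.mul_monotoneOn (hp : 2 < p) {v w : ℝ → ℝ} (h : IsSol p v w)
    (hv : ∀ t ∈ Icc 0 ℓ, |v t| < 1) : MonotoneOn (fun t => v t * w t) (Icc 0 ℓ) := by
  refine monotoneOn_of_hasDerivWithinAt_nonneg (convex_Icc 0 ℓ)
    (h.continuous.mul h.continuous').continuousOn
    (fun t _ => ((h t).1.mul (h t).2).hasDerivWithinAt) fun t ht => ?_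
  have h1 := hv t (interior_subset ht)
  have h2 : v t * force p (v t) = v t ^ 2 * (1 - |v t| ^ (p - 2)) := by
    rw [force]
    ring
  have h3 : |v t| ^ (p - 2) ≤ 1 := Real.rpow_le_one (abs_nonneg _) h1.le (by linarith)
  rw [h2]
  have := mul_nonneg (sq_nonneg (v t)) (sub_nonneg.2 h3)
  nlinarith [sq_nonneg (w t)]

theorem sol_mul_nonneg (hp : 2 < p) (hℓ : 0 ≤ ℓ) {d : ℝ}
    (hv : ∀ t ∈ Icc 0 ℓ, |sol p d 0 t| < 1) : 0 ≤ sol p d 0 ℓ * sol' p d 0 ℓ := by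
  have := (isSol_sol hp d 0).mul_monotoneOn hp hv (left_mem_Icc.2 hℓ) (right_mem_Icc.2 hℓ) hℓ
  simpa [sol'_zero hp] using this

theorem eq_zero_of_sol_eq_zero (hp : 2 < p) (hℓ : 0 < ℓ) {d : ℝ}
    (hv : ∀ t ∈ Icc 0 ℓ, |sol p d 0 t| < 1) (h0 : sol p d 0 ℓ = 0) : d = 0 := by
  have hs := isSol_sol hp d 0
  have hm := hs.mul_monotoneOn hp hv
  have hsq : MonotoneOn (fun t => sol p d 0 t ^ 2) (Icc 0 ℓ) := by
    refine monotoneOn_of_hasDerivWithinAt_nonneg (convex_Icc 0 ℓ)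
      (hs.continuous.pow 2).continuousOn
      (fun t _ => ((hs t).1.pow 2).hasDerivWithinAt) fun t ht => ?_
    have ht' := interior_subset ht
    have := hm (left_mem_Icc.2 hℓ.le) ht' ht'.1
    simp only [sol'_zero hp, mul_zero] at this
    simp
    linarith
  have := hsq (left_mem_Icc.2 hℓ.le) (right_mem_Icc.2 hℓ.le) hℓ.le
  simp only [sol_zero hp, h0] at this
  nlinarith

/-- There is no nontrivial bound-state with data below the equilibrium. -/
theorem Matching.exists_one_le (hp : 2 < p) (hℓ : 0 < ℓ) {b : ℝ} {d : Fin P → ℝ}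
    (h : Matching p ℓ b d) (hne : b ≠ 0 ∨ ∃ i, d i ≠ 0) :
    1 ≤ |b| ∨ ∃ i, ∃ t ∈ Icc 0 ℓ, 1 ≤ |sol p (d i) 0 t| := by
  by_contra! hcon
  obtain ⟨hb, hv⟩ := hcon
  -- Kirchhoff's condition makes this product the sum of the nonnegative pendant products, while
  -- `|b| < 1` makes it negative unless the vertex value is `0`.
  have h1 : 0 ≤ hl p b 0 * hl' p b 0 := by
    rw [h.2, Finset.mul_sum]
    refine Finset.sum_nonneg fun i _ => ?_
    rw [← h.1 i]
    exact sol_mul_nonneg hp hℓ.le (hv i)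
  have h2 := rho_lt_one hp hb le_rfl
  have h3 := rho_nonneg (p := p) b 0
  have h4 : hl p b 0 = 0 := by
    have h5 : (rho p b 0 - 1) / (rho p b 0 + 1) < 0 := div_neg_of_neg_of_pos (by linarith)
      (by linarith)
    rw [hl', ← mul_assoc] at h1
    by_contra h6
    have := mul_neg_of_pos_of_neg (mul_self_pos.2 h6) h5
    linarith
  have hd : ∀ i, d i = 0 := fun i => eq_zero_of_sol_eq_zero hp hℓ (hv i) (by rw [h.1 i, h4])
  rcases hne with hb0 | ⟨i, hi⟩
  · rcases lt_or_gt_of_ne hb0 with h5 | h5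
    · have := hl_pos hp (neg_pos.2 h5) 0
      rw [hl_neg, h4] at this
      linarith
    · exact (hl_pos hp h5 0).ne' h4
  · exact hi (hd i)

/-- Bound-states of bounded mass are bounded. -/
theorem Matching.abs_sol_le (hp : 2 < p) (hℓ : 0 ≤ ℓ) {b : ℝ} {d : Fin P → ℝ}
    (h : Matching p ℓ b d) (i : Fin P) {t : ℝ} (ht : t ∈ Icc 0 ℓ) :
    |sol p (d i) 0 t| ≤
      peak p + (ℓ + (halfLineMass p b + ∑ i, pendantMass p ℓ (d i))) / 2 := by
  have hs := isSol_sol hp (d i) 0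
  have hw2 : ∀ d : ℝ, Continuous fun t => sol' p d 0 t ^ 2 := fun d =>
    (continuous_sol' hp d 0).pow 2
  have hp0 : 0 < p := by linarith
  -- The integrand `w²/2 + pot v` plus `|v|^p / p` equals `(w² + v²)/2`, so action and mass control
  -- the slope in `L²`.
  have hpend : ∀ d, ∫ t in 0..ℓ, sol' p d 0 t ^ 2 ≤
      2 * pendantAction p ℓ d + 2 / p * pendantMass p ℓ d := fun d => by
    have hv := continuous_sol hp d 0
    have hc := (isSol_sol hp d 0).continuous_lagrangian hp
    have hN : Continuous fun t => |sol p d 0 t| ^ p := (continuous_abs_rpow hp).comp hv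
    have hc2 : Continuous fun t => 2 * (sol' p d 0 t ^ 2 / 2 + pot p (sol p d 0 t)) :=
      continuous_const.mul hc
    have hN2 : Continuous fun t => 2 / p * |sol p d 0 t| ^ p := continuous_const.mul hN
    rw [pendantAction, pendantMass, ← intervalIntegral.integral_const_mul,
      ← intervalIntegral.integral_const_mul, ← intervalIntegral.integral_add
        (hc2.intervalIntegrable _ _) (hN2.intervalIntegrable _ _)]
    refine intervalIntegral.integral_mono_on hℓ ((hw2 d).intervalIntegrable _ _)
      ((hc2.add hN2).intervalIntegrable _ _)
      fun t _ => ?_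
    have e : 2 * (sol' p d 0 t ^ 2 / 2 + pot p (sol p d 0 t)) + 2 / p * |sol p d 0 t| ^ p =
        sol' p d 0 t ^ 2 + sol p d 0 t ^ 2 := by
      rw [pot]
      ring
    rw [e]
    linarith [sq_nonneg (sol p d 0 t)]
  have hpend0 : ∀ d, 0 ≤ ∫ t in 0..ℓ, sol' p d 0 t ^ 2 := fun d =>
    intervalIntegral.integral_nonneg hℓ fun _ _ => sq_nonneg _
  have hD : ∫ t in 0..ℓ, sol' p (d i) 0 t ^ 2 ≤
      halfLineMass p b + ∑ i, pendantMass p ℓ (d i) := by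
    have h1 : ∑ i, ∫ t in 0..ℓ, sol' p (d i) 0 t ^ 2 ≤
        ∑ i, (2 * pendantAction p ℓ (d i) + 2 / p * pendantMass p ℓ (d i)) :=
      Finset.sum_le_sum fun j _ => hpend (d j)
    have h2 : ∫ t in 0..ℓ, sol' p (d i) 0 t ^ 2 ≤ ∑ i, ∫ t in 0..ℓ, sol' p (d i) 0 t ^ 2 :=
      Finset.single_le_sum (f := fun i => ∫ t in 0..ℓ, sol' p (d i) 0 t ^ 2)
        (fun j _ => hpend0 (d j)) (Finset.mem_univ i)
    rw [Finset.sum_add_distrib, ← Finset.mul_sum, ← Finset.mul_sum] at h1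
    have h3 := h.action_eq hp hℓ
    rw [action_fork hp hℓ] at h3
    have h4 := halfLineAction_nonneg hp b
    have h5 := halfLineMass_nonneg (p := p) b
    have h6 : 0 ≤ 1 / p * halfLineMass p b := by positivity
    have e : 2 * ((1 / 2 - 1 / p) * (halfLineMass p b + ∑ i, pendantMass p ℓ (d i))) +
        2 / p * ∑ i, pendantMass p ℓ (d i) = halfLineMass p b + ∑ i, pendantMass p ℓ (d i) -
        2 * (1 / p * halfLineMass p b) := by ring
    linarith
  have hdiff : |sol p (d i) 0 ℓ - sol p (d i) 0 t| ≤
      (ℓ + ∫ t in 0..ℓ, sol' p (d i) 0 t ^ 2) / 2 := by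
    have hw := hs.continuous'
    have hg : Continuous fun t => (1 + sol' p (d i) 0 t ^ 2) / 2 :=
      (continuous_const.add (hw2 _)).div_const 2
    rw [← intervalIntegral.integral_eq_sub_of_hasDerivAt (fun s _ => (hs s).1)
      (hw.intervalIntegrable _ _)]
    calc |∫ s in t..ℓ, sol' p (d i) 0 s| ≤ ∫ s in t..ℓ, |sol' p (d i) 0 s| :=
          intervalIntegral.abs_integral_le_integral_abs ht.2
      _ ≤ ∫ s in t..ℓ, (1 + sol' p (d i) 0 s ^ 2) / 2 := by
          refine intervalIntegral.integral_mono_on ht.2 (hw.abs.intervalIntegrable _ _)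
            (hg.intervalIntegrable _ _) fun s _ => ?_
          nlinarith [sq_nonneg (|sol' p (d i) 0 s| - 1), sq_abs (sol' p (d i) 0 s)]
      _ ≤ ∫ s in 0..ℓ, (1 + sol' p (d i) 0 s ^ 2) / 2 := by
          rw [← intervalIntegral.integral_add_adjacent_intervals
            (hg.intervalIntegrable 0 t) (hg.intervalIntegrable t ℓ)]
          have : 0 ≤ ∫ s in 0..t, (1 + sol' p (d i) 0 s ^ 2) / 2 :=
            intervalIntegral.integral_nonneg ht.1 fun _ _ => by positivity
          linarith
      _ = (ℓ + ∫ t in 0..ℓ, sol' p (d i) 0 t ^ 2) / 2 := by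
          rw [intervalIntegral.integral_div, intervalIntegral.integral_add
            (continuous_const.intervalIntegrable _ _) ((hw2 _).intervalIntegrable _ _)]
          simp
  have hc := abs_hl_le_peak hp b 0
  rw [← h.1 i] at hc
  have h1 := abs_sub_abs_le_abs_sub (sol p (d i) 0 t) (sol p (d i) 0 ℓ)
  rw [abs_sub_comm] at h1
  linarith

end Fork

namespace Fork

open ForkFun

variable {p : ℝ} {P : ℕ} {ℓ : ℝ} {u v w : ForkFun P}

/-! ### Action ground-states for short pendants -/

theorem SameOn.trans (h : SameOn ℓ u v) (h' : SameOn ℓ v w) : SameOn ℓ u w :=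
  ⟨h.1.trans h'.1, fun i => (h.2 i).trans (h'.2 i)⟩

theorem SameOn.neg (h : SameOn ℓ u v) : SameOn ℓ (-u) (-v) :=
  ⟨fun _ hx => congrArg Neg.neg (h.1 hx), fun i _ hx => congrArg Neg.neg (h.2 i hx)⟩

theorem neg_neg_forkFun (u : ForkFun P) : -(-u) = u := by
  cases u
  change ForkFun.mk _ _ = ForkFun.mk _ _
  simp [neg_halfLine, neg_pendant]

/-- The half-line part decreases, so it costs at most `calib c`. On the pendants `w²/2 = pot v - pot
δ` with `pot δ ≥ 0`, so the integrand is at most `2 pot 1`. -/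
theorem IsIncSymPosBoundState.action_le (hp : 2 < p) (hP : 2 ≤ P) (hℓ : 0 < ℓ)
    (hw : IsIncSymPosBoundState p ℓ w) :
    action p ℓ w ≤ calib p (peak p) + 2 * P * pot p 1 * ℓ := by
  obtain ⟨b, δ, hm, hb, hvpos, hsame⟩ := exists_positive_data hp hP hℓ hw.1 hw.2.1 hw.2.2.1
  have hanti := strictAntiOn_of_increasing hP hsame hw.2.2.2.1
  have hδ := one_lt_of_strictAntiOn hp hℓ hanti hvpos
  have hne := (hanti (left_mem_Icc.2 hℓ.le) (right_mem_Icc.2 hℓ.le) hℓ).ne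
  rw [sol_zero hp] at hne
  obtain ⟨hc, hc1⟩ := pot_vertex_pos hp hP hm hb (one_pos.trans hδ) hne
  -- Otherwise the peak lies on the half-line at `log b ≥ 0`, although `u` decreases there from a
  -- value below the peak.
  have hb1 : b < 1 := by
    by_contra! h
    have hl0 := Real.log_nonneg h
    have := hw.2.2.2.2.antitoneOn self_mem_Ici (mem_Ici.2 hl0) hl0
    rw [hsame.1 self_mem_Ici, hsame.1 (mem_Ici.2 hl0)] at this
    simp only [fork, hl_log hp hb] at this
    linarith
  have h1 := (halfLineAction_le hp hb hb1).trans (calib_le_peak hp _)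
  have hF : 0 ≤ pot p δ := by
    rw [Matching.symm_energy hp hP hm]
    exact mul_nonneg (theta_pos hP).le hc.le
  have h2 : pendantAction p ℓ δ ≤ 2 * pot p 1 * ℓ := by
    have hs := isSol_sol hp δ 0
    calc pendantAction p ℓ δ ≤ ∫ _ in 0..ℓ, 2 * pot p 1 := by
          refine intervalIntegral.integral_mono_on hℓ.le
            ((hs.continuous_lagrangian hp).intervalIntegrable _ _)
            (continuous_const.intervalIntegrable _ _) fun t _ => ?_
          have h3 := sol_energy hp δ t
          have h4 := pot_le hp (sol p δ 0 t)
          rw [← pot_one] at h4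
          linarith
      _ = 2 * pot p 1 * ℓ := by
          rw [intervalIntegral.integral_const, smul_eq_mul]
          ring
  rw [action_congr hsame, action_fork hp hℓ.le]
  simp only [Finset.sum_const, Finset.card_univ, Fintype.card_fin, nsmul_eq_mul]
  have := mul_le_mul_of_nonneg_left h2 (Nat.cast_nonneg (α := ℝ) P)
  linarith

/-- On short intervals, a bounded solution with vanishing initial slope is determined by its final
value. -/
theorem eq_of_sol_eq (hp : 2 < p) (hℓ : 0 ≤ ℓ) {M K : ℝ} (hK0 : 0 ≤ K)
    (hK : ∀ x, |x| ≤ M → ∀ y, |y| ≤ M → |force p x - force p y| ≤ K * |x - y|)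
    (hKℓ : K * ℓ ^ 2 < 1) {d d' : ℝ} (hd : ∀ t ∈ Icc 0 ℓ, |sol p d 0 t| ≤ M)
    (hd' : ∀ t ∈ Icc 0 ℓ, |sol p d' 0 t| ≤ M) (h : sol p d 0 ℓ = sol p d' 0 ℓ) : d = d' := by
  have hs := isSol_sol hp d 0
  have hs' := isSol_sol hp d' 0
  have hcont : Continuous fun t => |sol p d 0 t - sol p d' 0 t| :=
    (hs.continuous.sub hs'.continuous).abs
  obtain ⟨τ, hτ, hmax⟩ := (isCompact_Icc (a := (0 : ℝ)) (b := ℓ)).exists_isMaxOn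
    (nonempty_Icc.2 hℓ) hcont.continuousOn
  rw [isMaxOn_iff] at hmax
  set D := |sol p d 0 τ - sol p d' 0 τ|
  have hD : 0 ≤ D := abs_nonneg _
  have h1 : ∀ t ∈ Icc 0 ℓ, ‖sol' p d 0 t - sol' p d' 0 t‖ ≤ K * D * ℓ := fun t ht => by
    have := (convex_Icc 0 ℓ).norm_image_sub_le_of_norm_hasDerivWithin_le
      (f := fun t => sol' p d 0 t - sol' p d' 0 t) (C := K * D)
      (fun s _ => ((hs s).2.sub (hs' s).2).hasDerivWithinAt)
      (fun s hs => (hK _ (hd s hs) _ (hd' s hs)).trans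
        (mul_le_mul_of_nonneg_left (hmax s hs) hK0))
      (left_mem_Icc.2 hℓ) ht
    simp only [sol'_zero hp, sub_self, sub_zero] at this
    refine this.trans (mul_le_mul_of_nonneg_left ?_ (mul_nonneg hK0 hD))
    rw [Real.norm_of_nonneg ht.1]
    exact ht.2
  have h2 := (convex_Icc 0 ℓ).norm_image_sub_le_of_norm_hasDerivWithin_le
    (f := fun t => sol p d 0 t - sol p d' 0 t)
    (fun s _ => ((hs s).1.sub (hs' s).1).hasDerivWithinAt) h1 (right_mem_Icc.2 hℓ) hτ
  simp only [h, sub_self, sub_zero] at h2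
  have h3 : D ≤ K * D * ℓ * ℓ := by
    refine h2.trans (mul_le_mul_of_nonneg_left ?_ (by positivity))
    rw [Real.norm_eq_abs, abs_sub_comm, abs_of_nonneg (by linarith [hτ.2])]
    linarith [hτ.1]
  -- From `D ≤ K * ℓ² * D` and `K * ℓ² < 1`.
  have h4 : D = 0 := by nlinarith
  have h5 := hmax 0 (left_mem_Icc.2 hℓ)
  rw [h4, sol_zero hp, sol_zero hp] at h5
  have := abs_nonneg (d - d')
  exact sub_eq_zero.1 (abs_eq_zero.1 (by linarith))

/-- The potential increases up to `1` and decreases afterwards. In the contrapositive, a small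
potential confines the height to a neighbourhood of `0` or of the peak. -/
theorem pot_ge_min (hp : 2 < p) {a b c : ℝ} (ha : 0 ≤ a) (hb : b ∈ Icc a c) :
    min (pot p a) (pot p c) ≤ pot p b := by
  rcases le_total b 1 with h | h
  · exact (min_le_left _ _).trans (pot_mono_low hp ha hb.1 h)
  · exact (min_le_right _ _).trans (pot_anti_high hp h hb.2)

/-- For `ℓ` small, all bound-states of low action are, up to sign, increasing, symmetric and
positive. -/
theorem exists_isIncSymPos_of_action_le (hp : 2 < p) (hP : 2 ≤ P) : ∃ ℓ₀ : ℝ, 0 < ℓ₀ ∧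
    ∀ ℓ, 0 < ℓ → ℓ < ℓ₀ → ∀ (b : ℝ) (d : Fin P → ℝ), 0 ≤ b → Matching p ℓ b d →
      (b ≠ 0 ∨ ∃ i, d i ≠ 0) →
      action p ℓ (fork p ℓ b d) ≤ calib p (peak p) + 2 * P * pot p 1 * ℓ →
      IsIncSymPosBoundState p ℓ (fork p ℓ b d) := by
  have hpk := one_lt_peak hp
  have hκ : 0 < 1 / 2 - 1 / p := pot_one_pos hp
  have hF1 : 0 < pot p 1 := by rw [pot_one]; exact hκ
  set K := calib p (peak p) with hKdef
  -- Bound for the mass once `ℓ < 1`; `M` is the height that `Matching.abs_sol_le` derives from it.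
  set N₀ := (K + 2 * P * pot p 1) / (1 / 2 - 1 / p) with hN₀
  set M := peak p + (1 + N₀) / 2 with hM
  have hKpos : 0 < K := calib_pos hp (by linarith)
  have hM0 : 0 < M := by positivity
  obtain ⟨L, hL1, hL⟩ := force_lipschitzOn hp M
  set C := L * M with hC
  have hC0 : 0 < C := by positivity
  have hf : ∀ x, |x| ≤ M → |force p x| ≤ C := fun x hx => by
    have := hL x hx 0 (by simpa using hM0.le)
    rw [force_zero, sub_zero, sub_zero] at this
    exact this.trans (mul_le_mul_of_nonneg_left hx (by linarith))
  set s := (1 + peak p) / 2 with hs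
  set m := min (pot p (1 / 2)) (pot p s) with hm
  have hm0 : 0 < m :=
    lt_min (pot_pos hp (by norm_num) (by linarith)) (pot_pos hp (by linarith) (by linarith))
  have hg : calib p (1 / 2) < K :=
    calib_strictMonoOn hp ⟨by norm_num, by linarith⟩ ⟨by linarith, le_rfl⟩ (by linarith)
  -- The two bounds on `C * ℓ` keep the pendants below `1` when `c < 1/2` and above `1` when `s <
  -- c`. The bound by `m` leaves only these two cases for `c`, `L * ℓ ^ 2 < 1` is the contraction
  -- used for equal tips, and the last bound excludes a soliton peak on the half-line.
  have hev : ∀ᶠ ℓ : ℝ in 𝓝 0, ℓ < 1 ∧ C * ℓ < 1 / 2 ∧ C * ℓ < (peak p - 1) / 2 ∧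
      (P * (C * ℓ)) ^ 2 / 2 < m ∧ L * ℓ ^ 2 < 1 ∧
      2 * P * pot p 1 * ℓ < K - calib p (1 / 2) := by
    have e : ∀ {f : ℝ → ℝ} {y : ℝ}, Continuous f → f 0 < y → ∀ᶠ ℓ : ℝ in 𝓝 0, f ℓ < y :=
      fun hf h => (hf.tendsto 0).eventually_lt_const h
    refine (e continuous_id one_pos).and ((e (by fun_prop) (by norm_num)).and
      ((e (by fun_prop) (by linarith)).and ((e (by fun_prop) (by simpa using hm0)).and
      ((e (by fun_prop) (by norm_num)).and (e (by fun_prop) (by linarith))))))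
  obtain ⟨ℓ₀, hℓ₀, hball⟩ := Metric.eventually_nhds_iff.1 hev
  refine ⟨ℓ₀, hℓ₀, fun ℓ hℓ hℓlt b d hb hmat hne hact => ?_⟩
  obtain ⟨k1, k2, k3, k4, k5, k6⟩ := hball (y := ℓ) (by
    rwa [Real.dist_eq, sub_zero, abs_of_pos hℓ])
  clear hball hev
  have hN : halfLineMass p b + ∑ i, pendantMass p ℓ (d i) ≤ N₀ := by
    rw [hN₀, le_div_iff₀ hκ, mul_comm, ← hmat.action_eq hp hℓ.le]
    refine hact.trans ?_
    have : 2 * P * pot p 1 * ℓ ≤ 2 * P * pot p 1 := mul_le_of_le_one_right (by positivity) k1.le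
    linarith
  have hvM : ∀ i, ∀ t ∈ Icc 0 ℓ, |sol p (d i) 0 t| ≤ M := fun i t ht => by
    have := hmat.abs_sol_le hp hℓ.le i ht
    linarith
  have hwC : ∀ i, ∀ t ∈ Icc 0 ℓ, ‖sol' p (d i) 0 t‖ ≤ C * ℓ := fun i t ht => by
    have := (convex_Icc 0 ℓ).norm_image_sub_le_of_norm_hasDerivWithin_le
      (f := sol' p (d i) 0) (fun s _ => (isSol_sol hp (d i) 0 s).2.hasDerivWithinAt)
      (fun s hs => hf _ (hvM i s hs)) (left_mem_Icc.2 hℓ.le) ht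
    rw [sol'_zero hp, sub_zero, sub_zero, Real.norm_of_nonneg ht.1] at this
    exact this.trans (mul_le_mul_of_nonneg_left ht.2 hC0.le)
  set c := hl p b 0 with hc
  have hvc : ∀ i, ∀ t ∈ Icc 0 ℓ, |sol p (d i) 0 t - c| ≤ C * ℓ := fun i t ht => by
    have := (convex_Icc 0 ℓ).norm_image_sub_le_of_norm_hasDerivWithin_le
      (f := sol p (d i) 0) (fun s _ => (isSol_sol hp (d i) 0 s).1.hasDerivWithinAt)
      (hwC i) (right_mem_Icc.2 hℓ.le) ht
    rw [hmat.1 i] at this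
    refine this.trans (mul_le_of_le_one_right (by positivity) ?_)
    rw [Real.norm_eq_abs, abs_sub_comm, abs_of_nonneg (by linarith [ht.2])]
    linarith [ht.1]
  have hc0 : 0 ≤ c := by
    rcases hb.eq_or_lt with h | h
    · rw [hc, ← h, hl_zero_left]
    · exact (hl_pos hp h 0).le
  -- The pendant slopes are `O(ℓ)`, hence by Kirchhoff's condition so is `hl' p b 0`, whose square
  -- is `2 pot c`.
  have hFc : pot p c < m := by
    have h1 : |hl' p b 0| ≤ P * (C * ℓ) := by
      rw [hmat.2]
      refine (Finset.abs_sum_le_sum_abs _ _).trans ((Finset.sum_le_sum fun i _ =>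
        hwC i ℓ (right_mem_Icc.2 hℓ.le)).trans ?_)
      simp
    have h2 := hl'_sq hp b 0
    have h3 : hl' p b 0 ^ 2 ≤ (P * (C * ℓ)) ^ 2 := by
      rw [← sq_abs]
      gcongr
    linarith
  have hdich : c < 1 / 2 ∨ s < c := by
    by_contra! h
    exact absurd (pot_ge_min hp (by norm_num : (0 : ℝ) ≤ 1 / 2) h) (not_le.2 hFc)
  rcases hdich with hlow | hhigh
  · exfalso
    have hv1 : ∀ i, ∀ t ∈ Icc 0 ℓ, |sol p (d i) 0 t| < 1 := fun i t ht => by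
      have h1 := abs_le.1 (hvc i t ht)
      rw [abs_lt]
      constructor <;> linarith
    -- The pendants stay below the equilibrium, so nontriviality must come from the half-line, which
    -- then carries the peak and costs at least `2K - calib c`.
    have hb1 : 1 ≤ b := by
      rcases hmat.exists_one_le hp hℓ hne with h | ⟨i, t, ht, h⟩
      · rwa [abs_of_nonneg hb] at h
      · exact absurd h (not_le.2 (hv1 i t ht))
    have h1 := halfLineAction_ge_of_one_le hp hb1
    have h2 := calib_mono hp hlow.le
    have h3 : 0 ≤ ∑ i, pendantAction p ℓ (d i) := Finset.sum_nonneg fun i _ =>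
      pendantAction_nonneg_of_pot hℓ.le fun t ht => pot_nonneg hp
        ((hv1 i t ht).le.trans hpk.le)
    rw [action_fork hp hℓ.le] at hact
    linarith
  · have hv1 : ∀ i, ∀ t ∈ Icc 0 ℓ, 1 < sol p (d i) 0 t := fun i t ht => by
      have h1 := abs_le.1 (hvc i t ht)
      linarith
    have hwanti : ∀ i, StrictAntiOn (sol' p (d i) 0) (Icc 0 ℓ) := fun i =>
      strictAntiOn_of_hasDerivWithinAt_neg (convex_Icc 0 ℓ) (continuous_sol' hp _ _).continuousOn
        (fun t _ => (isSol_sol hp (d i) 0 t).2.hasDerivWithinAt) fun t ht =>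
          force_neg_of_one_lt hp (hv1 i t (interior_subset ht))
    have hwneg : ∀ i, ∀ t ∈ Ioc 0 ℓ, sol' p (d i) 0 t < 0 := fun i t ht => by
      have := hwanti i (left_mem_Icc.2 hℓ.le) (Ioc_subset_Icc_self ht) ht.1
      rwa [sol'_zero hp] at this
    have hvanti : ∀ i, StrictAntiOn (sol p (d i) 0) (Icc 0 ℓ) := fun i =>
      strictAntiOn_of_hasDerivWithinAt_neg (convex_Icc 0 ℓ) (continuous_sol hp _ _).continuousOn
        (fun t _ => (isSol_sol hp (d i) 0 t).1.hasDerivWithinAt) fun t ht => by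
          rw [interior_Icc] at ht
          exact hwneg i t (Ioo_subset_Ioc_self ht)
    have hb0 : 0 < b := pos_of_hl_pos hp (x := 0) (by linarith)
    have i₀ : Fin P := ⟨0, by omega⟩
    -- Symmetry: on short pendants the tip value is determined by the common value at the vertex.
    have hdeq : ∀ i j, d i = d j := fun i j =>
      eq_of_sol_eq hp hℓ.le (by linarith) hL k5 (hvM i) (hvM j) (by rw [hmat.1 i, hmat.1 j])
    refine ⟨isBoundState_fork hp hℓ.le hmat (Or.inl hb0.ne'),
      ⟨fun x _ => hl_pos hp hb0 x, fun i x hx => ?_⟩, fun i j x _ => ?_, fun i x hx y hy hxy => ?_,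
      hl_strictAntiOn hp hb0 ?_⟩
    · have := hv1 i (ℓ - x) ⟨by linarith [hx.2], by linarith [hx.1]⟩
      simp only [fork]
      linarith
    · simp only [fork, hdeq i j]
    · exact hvanti i ⟨by linarith [hy.2], by linarith [hy.1]⟩
        ⟨by linarith [hx.2], by linarith [hx.1]⟩ (by linarith)
    · rw [hmat.2]
      exact Finset.sum_neg (fun i _ => hwneg i ℓ ⟨hℓ, le_rfl⟩) ⟨i₀, Finset.mem_univ _⟩

theorem exists_forall_isGroundState (hp : 2 < p) (hP : 2 ≤ P) : ∃ ℓ₀ : ℝ, 0 < ℓ₀ ∧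
    ∀ ℓ, 0 < ℓ → ℓ < ℓ₀ → ∀ w : ForkFun P, IsIncSymPosBoundState p ℓ w →
      IsGroundState p ℓ w ∧
        ∀ u : ForkFun P, IsGroundState p ℓ u → SameOn ℓ u w ∨ SameOn ℓ u (-w) := by
  obtain ⟨ℓ₀, hℓ₀, h⟩ := exists_isIncSymPos_of_action_le (P := P) hp hP
  refine ⟨ℓ₀, hℓ₀, fun ℓ hℓ hℓlt w hw => ?_⟩
  have key : ∀ u : ForkFun P, IsBoundState p ℓ u → action p ℓ u ≤ action p ℓ w →
      SameOn ℓ u w ∨ SameOn ℓ u (-w) := fun u hu hle => by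
    obtain ⟨b, d, hmat, hne, hsame⟩ := IsBoundState.exists_fork hp hℓ hu
    have hle' := hle.trans (IsIncSymPosBoundState.action_le hp hP hℓ hw)
    rw [action_congr hsame] at hle'
    rcases le_total 0 b with hb | hb
    · left
      exact SameOn.trans hsame
        (IsIncSymPosBoundState.sameOn hp hP hℓ hw (h ℓ hℓ hℓlt b d hb hmat hne hle'))
    · right
      have h1 := h ℓ hℓ hℓlt (-b) (fun i => -d i) (by linarith) (hmat.neg hp) (by simpa using hne)
        (by rw [fork_neg hp, action_neg]; exact hle')
      have h2 := SameOn.neg (IsIncSymPosBoundState.sameOn hp hP hℓ hw h1)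
      rw [fork_neg hp, neg_neg_forkFun] at h2
      exact SameOn.trans hsame h2
  refine ⟨⟨hw.1, fun v hv => ?_⟩, fun u hu => key u hu.1 (hu.2 w hw.1)⟩
  by_contra! hlt
  rcases key v hv hlt.le with h1 | h1
  · exact hlt.ne (action_congr h1)
  · exact hlt.ne ((action_congr h1).trans action_neg)

end Fork

namespace Fork

open ForkFun

variable {p : ℝ} {P : ℕ} {ℓ : ℝ} {u : ForkFun P}

/-! ### Existence of action ground-states -/

theorem continuous_hl_left (hp : 2 < p) (x : ℝ) : Continuous fun b => hl p b x := by
  have h1 : Continuous fun b : ℝ => rho p b x :=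
    (continuous_abs.rpow_const fun _ => Or.inr (by linarith)).mul continuous_const
  have h2 : Continuous fun b : ℝ => (1 + rho p b x) ^ (-(2 / (p - 2))) :=
    (continuous_const.add h1).rpow_const fun b => Or.inl
      (ne_of_gt (by linarith [rho_nonneg (p := p) b x] : 0 < 1 + rho p b x))
  unfold hl
  fun_prop

theorem continuous_halfLineMass (hp : 2 < p) : Continuous (halfLineMass p) := by
  refine continuous_iff_continuousAt.2 fun b₀ => ?_
  refine continuousAt_of_dominated
    (bound := fun x => ((2 * p) ^ (1 / (p - 2)) * (|b₀| + 1)) ^ p * Real.exp (-p * x))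
    (Eventually.of_forall fun b =>
      ((continuous_abs_rpow hp).comp (continuous_hl hp b)).aestronglyMeasurable) ?_
    ((integrableOn_exp_neg_Ici (by linarith : (0 : ℝ) < p)).const_mul _)
    (ae_of_all _ fun x => ((continuous_abs_rpow hp).comp (continuous_hl_left hp x)).continuousAt)
  filter_upwards [continuous_abs.continuousAt.eventually_lt_const (lt_add_one |b₀|)] with b hb
  refine ae_of_all _ fun x => ?_
  rw [Real.norm_of_nonneg (by positivity)]
  exact abs_hl_rpow_le hp hb.le x

theorem continuous_pendantMass (hp : 2 < p) : Continuous (pendantMass p ℓ) := by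
  have : Continuous (Function.uncurry fun d t => |sol p d 0 t| ^ p) :=
    (continuous_abs_rpow hp).comp (Continuous.sol hp continuous_fst continuous_const continuous_snd)
  exact intervalIntegral.continuous_parametric_intervalIntegral_of_continuous' this 0 ℓ

theorem halfLineMass_neg (b : ℝ) : halfLineMass p (-b) = halfLineMass p b := by
  simp [halfLineMass, hl_neg]

/-- As the peak at `log b` moves away, the value at the vertex decays like `1 / b`. -/
theorem hl_zero_le_div (hp : 2 < p) {b : ℝ} (hb : 0 < b) :
    hl p b 0 ≤ (2 * p) ^ (1 / (p - 2)) / b := by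
  have hA : 0 < (2 * p) ^ (1 / (p - 2)) := Real.rpow_pos_of_pos (by linarith) _
  have hr : 0 < b ^ (p - 2) := Real.rpow_pos_of_pos hb _
  have h1 : (1 + b ^ (p - 2)) ^ (-(2 / (p - 2))) ≤ (b ^ (p - 2)) ^ (-(2 / (p - 2))) :=
    Real.rpow_le_rpow_of_nonpos hr (by linarith)
      (by have : 0 < 2 / (p - 2) := div_pos two_pos (by linarith)
          linarith)
  have h2 : (b ^ (p - 2)) ^ (-(2 / (p - 2))) = (b ^ 2)⁻¹ := by
    have : p - 2 ≠ 0 := by linarith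
    rw [← Real.rpow_mul hb.le, show (p - 2) * -(2 / (p - 2)) = -2 by field_simp,
      Real.rpow_neg hb.le]
    norm_cast
  rw [h2] at h1
  have h3 : rho p b 0 = b ^ (p - 2) := by simp [rho, abs_of_pos hb]
  rw [hl, h3]
  simp only [neg_zero, Real.exp_zero, mul_one]
  calc _ ≤ (2 * p) ^ (1 / (p - 2)) * b * (b ^ 2)⁻¹ := by gcongr
    _ = _ := by field_simp

/-- Half-line solutions with a far away peak carry almost the mass of a full soliton. -/
theorem exists_halfLineMass_gt (hp : 2 < p) {Λ : ℝ} (hΛ : Λ < 2 * calib p (peak p)) :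
    ∃ B : ℝ, ∀ b, B ≤ |b| → Λ < (1 / 2 - 1 / p) * halfLineMass p b := by
  have hlim : Tendsto (fun b : ℝ => 2 * calib p (peak p) -
      calib p ((2 * p) ^ (1 / (p - 2)) / b)) atTop (𝓝 (2 * calib p (peak p) - calib p 0)) :=
    tendsto_const_nhds.sub (((continuous_calib hp).tendsto 0).comp
      (tendsto_const_nhds.div_atTop tendsto_id))
  rw [calib_zero, sub_zero] at hlim
  obtain ⟨B, hB⟩ := eventually_atTop.1 ((hlim.eventually_const_lt hΛ).and (eventually_ge_atTop 1))
  have key : ∀ b, B ≤ b → Λ < (1 / 2 - 1 / p) * halfLineMass p b := fun b hb => by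
    obtain ⟨h1, h2⟩ := hB b hb
    have hb0 : 0 < b := by linarith
    have h3 := halfLineAction_ge_of_one_le hp h2
    have h4 := calib_mono hp (hl_zero_le_div hp hb0)
    have h5 := halfLineAction_eq hp b
    have h6 := mul_nonneg (hl'_nonneg hp h2) (hl_pos hp hb0 0).le
    linarith
  refine ⟨B, fun b hb => ?_⟩
  rcases abs_cases b with ⟨h, -⟩ | ⟨h, -⟩
  · exact key b (h ▸ hb)
  · rw [← halfLineMass_neg]
    exact key (-b) (h ▸ hb)

/-- Nontrivial data must reach the equilibrium height somewhere or have `1 ≤ |b|`. This keeps a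
minimizing family away from the zero function. -/
theorem exists_norm_ge (hp : 2 < p) (hℓ : 0 < ℓ) : ∃ r : ℝ, 0 < r ∧
    ∀ (b : ℝ) (d : Fin P → ℝ), Matching p ℓ b d → (b ≠ 0 ∨ ∃ i, d i ≠ 0) → r ≤ ‖(b, d)‖ := by
  obtain ⟨L, hL, h⟩ := sol_dist_le hp 1 ℓ
  refine ⟨min 1 (1 / L), by positivity, fun b d hm hne => ?_⟩
  rw [Prod.norm_def]
  rcases hm.exists_one_le hp hℓ hne with h1 | ⟨i, t, ht, h1⟩
  · exact (min_le_left _ _).trans (h1.trans (le_max_left _ _))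
  · refine le_trans ?_ ((norm_le_pi_norm d i).trans (le_max_right _ _))
    rw [Real.norm_eq_abs]
    rcases le_total 1 |d i| with h2 | h2
    · exact (min_le_left _ _).trans h2
    · refine (min_le_right _ _).trans ?_
      have h3 := (h (d i) 0 0 0 h2 (by simp) (by simp) (by simp) t
        (by rw [abs_of_nonneg ht.1]; exact ht.2)).1
      rw [(sol_equilibrium hp force_zero t).1, sub_zero, sub_zero, sub_zero, abs_zero,
        max_eq_left (abs_nonneg _)] at h3
      rw [div_le_iff₀ hL]
      linarith

theorem isClosed_matching (hp : 2 < p) :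
    IsClosed {z : ℝ × (Fin P → ℝ) | Matching p ℓ z.1 z.2} := by
  have hl0 : Continuous fun z : ℝ × (Fin P → ℝ) => hl p z.1 0 :=
    (continuous_hl_left hp 0).comp continuous_fst
  have hr : Continuous fun z : ℝ × (Fin P → ℝ) => rho p z.1 0 := by
    unfold rho
    exact ((continuous_abs.rpow_const fun _ => Or.inr (by linarith)).comp continuous_fst).mul
      continuous_const
  have hl1 : Continuous fun z : ℝ × (Fin P → ℝ) => hl' p z.1 0 := by
    unfold hl'
    refine hl0.mul ((hr.sub continuous_const).div (hr.add continuous_const) fun z => ?_)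
    have := rho_nonneg (p := p) z.1 0
    positivity
  have hd : ∀ i, Continuous fun z : ℝ × (Fin P → ℝ) => z.2 i := fun i =>
    (continuous_apply i).comp continuous_snd
  simp only [Matching, ofPred_and, ofPred_forall]
  refine (isClosed_iInter fun i => isClosed_eq
    (Continuous.sol hp (hd i) continuous_const continuous_const) hl0).inter
    (isClosed_eq hl1 (continuous_finsetSum _ fun i _ =>
      Continuous.sol' hp (hd i) continuous_const continuous_const))

/-- On matching data the action is a multiple of the continuous function `N`, to be minimized over a
sublevel set. That set is closed and stays away from `0`; the mass bounds `d`, and a level below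
`2K` bounds `b`, since otherwise nearly a full soliton would sit far out on the half-line. -/
theorem exists_isGroundState (hp : 2 < p) (hℓ : 0 < ℓ) (hu : IsBoundState p ℓ u)
    (hact : action p ℓ u < 2 * calib p (peak p)) : ∃ v : ForkFun P, IsGroundState p ℓ v := by
  have hκ := pot_one_pos hp
  obtain ⟨b₀, d₀, hm₀, hne₀, hsame₀⟩ := IsBoundState.exists_fork hp hℓ hu
  rw [action_congr hsame₀] at hact
  set Λ := action p ℓ (fork p ℓ b₀ d₀) with hΛ
  obtain ⟨B, hB⟩ := exists_halfLineMass_gt hp hact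
  obtain ⟨r, hr, hrn⟩ := exists_norm_ge (P := P) hp hℓ
  set N : ℝ × (Fin P → ℝ) → ℝ := fun z => halfLineMass p z.1 + ∑ i, pendantMass p ℓ (z.2 i)
    with hN
  have hNc : Continuous N := ((continuous_halfLineMass hp).comp continuous_fst).add
    (continuous_finsetSum _ fun i _ => (continuous_pendantMass hp).comp
      ((continuous_apply i).comp continuous_snd))
  set X : Set (ℝ × (Fin P → ℝ)) := {z | Matching p ℓ z.1 z.2} ∩
    ({z | r ≤ ‖z‖} ∩ {z | (1 / 2 - 1 / p) * N z ≤ Λ}) with hX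
  have hmemX : ∀ b d, Matching p ℓ b d → (b ≠ 0 ∨ ∃ i, d i ≠ 0) →
      action p ℓ (fork p ℓ b d) ≤ Λ → (b, d) ∈ X := fun b d hm hne hle =>
    ⟨hm, hrn b d hm hne, by rw [hm.action_eq hp hℓ.le] at hle; exact hle⟩
  have hclosed : IsClosed X := (isClosed_matching hp).inter
    ((isClosed_le continuous_const continuous_norm).inter
      (isClosed_le (continuous_const.mul hNc) continuous_const))
  set D := peak p + (ℓ + Λ / (1 / 2 - 1 / p)) / 2 with hD
  have hsub : X ⊆ Metric.closedBall 0 (max B D) := by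
    rintro ⟨b, d⟩ ⟨hm, -, hle⟩
    have hm : Matching p ℓ b d := hm
    have hle : (1 / 2 - 1 / p) * (halfLineMass p b + ∑ i, pendantMass p ℓ (d i)) ≤ Λ := hle
    have h0 : 0 ≤ ∑ i, pendantMass p ℓ (d i) :=
      Finset.sum_nonneg fun i _ => pendantMass_nonneg hℓ.le _
    have hNle : halfLineMass p b + ∑ i, pendantMass p ℓ (d i) ≤ Λ / (1 / 2 - 1 / p) := by
      rwa [le_div_iff₀ hκ, mul_comm]
    have hDd : ∀ i, |d i| ≤ D := fun i => by
      have := hm.abs_sol_le hp hℓ.le i (left_mem_Icc.2 hℓ.le)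
      rw [sol_zero hp] at this
      linarith
    have hD0 : 0 ≤ D := by
      have := halfLineMass_nonneg (p := p) b
      have := one_lt_peak hp
      have : 0 ≤ Λ / (1 / 2 - 1 / p) := by linarith
      positivity
    rw [mem_closedBall_zero_iff, Prod.norm_def]
    refine max_le_max ?_ ((pi_norm_le_iff_of_nonneg hD0).2 hDd)
    by_contra! h
    have h1 := hB b h.le
    have h2 := mul_nonneg hκ.le h0
    rw [mul_add] at hle
    linarith
  have hcomp : IsCompact X := (isCompact_closedBall _ _).of_isClosed_subset hclosed hsub
  obtain ⟨⟨b, d⟩, hbd, hmin⟩ := hcomp.exists_isMinOn ⟨(b₀, d₀), hmemX b₀ d₀ hm₀ hne₀ le_rfl⟩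
    hNc.continuousOn
  rw [isMinOn_iff] at hmin
  obtain ⟨hm, hnorm, hle⟩ := hbd
  have hm : Matching p ℓ b d := hm
  have hle' : action p ℓ (fork p ℓ b d) ≤ Λ := by
    rw [hm.action_eq hp hℓ.le]
    exact hle
  have hne : b ≠ 0 ∨ ∃ i, d i ≠ 0 := by
    by_contra! h
    have hd : d = 0 := funext h.2
    have hnorm : r ≤ ‖(b, d)‖ := hnorm
    rw [h.1, hd, Prod.mk_zero_zero, norm_zero] at hnorm
    linarith
  refine ⟨fork p ℓ b d, isBoundState_fork hp hℓ.le hm hne, fun v hv => ?_⟩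
  obtain ⟨b', d', hm', hne', hsame'⟩ := IsBoundState.exists_fork hp hℓ hv
  rw [action_congr hsame']
  rcases le_total (action p ℓ (fork p ℓ b' d')) Λ with h | h
  · have := hmin _ (hmemX b' d' hm' hne' h)
    rw [hm.action_eq hp hℓ.le, hm'.action_eq hp hℓ.le]
    exact mul_le_mul_of_nonneg_left this hκ.le
  · exact hle'.trans h

end Fork

namespace Fork

open ForkFun

variable {p : ℝ} {P : ℕ} {ℓ : ℝ} {u : ForkFun P}

/-! ### Symmetric bound-states on long pendants -/

/-- As long as the solution stays above `s`, its slope falls at rate at least `-force p s`, and on a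
long pendant it would fall below `-peak p`. -/
theorem exists_sol_lt (hp : 2 < p) (hℓ : 0 < ℓ) {δ s : ℝ} (hs : 1 < s)
    (hd : -peak p ≤ sol' p δ 0 ℓ) (hlarge : peak p < ℓ * -force p s) :
    ∃ t ∈ Icc 0 ℓ, sol p δ 0 t < s := by
  have hss := isSol_sol hp δ 0
  by_contra! h
  have h3 := (convex_Icc 0 ℓ).image_sub_le_mul_sub_of_deriv_le
    (f := sol' p δ 0) hss.continuous'.continuousOn
    (fun t _ => (hss t).2.differentiableAt.differentiableWithinAt)
    (C := force p s) (fun t ht => by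
      rw [(hss t).2.deriv]
      exact (force_strictAntiOn hp).antitoneOn (mem_Ici.2 (by linarith))
        (mem_Ici.2 (by linarith [h t (interior_subset ht)])) (h t (interior_subset ht)))
    0 (left_mem_Icc.2 hℓ.le) ℓ (right_mem_Icc.2 hℓ.le) hℓ.le
  rw [sol'_zero hp, sub_zero, sub_zero] at h3
  linarith

/-- The slope at the vertex is negative, so the pendant solution cannot stay below `1`, where `v w`
only grows from `0`. At its maximum it is at rest at height at least `1` with potential `pot δ < pot
a`, hence above `a`. -/
theorem Matching.exists_sol_gt (hp : 2 < p) (hP : 2 ≤ P) (hℓ : 0 < ℓ) {b δ a : ℝ}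
    (hm : Matching p ℓ b (fun _ : Fin P => δ)) (hb : 0 < b) (hb1 : b < 1) (hc1 : hl p b 0 < 1)
    (hF : pot p δ < pot p a) : ∃ t ∈ Icc 0 ℓ, a < sol p δ 0 t := by
  obtain ⟨h1, h2⟩ := (Matching.symm_iff hP).1 hm
  have hE := Matching.symm_energy hp hP hm
  have hss := isSol_sol hp δ 0
  have hP2 : (2 : ℝ) ≤ P := by exact_mod_cast hP
  have hl'neg : hl' p b 0 < 0 :=
    (hl'_neg_iff hp hb).2 (rho_lt_one hp (by rwa [abs_of_pos hb]) le_rfl)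
  have hFcpos : 0 < pot p (hl p b 0) :=
    pot_pos hp (hl_pos hp hb 0) (hc1.trans (one_lt_peak hp))
  have hvpos : ∀ t, 0 < sol p δ 0 t := by
    refine hss.pos_of_energy_neg hp (s := ℓ) ?_ (by rw [h1]; exact hl_pos hp hb 0)
    have h3 := sol_energy hp δ ℓ
    have h4 : 0 < pot p δ := by
      rw [hE]
      exact mul_pos (theta_pos hP) hFcpos
    linarith only [h3, h4]
  obtain ⟨τ, hτ, hmax⟩ := (isCompact_Icc (a := (0 : ℝ)) (b := ℓ)).exists_isMaxOn
    (nonempty_Icc.2 hℓ.le) hss.continuous.continuousOn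
  rw [isMaxOn_iff] at hmax
  have hτ1 : 1 ≤ sol p δ 0 τ := by
    by_contra! h
    have h3 := sol_mul_nonneg hp hℓ.le (d := δ) fun t ht => by
      rw [abs_of_pos (hvpos t)]
      exact (hmax t ht).trans_lt h
    rw [h1] at h3
    have h4 : sol' p δ 0 ℓ < 0 := by
      rw [h2] at hl'neg
      exact neg_of_mul_neg_right hl'neg (by linarith only [hP2])
    have := mul_neg_of_pos_of_neg (hl_pos hp hb 0) h4
    linarith only [this, h3]
  have hwτ : sol' p δ 0 τ = 0 := by
    rcases hτ.1.eq_or_lt with h | h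
    · rw [← h, sol'_zero hp]
    · have hτℓ : τ < ℓ := by
        refine hτ.2.lt_of_ne ?_
        rintro rfl
        rw [h1] at hτ1
        linarith only [hτ1, hc1]
      have hlm : IsLocalMax (sol p δ 0) τ := by
        filter_upwards [Ioo_mem_nhds h hτℓ] with x hx
        exact hmax x (Ioo_subset_Icc_self hx)
      exact hlm.hasDerivAt_eq_zero (hss τ).1
  have hFτ := sol_energy hp δ τ
  rw [hwτ] at hFτ
  refine ⟨τ, hτ, ?_⟩
  by_contra! h
  have h3 := pot_anti_high hp hτ1 h
  linarith only [h3, hFτ, hF]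

/-- A lower bound for the action of symmetric solutions in terms of three levels
`a₀ < 1 < s` and `a₁`, when the pendants are long. -/
theorem Matching.min_le_action_of_symmetric (hp : 2 < p) (hP : 2 ≤ P) (hℓ : 0 < ℓ)
    {b δ a₀ a₁ s : ℝ} (hm : Matching p ℓ b (fun _ : Fin P => δ)) (hb : 0 < b)
    (ha₀ : a₀ ∈ Ioo 0 1) (hs : 1 < s)
    (hlarge : peak p < ℓ * -force p s)
    (hFc : pot p (hl p b 0) < min (pot p a₀) (pot p a₁)) :
    min (calib p a₁ + 2 * (calib p a₁ - calib p s))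
      (min (2 * calib p (peak p) - calib p a₀) (2 * (calib p a₁ - calib p a₀))) ≤
      halfLineAction p b + 2 * pendantAction p ℓ δ := by
  obtain ⟨h1, h2⟩ := (Matching.symm_iff hP).1 hm
  have hE := Matching.symm_energy hp hP hm
  have hFδ : pot p δ ≤ pot p (hl p b 0) := by
    rw [hE]
    exact mul_le_of_le_one_left (pot_hl_nonneg hp b 0) (theta_lt_one hP).le
  have hFv0 : ∀ t ∈ Icc 0 ℓ, 0 ≤ pot p (sol p δ 0 t) := fun t _ => by
    have h3 : 0 ≤ pot p δ := by
      rw [hE]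
      exact mul_nonneg (theta_pos hP).le (pot_hl_nonneg hp b 0)
    have h4 := sol_energy hp δ t
    have h5 := sq_nonneg (sol' p δ 0 t)
    linarith only [h3, h4, h5]
  have hSp0 := pendantAction_nonneg_of_pot hℓ.le hFv0
  have hSh := halfLineAction_nonneg hp b
  have hcalib : ∀ t ∈ Icc 0 ℓ,
      |calib p (hl p b 0) - calib p (sol p δ 0 t)| ≤ pendantAction p ℓ δ := fun t ht => by
    rw [← h1]
    exact abs_calib_sub_le_pendantAction hp ht hFv0
  -- If the vertex is high, then `a₁ < c`: the half-line costs `calib a₁` and two pendants descend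
  -- below `s`. If it is low, then `c < a₀`: either the peak lies on the half-line, or two pendants
  -- climb above `a₁`.
  rcases le_or_gt 1 (hl p b 0) with hc1 | hc1
  · refine (min_le_left _ _).trans ?_
    have hca : a₁ < hl p b 0 := by
      by_contra! h
      exact absurd (hFc.trans_le (min_le_right _ _)) (not_lt.2 (pot_anti_high hp hc1 h))
    have hKac := calib_mono hp hca.le
    obtain ⟨t, ht, hvt⟩ := exists_sol_lt hp hℓ (δ := δ) hs (by
      have h4 := neg_abs_le (hl' p b 0)
      have h5 := (abs_hl'_le (p := p) b 0).trans (abs_hl_le_peak hp b 0)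
      rw [h2] at h4 h5
      have h7 : (2 : ℝ) ≤ P := by exact_mod_cast hP
      have h8 := one_lt_peak hp
      by_contra! h
      have h9 : (P : ℝ) * sol' p δ 0 ℓ ≤ 1 * sol' p δ 0 ℓ :=
        mul_le_mul_of_nonpos_right (by linarith only [h7]) (by linarith only [h, h8])
      linarith only [h4, h5, h9, h]) hlarge
    have h3 := hcalib t ht
    have h4 := le_abs_self (calib p (hl p b 0) - calib p (sol p δ 0 t))
    have h5 := calib_mono hp hvt.le
    have h6 := calib_le_halfLineAction hp b
    linarith only [h3, h4, h5, h6, hKac]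
  · refine (min_le_right _ _).trans ?_
    have hca : hl p b 0 < a₀ := by
      by_contra! h
      exact absurd (hFc.trans_le (min_le_left _ _))
        (not_lt.2 (pot_mono_low hp ha₀.1.le h hc1.le))
    have hKac := calib_mono hp hca.le
    rcases le_or_gt 1 b with hb1 | hb1
    · refine (min_le_left _ _).trans ?_
      have := halfLineAction_ge_of_one_le hp hb1
      linarith only [this, hKac, hSp0]
    · refine (min_le_right _ _).trans ?_
      obtain ⟨t, ht, hvt⟩ := hm.exists_sol_gt hp hP hℓ hb hb1 hc1
        (hFδ.trans_lt (hFc.trans_le (min_le_right _ _)))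
      have h3 := hcalib t ht
      have h4 := neg_abs_le (calib p (hl p b 0) - calib p (sol p δ 0 t))
      have h5 := calib_mono hp hvt.le
      linarith only [h3, h4, h5, hKac, hSh]

/-- With `s` fixed, as `a₀` tends to `0` and `a₁` to the peak the three costs tend to `3K - 2 calib
s`, `2K` and `2K`, all larger than `K`. -/
theorem exists_calib_levels (hp : 2 < p) : ∃ a₀ a₁ s : ℝ, a₀ ∈ Ioo 0 1 ∧ a₁ ∈ Ioo 1 (peak p) ∧
    1 < s ∧ calib p (peak p) < min (calib p a₁ + 2 * (calib p a₁ - calib p s))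
      (min (2 * calib p (peak p) - calib p a₀) (2 * (calib p a₁ - calib p a₀))) := by
  have hpk := one_lt_peak hp
  set K := calib p (peak p) with hK
  have hK0 : 0 < K := calib_pos hp (by linarith)
  set s := (1 + peak p) / 2 with hs
  have hg : calib p s < K :=
    calib_strictMonoOn hp ⟨by linarith, by linarith⟩ ⟨by linarith, le_rfl⟩ (by linarith)
  obtain ⟨a₁, ha₁, hKa₁, hKa₁'⟩ : ∃ a ∈ Ioo 1 (peak p),
      K - (K - calib p s) / 4 < calib p a ∧ 7 / 8 * K < calib p a := by
    have h1 : ∀ᶠ a in 𝓝[<] (peak p), a ∈ Ioo 1 (peak p) := Ioo_mem_nhdsLT hpk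
    have hc := ((continuous_calib hp).tendsto (peak p)).mono_left
      (nhdsWithin_le_nhds (s := Iio (peak p)))
    exact (h1.and ((hc.eventually_const_lt
      (show K - (K - calib p s) / 4 < K by linarith)).and
      (hc.eventually_const_lt (show 7 / 8 * K < K by linarith)))).exists
  obtain ⟨a₀, ha₀, hKa₀⟩ : ∃ a ∈ Ioo (0 : ℝ) 1, calib p a < K / 8 := by
    have h1 : ∀ᶠ a in 𝓝[>] (0 : ℝ), a ∈ Ioo (0 : ℝ) 1 := Ioo_mem_nhdsGT one_pos
    have hc := ((continuous_calib hp).tendsto 0).mono_left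
      (nhdsWithin_le_nhds (s := Ioi (0 : ℝ)))
    exact (h1.and (hc.eventually_lt_const
      (show calib p 0 < K / 8 by rw [calib_zero]; linarith))).exists
  exact ⟨a₀, a₁, s, ha₀, ha₁, by linarith, lt_min (by linarith)
    (lt_min (by linarith) (by linarith))⟩

/-- On long pendants, the action of core-symmetric bound-states stays away from the action of half
a soliton. -/
theorem exists_lt_action_of_symmetric (hp : 2 < p) (hP : 2 ≤ P) :
    ∃ Λ ℓ₁ : ℝ, calib p (peak p) < Λ ∧ Λ < 2 * calib p (peak p) ∧ 0 < ℓ₁ ∧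
      ∀ ℓ, ℓ₁ < ℓ → ∀ u : ForkFun P, IsBoundState p ℓ u → IsCoreSymmetric ℓ u →
        Λ ≤ action p ℓ u := by
  obtain ⟨a₀, a₁, s, ha₀, ha₁, hs, hlev⟩ := exists_calib_levels hp
  have hK0 : 0 < calib p (peak p) := calib_pos hp (by linarith [one_lt_peak hp])
  set Λ := min (calib p a₁ + 2 * (calib p a₁ - calib p s))
      (min (2 * calib p (peak p) - calib p a₀) (2 * (calib p a₁ - calib p a₀))) with hΛ
  set η := min (pot p a₀) (pot p a₁) with hη
  have hη0 : 0 < η := lt_min (pot_pos hp ha₀.1 (ha₀.2.trans (one_lt_peak hp)))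
    (pot_pos hp (one_pos.trans ha₁.1) ha₁.2)
  have hΛ2 : Λ < 2 * calib p (peak p) := by
    have h1 := (min_le_right _ _ : Λ ≤ _).trans (min_le_left _ _)
    have h2 := calib_pos hp ha₀.1
    linarith only [h1, h2]
  set θ := 1 - 1 / (P : ℝ) ^ 2 with hθ
  have hθη : 0 < θ * η := mul_pos (theta_pos hP) hη0
  have hfs : force p s < 0 := force_neg_of_one_lt hp hs
  have hP2 : (2 : ℝ) ≤ P := by exact_mod_cast hP
  -- Beyond the first length, a pendant on which the potential stays at least `θ * η` alone costs
  -- more than `Λ`; the second makes it impossible to stay above `s`.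
  refine ⟨Λ, max (Λ / (θ * η)) (peak p / -force p s), hlev, hΛ2,
    lt_max_of_lt_left (div_pos (hK0.trans hlev) hθη), fun ℓ hℓ u hu hsym => ?_⟩
  have hℓ1 := (le_max_left _ _).trans_lt hℓ
  have hℓ2 := (le_max_right _ _).trans_lt hℓ
  have hℓ0 : 0 < ℓ := (div_pos (hK0.trans hlev) hθη).trans hℓ1
  rw [div_lt_iff₀ hθη] at hℓ1
  rw [div_lt_iff₀ (by linarith)] at hℓ2
  have key : ∀ b δ : ℝ, 0 < b → Matching p ℓ b (fun _ : Fin P => δ) →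
      Λ ≤ action p ℓ (fork p ℓ b fun _ : Fin P => δ) := fun b δ hb hm => by
    have hE := Matching.symm_energy hp hP hm
    have hFv : ∀ t, pot p δ ≤ pot p (sol p δ 0 t) := fun t => by
      have h1 := sol_energy hp δ t
      have h2 := sq_nonneg (sol' p δ 0 t)
      linarith only [h1, h2]
    have hact : action p ℓ (fork p ℓ b fun _ : Fin P => δ) =
        halfLineAction p b + P * pendantAction p ℓ δ := by
      rw [action_fork hp hℓ0.le]
      simp
    have hFδ : 0 ≤ pot p δ := by
      rw [hE]
      exact mul_nonneg (theta_pos hP).le (pot_hl_nonneg hp b 0)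
    have hSp0 := pendantAction_nonneg_of_pot hℓ0.le fun t _ => hFδ.trans (hFv t)
    have hSpP := mul_le_mul_of_nonneg_right hP2 hSp0
    have hSh := halfLineAction_nonneg hp b
    rw [hact]
    rcases lt_or_ge (pot p (hl p b 0)) η with hFc | hFc
    · have := hm.min_le_action_of_symmetric hp hP hℓ0 hb ha₀ hs hℓ2 hFc
      linarith only [this, hSpP, hΛ]
    · have h1 : ∫ _ in 0..ℓ, pot p δ ≤ pendantAction p ℓ δ := by
        refine intervalIntegral.integral_mono_on hℓ0.le
          (continuous_const.intervalIntegrable _ _)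
          (((isSol_sol hp δ 0).continuous_lagrangian hp).intervalIntegrable _ _) fun t _ => ?_
        have h1 := hFv t
        have h2 := sq_nonneg (sol' p δ 0 t)
        linarith only [h1, h2]
      simp only [intervalIntegral.integral_const, sub_zero, smul_eq_mul] at h1
      have h2 : θ * η ≤ pot p δ := by
        rw [hE]
        exact mul_le_mul_of_nonneg_left hFc (theta_pos hP).le
      have h3 := mul_le_mul_of_nonneg_left h2 hℓ0.le
      linarith only [h1, h3, hSpP, hSh, hℓ1, hSp0]
  obtain ⟨b, δ, hm, hne, hsame⟩ := exists_forkFun_of_symmetric hp hP hℓ0 hu hsym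
  rw [action_congr hsame]
  rcases lt_trichotomy b 0 with hb | hb | hb
  · have := key (-b) (-δ) (by linarith) (hm.neg hp)
    rwa [fork_neg hp b (fun _ => δ), action_neg] at this
  · exfalso
    obtain ⟨h1, h2⟩ := (Matching.symm_iff hP).1 hm
    rw [hb, hl_zero_left] at h1
    rw [hb, hl'_zero_left] at h2
    have h3 : sol' p δ 0 ℓ = 0 := by
      rcases mul_eq_zero.1 h2.symm with h | h
      · linarith
      · exact h
    have := ((isSol_sol hp δ 0).eq_const hp (s := ℓ) (by rw [h1, force_zero]) h3 0).1
    rw [h1, sol_zero hp] at this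
    rcases hne with h | h
    · exact h hb
    · exact h this
  · exact key b δ hb hm

end Fork

namespace Fork

open ForkFun

variable {p : ℝ} {P : ℕ} {ℓ : ℝ} {u : ForkFun P}

/-! ### Bound-states concentrated on one long pendant -/

theorem sol_pos_of_lt_one (hp : 2 < p) {σ : ℝ} (hσ : 0 < σ) (hσ1 : σ < 1) (t : ℝ) :
    0 < sol p σ 0 t := by
  refine (isSol_sol hp σ 0).pos_of_energy_neg hp (s := 0) ?_ (by rwa [sol_zero hp]) t
  rw [sol_zero hp, sol'_zero hp]
  have := pot_pos hp hσ (hσ1.trans (one_lt_peak hp))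
  linarith

theorem sol'_strictMonoOn (hp : 2 < p) {σ : ℝ} (hσ : 0 < σ) (hσ1 : σ < 1)
    (hv : ∀ t ∈ Icc 0 ℓ, sol p σ 0 t < 1) : StrictMonoOn (sol' p σ 0) (Icc 0 ℓ) := by
  refine strictMonoOn_of_hasDerivWithinAt_pos (convex_Icc 0 ℓ)
    (continuous_sol' hp σ 0).continuousOn
    (fun x _ => (isSol_sol hp σ 0 x).2.hasDerivWithinAt) fun x hx => ?_
  exact force_pos hp (sol_pos_of_lt_one hp hσ hσ1 x) (hv x (interior_subset hx))

theorem sol'_nonneg_of_lt_one (hp : 2 < p) {σ : ℝ} (hσ : 0 < σ) (hσ1 : σ < 1)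
    (hv : ∀ t ∈ Icc 0 ℓ, sol p σ 0 t < 1) {t : ℝ} (ht : t ∈ Icc 0 ℓ) : 0 ≤ sol' p σ 0 t := by
  have := (sol'_strictMonoOn hp hσ hσ1 hv).monotoneOn (left_mem_Icc.2 (ht.1.trans ht.2)) ht ht.1
  rwa [sol'_zero hp] at this

theorem sol_monotoneOn (hp : 2 < p) {σ : ℝ} (hσ : 0 < σ) (hσ1 : σ < 1)
    (hv : ∀ t ∈ Icc 0 ℓ, sol p σ 0 t < 1) : MonotoneOn (sol p σ 0) (Icc 0 ℓ) :=
  monotoneOn_of_hasDerivWithinAt_nonneg (convex_Icc 0 ℓ) (continuous_sol hp σ 0).continuousOn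
    (fun x _ => (isSol_sol hp σ 0 x).1.hasDerivWithinAt)
    fun _ hx => sol'_nonneg_of_lt_one hp hσ hσ1 hv (interior_subset hx)

theorem sol'_le_sqrt (hp : 2 < p) {σ : ℝ} (hσ : 0 ≤ pot p σ) (t : ℝ) :
    sol' p σ 0 t ≤ √(2 * pot p (sol p σ 0 t)) := by
  refine Real.le_sqrt_of_sq_le ?_
  rw [sol_energy hp]
  linarith

/-- Small solutions have small action. -/
theorem pendantAction_le_of_small (hp : 2 < p) (hℓ : 0 ≤ ℓ) {σ : ℝ}
    (hv : ∀ t ∈ Icc 0 ℓ, |sol p σ 0 t| ^ (p - 2) ≤ 1 / 2) :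
    pendantAction p ℓ σ ≤ sol p σ 0 ℓ * sol' p σ 0 ℓ := by
  have hs := isSol_sol hp σ 0
  have hc : Continuous fun t => sol' p σ 0 t * sol' p σ 0 t + sol p σ 0 t * force p (sol p σ 0 t) :=
    (hs.continuous'.mul hs.continuous').add
      (hs.continuous.mul ((continuous_force hp).comp hs.continuous))
  have h := intervalIntegral.integral_eq_sub_of_hasDerivAt (a := 0) (b := ℓ)
    (fun t _ => ((hs t).1.mul (hs t).2)) (hc.intervalIntegrable _ _)
  simp only [Pi.mul_apply, sol'_zero hp, mul_zero, sub_zero] at h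
  rw [← h]
  -- The right-hand integrand is `(v w)' = w² + v² (1 - |v|^(p-2))`, and `|v|^(p-2) ≤ 1/2` leaves at
  -- least `w² + v²/2`.
  refine intervalIntegral.integral_mono_on hℓ ((hs.continuous_lagrangian hp).intervalIntegrable _ _)
    (hc.intervalIntegrable _ _) fun t ht => ?_
  have h1 := pot_le_sq hp (sol p σ 0 t)
  have h2 : sol p σ 0 t * force p (sol p σ 0 t) =
      sol p σ 0 t ^ 2 * (1 - |sol p σ 0 t| ^ (p - 2)) := by
    rw [force]
    ring
  have h3 := mul_le_mul_of_nonneg_left (hv t ht) (sq_nonneg (sol p σ 0 t))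
  have h4 := sq_nonneg (sol' p σ 0 t)
  rw [h2]
  linarith only [h1, h3, h4]

/-- An upper bound for the action of increasing solutions of nonnegative energy `E`. -/
theorem IsSol.integral_lagrangian_le (hp : 2 < p) (hℓ : 0 ≤ ℓ) {v w : ℝ → ℝ} (h : IsSol p v w)
    {E : ℝ} (hE0 : 0 ≤ E) (hE : ∀ t, w t ^ 2 = 2 * pot p (v t) + 2 * E)
    (hw : ∀ t ∈ Icc 0 ℓ, 0 ≤ w t) :
    ∫ t in 0..ℓ, (w t ^ 2 / 2 + pot p (v t)) ≤
      calib p (v ℓ) - calib p (v 0) + √(2 * E) * (v ℓ - v 0) := by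
  have hd : ∀ t, HasDerivAt (fun t => calib p (v t) + √(2 * E) * v t)
      (√(2 * pot p (v t)) * w t + √(2 * E) * w t) t := fun t =>
    ((hasDerivAt_calib hp (v t)).comp t (h t).1).add ((h t).1.const_mul _)
  have hc : Continuous fun t => √(2 * pot p (v t)) * w t + √(2 * E) * w t :=
    (((continuous_sqrt_pot hp).comp h.continuous).mul h.continuous').add
      (continuous_const.mul h.continuous')
  have hi := intervalIntegral.integral_eq_sub_of_hasDerivAt (a := 0) (b := ℓ) (fun t _ => hd t)
    (hc.intervalIntegrable _ _)
  have : calib p (v ℓ) - calib p (v 0) + √(2 * E) * (v ℓ - v 0) =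
      calib p (v ℓ) + √(2 * E) * v ℓ - (calib p (v 0) + √(2 * E) * v 0) := by ring
  rw [this, ← hi]
  refine intervalIntegral.integral_mono_on hℓ ((h.continuous_lagrangian hp).intervalIntegrable _ _)
    (hc.intervalIntegrable _ _) fun t ht => ?_
  have h1 : w t ≤ √(2 * pot p (v t)) + √(2 * E) := by
    rw [← Real.sqrt_sq (hw t ht), hE]
    refine Real.sqrt_le_iff.2 ⟨by positivity, ?_⟩
    have h2 : 2 * pot p (v t) ≤ √(2 * pot p (v t)) ^ 2 := by
      rcases le_total 0 (2 * pot p (v t)) with h | h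
      · rw [Real.sq_sqrt h]
      · exact h.trans (sq_nonneg _)
    have h3 := Real.sq_sqrt (show 0 ≤ 2 * E by linarith)
    have h4 : 0 ≤ √(2 * pot p (v t)) * √(2 * E) := by positivity
    rw [add_sq]
    linarith only [h2, h3, h4]
  have h2 := mul_le_mul_of_nonneg_right h1 (hw t ht)
  have h3 := hE t
  linarith only [h2, h3, hE0]

/-- Increasing solutions of nonnegative energy cross any level `s ∈ (1, peak)` and turn back within
bounded time. -/
theorem IsSol.not_long_rise (hp : 2 < p) (hℓ : 0 < ℓ) {v w : ℝ → ℝ} (h : IsSol p v w)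
    {ε s C : ℝ} (hε : 0 < ε) (hs : 1 < s)
    (hE : ∀ t, 2 * pot p (v t) ≤ w t ^ 2) (hC : ∀ t ∈ Icc 0 ℓ, w t ≤ C) (h0 : ε ≤ v 0)
    (hw : ∀ t ∈ Icc 0 ℓ, 0 ≤ w t) (h1 : s < √(2 * min (pot p ε) (pot p s)) * (ℓ / 2))
    (h2 : C < -force p s * (ℓ / 2)) : False := by
  have hmono : MonotoneOn v (Icc 0 ℓ) :=
    monotoneOn_of_hasDerivWithinAt_nonneg (convex_Icc 0 ℓ) h.continuous.continuousOn
      (fun x _ => (h x).1.hasDerivWithinAt) fun _ hx => hw _ (interior_subset hx)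
  have hmid : ℓ / 2 ∈ Icc 0 ℓ := ⟨by linarith, by linarith⟩
  have hsub1 : Icc 0 (ℓ / 2) ⊆ Icc 0 ℓ := Icc_subset_Icc_right hmid.2
  have hsub2 : Icc (ℓ / 2) ℓ ⊆ Icc 0 ℓ := Icc_subset_Icc_left hmid.1
  -- While the height lies in `[ε, s]` the speed is bounded below, so the first half of the interval
  -- suffices to reach `s`. In the second half the force is at most `force p s` and would drive the
  -- slope below `0`.
  have hvs : s ≤ v (ℓ / 2) := by
    by_contra! hlt
    have h3 := (convex_Icc 0 (ℓ / 2)).mul_sub_le_image_sub_of_le_deriv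
      h.continuous.continuousOn
      (fun t _ => (h t).1.differentiableAt.differentiableWithinAt)
      (C := √(2 * min (pot p ε) (pot p s))) (fun t ht => by
        have ht' := interior_subset ht
        rw [(h t).1.deriv]
        refine Real.sqrt_le_iff.2 ⟨hw t (hsub1 ht'), le_trans ?_ (hE t)⟩
        have h4 := hmono (left_mem_Icc.2 hℓ.le) (hsub1 ht') ht'.1
        have h5 := hmono (hsub1 ht') hmid ht'.2
        have h6 := pot_ge_min hp hε.le (b := v t) (c := s) ⟨h0.trans h4, h5.trans hlt.le⟩
        linarith only [h6])
      0 (left_mem_Icc.2 hmid.1) (ℓ / 2) (right_mem_Icc.2 hmid.1) hmid.1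
    rw [sub_zero] at h3
    linarith only [h3, h1, h0, hε, hlt]
  have h3 := (convex_Icc (ℓ / 2) ℓ).image_sub_le_mul_sub_of_deriv_le
    h.continuous'.continuousOn
    (fun t _ => (h t).2.differentiableAt.differentiableWithinAt)
    (C := force p s) (fun t ht => by
      have ht' := interior_subset ht
      have h4 := hvs.trans (hmono hmid (hsub2 ht') ht'.1)
      rw [(h t).2.deriv]
      exact (force_strictAntiOn hp).antitoneOn (mem_Ici.2 hs.le)
        (mem_Ici.2 (hs.le.trans h4)) h4)
    (ℓ / 2) (left_mem_Icc.2 hmid.2) ℓ (right_mem_Icc.2 hmid.2) hmid.2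
  have h4 := hC _ hmid
  have h5 := hw _ (right_mem_Icc.2 hℓ.le)
  rw [show ℓ - ℓ / 2 = ℓ / 2 by ring] at h3
  linarith only [h2, h3, h4, h5]

/-- The slope at the vertex of the exceptional pendant, when the others carry the solutions with
tip value `σ`. -/
def vertexSlope (p : ℝ) (P : ℕ) (ℓ σ : ℝ) : ℝ :=
  √(2 * pot p (sol p σ 0 ℓ)) + (P - 1) * sol' p σ 0 ℓ

theorem vertexSlope_bounds (hp : 2 < p) (hP : 2 ≤ P) (hℓ : 0 < ℓ) {σ : ℝ} (hσ : 0 < σ)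
    (hv : ∀ t ∈ Icc 0 ℓ, sol p σ 0 t < 1) :
    0 < vertexSlope p P ℓ σ ∧ vertexSlope p P ℓ σ ≤ P * sol p σ 0 ℓ ∧
      2 * pot p (sol p σ 0 ℓ) ≤ vertexSlope p P ℓ σ ^ 2 ∧ 0 < sol p σ 0 ℓ := by
  have hℓm : ℓ ∈ Icc 0 ℓ := right_mem_Icc.2 hℓ.le
  have hσ1 : σ < 1 := by
    have := hv 0 (left_mem_Icc.2 hℓ.le)
    rwa [sol_zero hp] at this
  have hc := sol_pos_of_lt_one hp hσ hσ1 ℓ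
  have hF := pot_pos hp hc ((hv ℓ hℓm).trans (one_lt_peak hp))
  have hw := sol'_nonneg_of_lt_one hp hσ hσ1 hv hℓm
  have hw2 := sol'_le_sqrt hp (pot_pos hp hσ (hσ1.trans (one_lt_peak hp))).le ℓ
  have hsq := sqrt_two_pot_le hp hc.le
  have hsp := Real.sqrt_pos.2 (show 0 < 2 * pot p (sol p σ 0 ℓ) by linarith)
  have hP1 : (1 : ℝ) ≤ P := by exact_mod_cast (by omega : 1 ≤ P)
  have hPw : 0 ≤ ((P : ℝ) - 1) * sol' p σ 0 ℓ := mul_nonneg (by linarith) hw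
  have hPw2 : ((P : ℝ) - 1) * sol' p σ 0 ℓ ≤ (P - 1) * sol p σ 0 ℓ :=
    mul_le_mul_of_nonneg_left (hw2.trans hsq) (by linarith)
  unfold vertexSlope
  refine ⟨by linarith only [hsp, hPw], by linarith only [hPw2, hsq], ?_, hc⟩
  calc _ = √(2 * pot p (sol p σ 0 ℓ)) ^ 2 := (Real.sq_sqrt (by linarith)).symm
    _ ≤ _ := by
      refine pow_le_pow_left₀ hsp.le ?_ 2
      linarith only [hPw]

theorem continuous_vertexSlope (hp : 2 < p) : Continuous (vertexSlope p P ℓ) :=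
  ((continuous_sqrt_pot hp).comp (Continuous.sol hp continuous_id continuous_const
    continuous_const)).add (continuous_const.mul
      (Continuous.sol' hp continuous_id continuous_const continuous_const))

theorem IsSol.deriv_pos_of_small (hp : 2 < p) {y z : ℝ → ℝ} (h : IsSol p y z) (hy : 0 < y 0)
    (hz : 0 < z 0) (h1 : ∀ t ∈ Icc 0 ℓ, y t < 1) : ∀ t ∈ Icc 0 ℓ, 0 < z t := by
  by_contra! hcon
  obtain ⟨t, ht, hzt, hlt⟩ := exists_first_zero h.continuous'.continuousOn hz hcon
  have hsub : Icc 0 t ⊆ Icc 0 ℓ := Icc_subset_Icc_right ht.2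
  have hm : MonotoneOn y (Icc 0 t) :=
    monotoneOn_of_hasDerivWithinAt_nonneg (convex_Icc 0 t) h.continuous.continuousOn
      (fun x _ => (h x).1.hasDerivWithinAt) fun x hx => by
        rw [interior_Icc] at hx
        exact (hlt x ⟨hx.1.le, hx.2⟩).le
  have hm' : MonotoneOn z (Icc 0 t) :=
    monotoneOn_of_hasDerivWithinAt_nonneg (convex_Icc 0 t) h.continuous'.continuousOn
      (fun x _ => (h x).2.hasDerivWithinAt) fun x hx => by
        have hx' := interior_subset hx
        exact (force_pos hp (hy.trans_le (hm (left_mem_Icc.2 ht.1.le) hx' hx'.1))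
          (h1 x (hsub hx'))).le
  have := hm' (left_mem_Icc.2 ht.1.le) (right_mem_Icc.2 ht.1.le) ht.1.le
  linarith

/-- For small `σ`, height and slope at the vertex are `O(σ)`, so on the fixed interval the
exceptional pendant stays below `1` and its slope stays positive. -/
theorem exists_small_tip (hp : 2 < p) (hP : 2 ≤ P) (hℓ : 0 < ℓ) {ε : ℝ} (hε : 0 < ε)
    (hε1 : ε < 1) : ∃ σ, 0 < σ ∧ σ < 1 ∧ ∀ t ∈ Icc 0 ℓ,
      0 < min (sol' p (sol p σ 0 ℓ) (vertexSlope p P ℓ σ) t) (ε - sol p σ 0 t) := by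
  obtain ⟨L, hL, h⟩ := sol_dist_le hp 1 ℓ
  have hP1 : (1 : ℝ) ≤ P := by exact_mod_cast (by omega : 1 ≤ P)
  have h0 : ∀ a b, |a| ≤ 1 → |b| ≤ 1 → ∀ t ∈ Icc 0 ℓ, |sol p a b t| ≤ L * max |a| |b| :=
    fun a b ha hb t ht => by
      have := (h a b 0 0 ha hb (by simp) (by simp) t (by rw [abs_of_nonneg ht.1]; exact ht.2)).1
      rwa [(sol_equilibrium hp force_zero t).1, sub_zero, sub_zero, sub_zero] at this
  have hev : ∀ᶠ σ : ℝ in 𝓝[>] 0, 0 < σ ∧ σ < 1 ∧ L * σ < ε ∧ P * (L * σ) < 1 ∧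
      L * (P * (L * σ)) < 1 := by
    have hc : ∀ {f : ℝ → ℝ} {a : ℝ}, Continuous f → f 0 < a → ∀ᶠ σ in 𝓝[>] 0, f σ < a :=
      fun hf ha => ((hf.tendsto 0).mono_left nhdsWithin_le_nhds).eventually_lt_const ha
    refine eventually_nhdsWithin_of_forall (fun x hx => hx) |>.and ((hc continuous_id one_pos).and
      ((hc (by fun_prop) (by simpa)).and ((hc (by fun_prop) (by simp)).and
        (hc (by fun_prop) (by simp)))))
  obtain ⟨σ, hσ, hσ1, hLσ, hPL, hPL2⟩ := hev.exists
  have hvσ : ∀ t ∈ Icc 0 ℓ, sol p σ 0 t ≤ L * σ := fun t ht => by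
    have := h0 σ 0 (by rw [abs_of_pos hσ]; exact hσ1.le) (by simp) t ht
    rw [abs_zero, abs_of_pos hσ, max_eq_left hσ.le] at this
    exact (le_abs_self _).trans this
  obtain ⟨hz, hzc, -, hc⟩ := vertexSlope_bounds hp hP hℓ hσ
    fun t ht => (hvσ t ht).trans_lt (hLσ.trans hε1)
  have hcL := hvσ ℓ (right_mem_Icc.2 hℓ.le)
  have hzL : vertexSlope p P ℓ σ ≤ P * (L * σ) :=
    hzc.trans (mul_le_mul_of_nonneg_left hcL (by linarith))
  have hcP : sol p σ 0 ℓ ≤ P * (L * σ) :=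
    hcL.trans (le_mul_of_one_le_left (by positivity) hP1)
  refine ⟨σ, hσ, hσ1, fun t ht => lt_min ?_ (by linarith [hvσ t ht])⟩
  refine (isSol_sol hp _ _).deriv_pos_of_small hp (by rwa [sol_zero hp]) (by rwa [sol'_zero hp])
    (fun t ht => ?_) t ht
  have := h0 (sol p σ 0 ℓ) (vertexSlope p P ℓ σ) (by rw [abs_of_pos hc]; linarith)
    (by rw [abs_of_pos hz]; linarith) t ht
  rw [abs_of_pos hc, abs_of_pos hz] at this
  exact (le_abs_self _).trans_lt (this.trans_lt
    ((mul_le_mul_of_nonneg_left (max_le hcP hzL) hL.le).trans_lt hPL2))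

/-- The solutions on the pendants of a bound-state concentrated on one pendant. -/
theorem exists_concentrated (hp : 2 < p) (hP : 2 ≤ P) {ε : ℝ} (hε : 0 < ε) (hε1 : ε < 1) :
    ∃ ℓ₁ : ℝ, 0 < ℓ₁ ∧ ∀ ℓ, ℓ₁ < ℓ → ∃ σ, 0 < σ ∧ (∀ t ∈ Icc 0 ℓ, sol p σ 0 t ≤ ε) ∧
      sol' p (sol p σ 0 ℓ) (vertexSlope p P ℓ σ) ℓ = 0 ∧
      ∀ t ∈ Icc 0 ℓ, 0 ≤ sol' p (sol p σ 0 ℓ) (vertexSlope p P ℓ σ) t := by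
  have hpk := one_lt_peak hp
  set s := (1 + peak p) / 2 with hs
  have hs1 : 1 < s := by linarith
  have hsp : s < peak p := by linarith
  set μ := √(2 * min (pot p ε) (pot p s)) with hμ
  have hμ0 : 0 < μ := Real.sqrt_pos.2 (mul_pos two_pos
    (lt_min (pot_pos hp hε (hε1.trans hpk)) (pot_pos hp (one_pos.trans hs1) hsp)))
  have hfs := force_neg_of_one_lt hp hs1
  refine ⟨max (2 * s / μ) (2 * (P + 1) / -force p s),
    lt_max_of_lt_left (div_pos (by linarith) hμ0), fun ℓ hℓ => ?_⟩
  have hℓ1 := (le_max_left _ _).trans_lt hℓ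
  have hℓ2 := (le_max_right _ _).trans_lt hℓ
  have hℓ0 : 0 < ℓ := (div_pos (by linarith) hμ0).trans hℓ1
  rw [div_lt_iff₀ hμ0] at hℓ1
  rw [div_lt_iff₀ (by linarith)] at hℓ2
  obtain ⟨α, hα, hα1, hlow⟩ := exists_small_tip hp hP hℓ0 hε hε1
  have hcz : Continuous fun σ => sol p σ 0 ℓ :=
    Continuous.sol hp continuous_id continuous_const continuous_const
  have hG : Continuous (Function.uncurry fun σ t =>
      min (sol' p (sol p σ 0 ℓ) (vertexSlope p P ℓ σ) t) (ε - sol p σ 0 t)) :=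
    (Continuous.sol' hp (hcz.comp continuous_fst)
      ((continuous_vertexSlope hp).comp continuous_fst) continuous_snd).min
      (continuous_const.sub (Continuous.sol hp continuous_fst continuous_const continuous_snd))
  -- Two constraints are shot at once: the exceptional pendant rises, and the others stay below `ε`.
  -- The endpoint `σ = 1` violates the second one already at the tip.
  obtain ⟨σ, hσ, hnn, t, ht, hzero⟩ := exists_shooting hG hℓ0.le (β := 1) hlow
    ⟨0, left_mem_Icc.2 hℓ0.le, (min_le_right _ _).trans_lt (by rw [sol_zero hp]; linarith)⟩
  rw [uIcc_of_le hα1.le] at hσ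
  have hσ0 := hα.trans_le hσ.1
  have hvε : ∀ t ∈ Icc 0 ℓ, sol p σ 0 t ≤ ε := fun t ht => by
    linarith [(hnn t ht).trans (min_le_right _ _)]
  have hv1 : ∀ t ∈ Icc 0 ℓ, sol p σ 0 t < 1 := fun t ht => (hvε t ht).trans_lt hε1
  have hσ1 : σ < 1 := by
    have := hv1 0 (left_mem_Icc.2 hℓ0.le)
    rwa [sol_zero hp] at this
  have hy' : ∀ t ∈ Icc 0 ℓ, 0 ≤ sol' p (sol p σ 0 ℓ) (vertexSlope p P ℓ σ) t := fun t ht =>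
    (hnn t ht).trans (min_le_left _ _)
  obtain ⟨hz, hzc, hzF, hc⟩ := vertexSlope_bounds hp hP hℓ0 hσ0 hv1
  have hy := isSol_sol hp (sol p σ 0 ℓ) (vertexSlope p P ℓ σ)
  have hen := fun t => hy.energy hp t 0
  simp only [sol_zero hp, sol'_zero hp] at hen
  have hP0 : (0 : ℝ) ≤ P := Nat.cast_nonneg P
  have hturn : ∃ t ∈ Icc 0 ℓ, sol' p (sol p σ 0 ℓ) (vertexSlope p P ℓ σ) t = 0 := by
    rcases min_choice (sol' p (sol p σ 0 ℓ) (vertexSlope p P ℓ σ) t) (ε - sol p σ 0 t) with h | h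
    · exact ⟨t, ht, h ▸ hzero⟩
    -- If the smallness constraint is the active one, monotonicity makes the vertex value at least
    -- `ε`, and the exceptional pendant would have to rise for longer than `IsSol.not_long_rise`
    -- allows.
    · exfalso
      rw [h] at hzero
      have hm := sol_monotoneOn hp hσ0 hσ1 hv1 ht (right_mem_Icc.2 hℓ0.le) ht.2
      refine hy.not_long_rise hp hℓ0 hε hs1 (C := P + 1) (fun t => ?_) (fun t ht => ?_)
        (by rw [sol_zero hp]; linarith) hy' (by linarith) (by linarith)
      · linarith [hen t]
      · have h2 : vertexSlope p P ℓ σ ≤ P :=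
          hzc.trans (mul_le_of_le_one_right hP0 (hv1 ℓ (right_mem_Icc.2 hℓ0.le)).le)
        have h3 := pot_le hp (sol p (sol p σ 0 ℓ) (vertexSlope p P ℓ σ) t)
        have h4 := pot_pos hp hc ((hv1 ℓ (right_mem_Icc.2 hℓ0.le)).trans hpk)
        have h5 := pow_le_pow_left₀ hz.le h2 2
        have h6 : 0 < 1 / p := by positivity
        refine abs_le_of_sq_le_sq' (a := sol' p (sol p σ 0 ℓ) (vertexSlope p P ℓ σ) t)
          (b := (P : ℝ) + 1) ?_ (by linarith) |>.2
        rw [add_sq]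
        linarith [hen t]
  exact ⟨σ, hσ0, hvε, (hy.tip hp one_ne_zero (by rw [sol'_zero hp]; exact hz.ne')
    (fun t ht => by rw [one_mul]; exact hy' t ht) hturn).1, hy'⟩

theorem sum_ite_eq_add {i₀ : Fin P} (A B : ℝ) :
    ∑ i, (if i = i₀ then A else B) = A + (P - 1) * B := by
  have : ∀ i : Fin P, (if i = i₀ then A else B) = B + if i = i₀ then A - B else 0 := fun i => by
    split_ifs <;> ring
  simp only [this, Finset.sum_add_distrib, Finset.sum_const, Finset.card_univ, Fintype.card_fin,
    Finset.sum_ite_eq', Finset.mem_univ, if_true, nsmul_eq_mul]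
  ring

/-- On long pendants there are bound-states with action close to the action of half a soliton. -/
theorem exists_isBoundState_action_lt (hp : 2 < p) (hP : 2 ≤ P) {Λ : ℝ}
    (hΛ : calib p (peak p) < Λ) : ∃ ℓ₁ : ℝ, 0 < ℓ₁ ∧ ∀ ℓ, ℓ₁ < ℓ →
      ∃ u : ForkFun P, IsBoundState p ℓ u ∧ action p ℓ u < Λ := by
  -- Since `ε < 1`, the energy on the exceptional pendant is at most `P²/2`; so `M` bounds its tip
  -- value independently of `ε`.
  obtain ⟨M, hM, hMpot⟩ := pot_coercive hp ((P : ℝ) ^ 2 / 2)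
  have hP1 : (1 : ℝ) ≤ P := by exact_mod_cast (by omega : 1 ≤ P)
  -- `P * ε * M` pays for the positive energy of the exceptional pendant and `P * ε ^ 2` for the
  -- small pendants; what is left telescopes to at most `K`.
  obtain ⟨ε, hε, hε1, hεp, hεΛ⟩ : ∃ ε : ℝ, 0 < ε ∧ ε < 1 ∧ ε ^ (p - 2) < 1 / 2 ∧
      calib p (peak p) + (P * ε * M + P * ε ^ 2) < Λ := by
    have hc : ∀ {f : ℝ → ℝ} {a : ℝ}, Continuous f → f 0 < a → ∀ᶠ σ in 𝓝[>] 0, f σ < a :=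
      fun hf ha => ((hf.tendsto 0).mono_left nhdsWithin_le_nhds).eventually_lt_const ha
    exact (eventually_nhdsWithin_of_forall (fun x hx => hx) |>.and ((hc continuous_id one_pos).and
      ((hc (continuous_rpow_sub_two hp) (by
        rw [Real.zero_rpow (by linarith)]
        norm_num)).and (hc (by fun_prop) (by simpa))))).exists
  obtain ⟨ℓ₁, hℓ₁, hcon⟩ := exists_concentrated hp hP hε hε1
  refine ⟨ℓ₁, hℓ₁, fun ℓ hℓ => ?_⟩
  have hℓ0 := hℓ₁.trans hℓ
  have hℓm : ℓ ∈ Icc 0 ℓ := right_mem_Icc.2 hℓ0.le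
  obtain ⟨σ, hσ, hvε, hturn, hy'⟩ := hcon ℓ hℓ
  have hv1 : ∀ t ∈ Icc 0 ℓ, sol p σ 0 t < 1 := fun t ht => (hvε t ht).trans_lt hε1
  have hσ1 : σ < 1 := by
    have := hv1 0 (left_mem_Icc.2 hℓ0.le)
    rwa [sol_zero hp] at this
  obtain ⟨hz, hzc, hzF, hc⟩ := vertexSlope_bounds hp hP hℓ0 hσ hv1
  have hy := isSol_sol hp (sol p σ 0 ℓ) (vertexSlope p P ℓ σ)
  have hw2 := sol'_le_sqrt hp (pot_pos hp hσ (hσ1.trans (one_lt_peak hp))).le ℓ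
  have hen := fun t => hy.energy hp t 0
  simp only [sol_zero hp, sol'_zero hp] at hen
  have hrev := hy.reverse hp hturn
  have hy0 : sol p (sol p σ 0 ℓ) (vertexSlope p P ℓ σ) 0 = sol p σ 0 ℓ := sol_zero hp _ _
  have hy0' : sol' p (sol p σ 0 ℓ) (vertexSlope p P ℓ σ) 0 = vertexSlope p P ℓ σ := sol'_zero hp _ _
  have hcε := hvε ℓ hℓm
  have hFc := pot_pos hp hc ((hv1 ℓ hℓm).trans (one_lt_peak hp))
  have hsq := sqrt_two_pot_le hp hc.le
  set c := sol p σ 0 ℓ with hc_def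
  set z := vertexSlope p P ℓ σ with hz_def
  set y := sol p c z with hy_def
  set y' := sol' p c z with hy'_def
  set E := z ^ 2 / 2 - pot p c with hE_def
  have hE0 : 0 ≤ E := by linarith
  have hzε : z ≤ P * ε := hzc.trans (mul_le_mul_of_nonneg_left hcε (by linarith))
  have hEle : 2 * E ≤ (P * ε) ^ 2 := by
    have := pow_le_pow_left₀ hz.le hzε 2
    linarith
  have hyℓ : y ℓ ≤ M := by
    refine (le_abs_self _).trans (hMpot _ ?_).le
    have h1 := hen ℓ
    rw [hturn] at h1
    have h2 : ε ^ 2 ≤ 1 := pow_le_one₀ hε.le hε1.le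
    have h3 := mul_le_mul_of_nonneg_left h2 (sq_nonneg (P : ℝ))
    rw [mul_pow] at hEle
    linarith only [h1, h3, hEle]
  obtain ⟨b, hb, hb'⟩ := exists_hl_data hp (c := c) (w := -√(2 * pot p c)) (by
    rw [neg_sq, Real.sq_sqrt (by linarith)])
  have hb0 : 0 < b := pos_of_hl_pos hp (x := 0) (hb ▸ hc)
  have hb1 : b < 1 := by
    by_contra! h
    have h1 := hl'_nonneg hp h
    have h2 := Real.sqrt_pos.2 (show 0 < 2 * pot p c by linarith)
    linarith
  set i₀ : Fin P := ⟨0, by omega⟩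
  set d : Fin P → ℝ := fun i => if i = i₀ then y ℓ else σ with hd
  have hdsum : ∀ f : ℝ → ℝ, ∑ i, f (d i) = f (y ℓ) + (P - 1) * f σ := fun f => by
    rw [← sum_ite_eq_add (i₀ := i₀)]
    exact Finset.sum_congr rfl fun i _ => apply_ite f _ _ _
  have hm : Matching p ℓ b d := by
    refine ⟨fun i => ?_, ?_⟩
    · rw [hb, hd]
      simp only
      split_ifs
      · rw [(hrev ℓ).1, sub_self, hy0]
      · rfl
    · rw [hdsum fun x => sol' p x 0 ℓ, (hrev ℓ).2, sub_self, hy0', hb', hz_def, vertexSlope]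
      ring
  refine ⟨_, isBoundState_fork hp hℓ0.le hm (Or.inl hb0.ne'), ?_⟩
  have h1 := halfLineAction_le hp hb0 hb1
  rw [hb] at h1
  have h2 : pendantAction p ℓ σ ≤ ε ^ 2 := by
    refine (pendantAction_le_of_small hp hℓ0.le fun t ht => ?_).trans ?_
    · have h3 := sol_pos_of_lt_one hp hσ hσ1 t
      rw [abs_of_pos h3]
      exact (Real.rpow_le_rpow h3.le (hvε t ht) (by linarith)).trans hεp.le
    · calc c * sol' p σ 0 ℓ ≤ c * c := mul_le_mul_of_nonneg_left (hw2.trans hsq) hc.le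
        _ ≤ ε ^ 2 := by
          rw [← sq]
          exact pow_le_pow_left₀ hc.le hcε 2
  have h3 : pendantAction p ℓ (y ℓ) ≤ calib p (peak p) - calib p c + P * ε * M := by
    have h4 : pendantAction p ℓ (y ℓ) = ∫ t in 0..ℓ, (y' t ^ 2 / 2 + pot p (y t)) := by
      have h5 := intervalIntegral.integral_comp_sub_left (a := 0) (b := ℓ)
        (fun t => y' t ^ 2 / 2 + pot p (y t)) ℓ
      rw [sub_self, sub_zero] at h5
      rw [← h5]
      simp only [pendantAction, (hrev _).1, (hrev _).2, neg_sq]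
    rw [h4]
    refine (hy.integral_lagrangian_le hp hℓ0.le hE0 (fun t => by linarith only [hen t]) hy').trans ?_
    rw [hy0]
    refine add_le_add (sub_le_sub_right (calib_le_peak hp _) _) ?_
    have h5 : √(2 * E) ≤ P * ε := Real.sqrt_le_iff.2 ⟨by positivity, hEle⟩
    calc √(2 * E) * (y ℓ - c) ≤ √(2 * E) * M :=
          mul_le_mul_of_nonneg_left (by linarith) (Real.sqrt_nonneg _)
      _ ≤ P * ε * M := mul_le_mul_of_nonneg_right h5 hM.le
  have h4 := mul_le_mul_of_nonneg_left h2 (show (0 : ℝ) ≤ P - 1 by linarith)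
  have h5 := sq_nonneg ε
  rw [action_fork hp hℓ0.le, hdsum]
  linarith only [h1, h3, h4, h5, hεΛ]

/-- On long pendants there are action ground-states, and none is core-symmetric. -/
theorem exists_forall_not_isCoreSymmetric (hp : 2 < p) (hP : 2 ≤ P) :
    ∃ ℓ₁ : ℝ, 0 < ℓ₁ ∧ ∀ ℓ : ℝ, ℓ₁ < ℓ → (∃ u : ForkFun P, IsGroundState p ℓ u) ∧
      ∀ u : ForkFun P, IsGroundState p ℓ u → ¬ IsCoreSymmetric ℓ u := by
  obtain ⟨Λ, ℓ₁, hΛ1, hΛ2, hℓ₁, hsym⟩ := exists_lt_action_of_symmetric hp hP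
  obtain ⟨ℓ₂, -, hlow⟩ := exists_isBoundState_action_lt hp hP hΛ1
  refine ⟨max ℓ₁ ℓ₂, lt_max_of_lt_left hℓ₁, fun ℓ hℓ => ?_⟩
  obtain ⟨hℓ1, hℓ2⟩ := max_lt_iff.1 hℓ
  obtain ⟨v, hv, hact⟩ := hlow ℓ hℓ2
  refine ⟨exists_isGroundState hp (hℓ₁.trans hℓ1) hv (hact.trans hΛ2), fun u hu hs => ?_⟩
  exact ((hsym ℓ hℓ1 u hu.1 hs).trans (hu.2 v hv)).not_gt hact

end Fork

end

theorem mainTheorem9 (p : ℝ) (hp : 2 < p) (P : ℕ) (hP : 2 ≤ P) :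
    (∀ ℓ : ℝ, 0 < ℓ →
      (∃ u : ForkFun P, ForkFun.IsIncSymPosBoundState p ℓ u ∧
        ∀ v : ForkFun P, ForkFun.IsIncSymPosBoundState p ℓ v → ForkFun.SameOn ℓ v u) ∧
      (ℓ ≤ Real.arsinh (1 / Real.sqrt ((P : ℝ) ^ 2 - 1)) →
        ¬ ∃ u : ForkFun P, ForkFun.IsCoreDecSymPosBoundState p ℓ u) ∧
      (Real.arsinh (1 / Real.sqrt ((P : ℝ) ^ 2 - 1)) < ℓ →
        ∃ u : ForkFun P, ForkFun.IsCoreDecSymPosBoundState p ℓ u ∧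
          ∀ v : ForkFun P, ForkFun.IsCoreDecSymPosBoundState p ℓ v → ForkFun.SameOn ℓ v u)) ∧
    (∃ ℓ₀ : ℝ, 0 < ℓ₀ ∧ ∀ ℓ : ℝ, 0 < ℓ → ℓ < ℓ₀ →
      ∀ w : ForkFun P, ForkFun.IsIncSymPosBoundState p ℓ w →
        ForkFun.IsGroundState p ℓ w ∧
        ∀ u : ForkFun P, ForkFun.IsGroundState p ℓ u →
          ForkFun.SameOn ℓ u w ∨ ForkFun.SameOn ℓ u (-w)) ∧
    (∃ ℓ₁ : ℝ, 0 < ℓ₁ ∧ ∀ ℓ : ℝ, ℓ₁ < ℓ →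
      (∃ u : ForkFun P, ForkFun.IsGroundState p ℓ u) ∧
      ∀ u : ForkFun P, ForkFun.IsGroundState p ℓ u → ¬ ForkFun.IsCoreSymmetric ℓ u) :=
  ⟨fun ℓ hℓ => ⟨by
      obtain ⟨u, hu⟩ := Fork.exists_isIncSymPosBoundState hp hP hℓ
      exact ⟨u, hu, fun _ hv => Fork.IsIncSymPosBoundState.sameOn hp hP hℓ hu hv⟩,
    fun hle ⟨_, hu⟩ => (Fork.IsCoreDecSymPosBoundState.threshold_lt hp hP hℓ hu).not_ge hle,
    fun hlt => by
      obtain ⟨u, hu⟩ := Fork.exists_isCoreDecSymPosBoundState hp hP hlt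
      exact ⟨u, hu, fun _ hv => Fork.IsCoreDecSymPosBoundState.sameOn hp hP hℓ hu hv⟩⟩,
    Fork.exists_forall_isGroundState hp hP, Fork.exists_forall_not_isCoreSymmetric hp hP⟩
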